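/- Model of computation: the real RAM. Its memory consists of registers and arrays of exact real numbers and of registers and arrays of machine words of $O(\log n)$ bits, i.e. natural numbers at most $(n+1)^{K}$ for a constant $K$; arrays are addressed indirectly by words. The operations $+,-,\times,\div$, square root and comparison on reals, the operations $+,-,\times,\lfloor\cdot/\cdot\rfloor$ and comparison on words, rational and natural constants, and reading and writing memory cells take unit time; there is no conversion of reals into words. A circle with centre $c\in\mathbb R^2$ and radius $r\ge 0$ is identified with the closed disk that it bounds (for $r=0$ this is the point $c$). For a finite set $P\subset\mathbb R^2$ and a closed disk or a point $Q$, a circle $C$ is a separating circle for $P$ and $Q$ if $P\subseteq C$ and the interior of $C$ does not meet $Q$; a minimum separating circle is a separating circle of minimum radius. Statement: there are two fixed programs (preprocessing and query), independent of $n$, $P$ and $Q$, and a constant $K$, such that for every set $P$ of $n\ge 1$ distinct points in the plane the following holds. Given $P$, the preprocessing program halts after at most $K\,n(\lfloor\log_2 n\rfloor+1)=O(n\log n)$ steps. Afterwards any sequence of queries can be answered: whenever the query program is given a query circle or point $Q$ (by its centre and its radius, the radius being $0$ for a point), it halts after at most $K(\lfloor\log_2 n\rfloor+1)=O(\log n)$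 steps, and it outputs the centre and the radius of a minimum separating circle for $P$ and $Q$ if a separating circle exists, and reports that there is none otherwise. -/

import Mathlib

namespace CircleSep

/-! ### Geometry -/

/-- The Euclidean plane. -/
abbrev Plane : Type := EuclideanSpace ℝ (Fin 2)

/-- A circle, given by its centre and its radius. It bounds the closed disk `Circle.region`, and
"contained in the circle" refers to that disk. Radius `0` is allowed: then the disk is a point. -/
structure Circle where
  center : Plane
  radius : ℝ
  radius_nonneg : 0 ≤ radius

/-- The closed disk bounded by a circle. -/
def Circle.region (C : Circle) : Set Plane := Metric.closedBall C.center C.radius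

/-- `C` separates the points `P` from `Q`: it contains `P` and its interior does not meet `Q`. -/
def IsSeparating {n : ℕ} (P : Fin n → Plane) (Q : Set Plane) (C : Circle) : Prop :=
  (∀ i, P i ∈ C.region) ∧ Disjoint (interior C.region) Q

/-- `C` is a separating circle of minimum radius. -/
def IsMinSeparating {n : ℕ} (P : Fin n → Plane) (Q : Set Plane) (C : Circle) : Prop :=
  IsSeparating P Q C ∧ ∀ C' : Circle, IsSeparating P Q C' → C.radius ≤ C'.radius

/-! ### A real RAM

The memory has registers and arrays for machine words (natural numbers, used as counters and
pointers), and registers and arrays for exact real numbers. Arrays are addressed indirectly, by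
words. There is no conversion of reals into words (in particular no floor function). A program is a
finite text of a structured imperative language. -/

/-- The memory of the machine. -/
structure State where
  /-- word registers -/
  word : ℕ → ℕ
  /-- real registers -/
  real : ℕ → ℝ
  /-- arrays of words -/
  wordArr : ℕ → ℕ → ℕ
  /-- arrays of reals -/
  realArr : ℕ → ℕ → ℝ

/-- Word expressions. -/
inductive WExp : Type
  | const (k : ℕ)
  | reg (x : ℕ)
  | get (a : ℕ) (i : WExp)
  | add (e f : WExp)
  | sub (e f : WExp)
  | mul (e f : WExp)
  | div (e f : WExp)

/-- The value of a word expression (subtraction is truncated, division rounds down). -/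
def WExp.eval (s : State) : WExp → ℕ
  | .const k => k
  | .reg x => s.word x
  | .get a i => s.wordArr a (i.eval s)
  | .add e f => e.eval s + f.eval s
  | .sub e f => e.eval s - f.eval s
  | .mul e f => e.eval s * f.eval s
  | .div e f => e.eval s / f.eval s

/-- Real expressions: rational constants, the four arithmetic operations and square roots. -/
inductive RExp : Type
  | const (q : ℚ)
  | reg (x : ℕ)
  | get (a : ℕ) (i : WExp)
  | add (e f : RExp)
  | sub (e f : RExp)
  | mul (e f : RExp)
  | div (e f : RExp)
  | sqrt (e : RExp)

/-- The value of a real expression. -/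
noncomputable def RExp.eval (s : State) : RExp → ℝ
  | .const q => (q : ℝ)
  | .reg x => s.real x
  | .get a i => s.realArr a (i.eval s)
  | .add e f => e.eval s + f.eval s
  | .sub e f => e.eval s - f.eval s
  | .mul e f => e.eval s * f.eval s
  | .div e f => e.eval s / f.eval s
  | .sqrt e => Real.sqrt (e.eval s)

/-- Tests: comparisons of words, comparisons of reals, and Boolean combinations. -/
inductive Test : Type
  | wordLt (e f : WExp)
  | wordEq (e f : WExp)
  | realLt (e f : RExp)
  | realEq (e f : RExp)
  | neg (b : Test)
  | conj (b c : Test)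
  | disj (b c : Test)

/-- The truth of a test in a state. -/
def Test.holds (s : State) : Test → Prop
  | .wordLt e f => e.eval s < f.eval s
  | .wordEq e f => e.eval s = f.eval s
  | .realLt e f => e.eval s < f.eval s
  | .realEq e f => e.eval s = f.eval s
  | .neg b => ¬ b.holds s
  | .conj b c => b.holds s ∧ c.holds s
  | .disj b c => b.holds s ∨ c.holds s

/-- Programs. -/
inductive Prog : Type
  | skip
  | setWord (x : ℕ) (e : WExp)
  | setReal (x : ℕ) (e : RExp)
  | putWord (a : ℕ) (i : WExp) (e : WExp)
  | putReal (a : ℕ) (i : WExp) (e : RExp)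
  | seq (c d : Prog)
  | branch (b : Test) (c d : Prog)
  | loop (b : Test) (c : Prog)

/-- Write a word register. -/
def State.setWord (s : State) (x v : ℕ) : State :=
  { s with word := Function.update s.word x v }

/-- Write a real register. -/
def State.setReal (s : State) (x : ℕ) (v : ℝ) : State :=
  { s with real := Function.update s.real x v }

/-- Write an entry of an array of words. -/
def State.putWord (s : State) (a i v : ℕ) : State :=
  { s with wordArr := Function.update s.wordArr a (Function.update (s.wordArr a) i v) }

/-- Write an entry of an array of reals. -/
def State.putReal (s : State) (a i : ℕ) (v : ℝ) : State :=
  { s with realArr := Function.update s.realArr a (Function.update (s.realArr a) i v) }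

/-- `Exec W c s s' t`: on a machine whose words hold the numbers up to `W`, the program `c` started
in the memory `s` halts in the memory `s'` after `t` steps. Every assignment and every evaluation of
the test of a branch or of a loop is one step (the expressions of a fixed program have bounded size,
so that a step is a bounded number of elementary operations). A program that tries to store a
number larger than `W` as a word has no execution. -/
inductive Exec (W : ℕ) : Prog → State → State → ℕ → Prop
  | skip (s : State) : Exec W .skip s s 1
  | setWord (s : State) (x : ℕ) (e : WExp) (h : e.eval s ≤ W) :
      Exec W (.setWord x e) s (s.setWord x (e.eval s)) 1
  | setReal (s : State) (x : ℕ) (e : RExp) :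
      Exec W (.setReal x e) s (s.setReal x (e.eval s)) 1
  | putWord (s : State) (a : ℕ) (i e : WExp) (hi : i.eval s ≤ W) (h : e.eval s ≤ W) :
      Exec W (.putWord a i e) s (s.putWord a (i.eval s) (e.eval s)) 1
  | putReal (s : State) (a : ℕ) (i : WExp) (e : RExp) (hi : i.eval s ≤ W) :
      Exec W (.putReal a i e) s (s.putReal a (i.eval s) (e.eval s)) 1
  | seq {c d : Prog} {s s₁ s₂ : State} {t₁ t₂ : ℕ} (h₁ : Exec W c s s₁ t₁)
      (h₂ : Exec W d s₁ s₂ t₂) : Exec W (.seq c d) s s₂ (t₁ + t₂)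
  | branchTrue {b : Test} {c d : Prog} {s s' : State} {t : ℕ} (hb : b.holds s)
      (h : Exec W c s s' t) : Exec W (.branch b c d) s s' (t + 1)
  | branchFalse {b : Test} {c d : Prog} {s s' : State} {t : ℕ} (hb : ¬ b.holds s)
      (h : Exec W d s s' t) : Exec W (.branch b c d) s s' (t + 1)
  | loopDone {b : Test} {c : Prog} {s : State} (hb : ¬ b.holds s) :
      Exec W (.loop b c) s s 1
  | loopStep {b : Test} {c : Prog} {s s₁ s₂ : State} {t₁ t₂ : ℕ} (hb : b.holds s)
      (h₁ : Exec W c s s₁ t₁) (h₂ : Exec W (.loop b c) s₁ s₂ t₂) :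
      Exec W (.loop b c) s s₂ (t₁ + t₂ + 1)

/-! ### Input and output -/

/-- The initial memory: the number `n` of points in word register `0`, the coordinates of the points
in the real arrays `0` and `1`, and zero everywhere else. -/
noncomputable def inputState {n : ℕ} (P : Fin n → Plane) : State where
  word x := if x = 0 then n else 0
  real _ := 0
  wordArr _ _ := 0
  realArr a i := if h : i < n then (if a = 0 then P ⟨i, h⟩ 0 else if a = 1 then P ⟨i, h⟩ 1 else 0) else 0

/-- A query circle is entered into the real registers `0`, `1`, `2`: the two coordinates of the
centre and the radius. -/
def State.enter (s : State) (Q : Circle) : State :=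
  ((s.setReal 0 (Q.center 0)).setReal 1 (Q.center 1)).setReal 2 Q.radius

/-- The real registers `0`, `1`, `2` hold the circle `C`. -/
def State.Shows (s : State) (C : Circle) : Prop :=
  s.real 0 = C.center 0 ∧ s.real 1 = C.center 1 ∧ s.real 2 = C.radius

/-- The memory holds the right answer to the query `Q`: either word register `1` holds `1` and the
real registers hold the minimum separating circle, or word register `1` holds `0` and there is no
separating circle. -/
def State.Answers {n : ℕ} (s : State) (P : Fin n → Plane) (Q : Circle) : Prop :=
  (s.word 1 = 1 ∧ ∃ C : Circle, IsMinSeparating P Q.region C ∧ s.Shows C) ∨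
    (s.word 1 = 0 ∧ ∀ C : Circle, ¬ IsSeparating P Q.region C)

end CircleSep

namespace CircleSep

/-! ### Bounded execution -/

/-! A circle with centre `c` and radius `r` solves the query with centre `q` and radius `ρ` if it
contains all points and `r + ρ ≤ dist c q`. The preprocessing builds the farthest-point
triangulation: a triangulation of the convex hull in which the circumcircle of every triangle
contains all points.

Certificates. For an edge `u v`, the smallest circle that contains `u` and `v` and avoids the query
passes through both points and is unique (`pairOpt_bis`, `PairOpt.unique`). If it does not exist,
there is no separating circle. If it contains the apexes of the two triangles at the edge, it
contains all points (`edgeOk_of_guard`) and is therefore optimal. Otherwise it misses an apex, and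
the edge points to that side. If all three edges of a triangle point inward, the circumcircle of the
triangle is the only candidate (`circum_min`): a feasible circle can be shrunk towards its farthest
vertex until it passes through two vertices, and then its centre can be moved along their bisector
to the circumcentre. Feasibility survives the second motion because the feasible centres on a
bisector form an interval (`Ok.convex`).

Search. Below the two sides of a root edge the triangles form binary trees, possibly of linear
depth. Every triangle gets a rank such that each triangle sees at most one triangle of every rank
below it; a triangle hides everything of smaller rank beneath it (`RowOk`). A query keeps a triangle
`y` whose base points into it and visits the triangles visible from `y` by decreasing rank. A visit
answers the query, or replaces `y` by a child of the visited triangle, or shows that the base of the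
visited triangle does not point into it. Since `y` sees itself, the columns cannot run out without
an answer (`SearchInv.pos`). Ranks arise as the carry position of a binary addition (`RankUpTo`), so
the visible ranks, read as a binary number, are bounded by the number of positions under a base
(`mask_newRow`), and `Nat.log 2 n + 1` columns suffice.

Construction. The lexicographically first point becomes the origin, and the others are sorted by
angle around it and linked to a chain. A circle is encoded by the excess `exc`, the squared norm
minus an affine function; at the origin it equals `-C`. Reflex vertices are dropped first, which
leaves the hull; then the ear whose circle has the greatest `C` is cut off repeatedly. That circle
contains the rest of the chain by a discrete concavity argument (`concave_step`, `Chain.exc_nonpos`)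
and the vertices cut off before by comparison with the older circles (`Forest.circ_new`). A cut
changes two keys in a tournament and fills one row of the rank table, which costs logarithmic time.

Programs are verified by `Run`, which couples a time bound with a postcondition; `wp` evaluates
loop-free code, and `Exec.agree` carries unchanged cells across it. -/

/-- `c` halts from `s` within `T` steps in a memory satisfying `Q`. -/
def Run (W : ℕ) (c : Prog) (s : State) (T : ℕ) (Q : State → Prop) : Prop :=
  ∃ s' t, Exec W c s s' t ∧ t ≤ T ∧ Q s'

infixr:60 " ;; " => Prog.seq

theorem Run.mono {W : ℕ} {c : Prog} {s : State} {T T' : ℕ} {Q Q' : State → Prop}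
    (h : Run W c s T Q) (hT : T ≤ T') (hQ : ∀ s', Q s' → Q' s') : Run W c s T' Q' := by
  obtain ⟨s', t, h1, h2, h3⟩ := h
  exact ⟨s', t, h1, h2.trans hT, hQ _ h3⟩

theorem Run.seq {W : ℕ} {c d : Prog} {s : State} {T₁ T₂ : ℕ} {Q R : State → Prop}
    (h : Run W c s T₁ R) (h' : ∀ s', R s' → Run W d s' T₂ Q) :
    Run W (c ;; d) s (T₁ + T₂) Q := by
  obtain ⟨s', t, h1, h2, h3⟩ := h
  obtain ⟨s'', t', h1', h2', h3'⟩ := h' _ h3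
  exact ⟨s'', t + t', .seq h1 h1', by omega, h3'⟩

theorem Run.branch {W : ℕ} {b : Test} {c d : Prog} {s : State} {T : ℕ} {Q : State → Prop}
    (h : b.holds s → Run W c s T Q) (h' : ¬ b.holds s → Run W d s T Q) :
    Run W (.branch b c d) s (T + 1) Q := by
  by_cases hb : b.holds s
  · obtain ⟨s', t, h1, h2, h3⟩ := h hb
    exact ⟨s', t + 1, .branchTrue hb h1, by omega, h3⟩
  · obtain ⟨s', t, h1, h2, h3⟩ := h' hb
    exact ⟨s', t + 1, .branchFalse hb h1, by omega, h3⟩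

/-- A loop whose `i`-th iteration turns `I i` into `I (i + 1)` and which iterates only while
`i < N`. -/
theorem Run.loop {W : ℕ} {b : Test} {c : Prog} {T : ℕ} {Q : State → Prop} (N : ℕ)
    (I : ℕ → State → Prop)
    (step : ∀ i s, I i s → b.holds s → i < N ∧ Run W c s T (I (i + 1)))
    (done : ∀ i s, I i s → ¬ b.holds s → Q s) {i : ℕ} {s : State} (h : I i s) :
    Run W (.loop b c) s ((N - i) * (T + 1) + 1) Q := by
  induction hk : N - i generalizing i s with
  | zero =>
    have hb : ¬ b.holds s := fun hb => by have := (step i s h hb).1; omega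
    exact ⟨s, 1, .loopDone hb, by omega, done _ _ h hb⟩
  | succ k ih =>
    by_cases hb : b.holds s
    · obtain ⟨hi, s', t, h1, h2, h3⟩ := step i s h hb
      obtain ⟨s'', t', h1', h2', h3'⟩ := ih h3 (by omega)
      exact ⟨s'', t + t' + 1, .loopStep hb h1 h1', by linarith, h3'⟩
    · exact ⟨s, 1, .loopDone hb, by omega, done _ _ h hb⟩

/-- An upper bound for the running time of loop-free programs. -/
def Prog.cost : Prog → ℕ
  | .seq c d => c.cost + d.cost
  | .branch _ c d => max c.cost d.cost + 1
  | _ => 1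

/-- The weakest precondition of loop-free programs. -/
def wp (W : ℕ) : Prog → (State → Prop) → State → Prop
  | .skip, Q, s => Q s
  | .setWord x e, Q, s => e.eval s ≤ W ∧ Q (s.setWord x (e.eval s))
  | .setReal x e, Q, s => Q (s.setReal x (e.eval s))
  | .putWord a i e, Q, s => i.eval s ≤ W ∧ e.eval s ≤ W ∧ Q (s.putWord a (i.eval s) (e.eval s))
  | .putReal a i e, Q, s => i.eval s ≤ W ∧ Q (s.putReal a (i.eval s) (e.eval s))
  | .seq c d, Q, s => wp W c (wp W d Q) s
  | .branch b c d, Q, s => (b.holds s → wp W c Q s) ∧ (¬ b.holds s → wp W d Q s)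
  | .loop _ _, _, _ => False

/-- Straight-line code is verified by unfolding `wp`. As `wp` of a loop is `False`, loops need a
rule with an explicit invariant. -/
theorem Run.of_wp {W : ℕ} {c : Prog} {s : State} {Q : State → Prop} (h : wp W c Q s) :
    Run W c s c.cost Q := by
  induction c generalizing s Q with
  | skip => exact ⟨s, 1, .skip s, le_rfl, h⟩
  | setWord x e => exact ⟨_, 1, .setWord s x e h.1, le_rfl, h.2⟩
  | setReal x e => exact ⟨_, 1, .setReal s x e, le_rfl, h⟩
  | putWord a i e => exact ⟨_, 1, .putWord s a i e h.1 h.2.1, le_rfl, h.2.2⟩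
  | putReal a i e => exact ⟨_, 1, .putReal s a i e h.1, le_rfl, h.2⟩
  | seq c d ihc ihd => exact Run.seq (ihc h) fun s' h' => ihd h'
  | branch b c d ihc ihd =>
    exact Run.branch (fun hb => (ihc (h.1 hb)).mono (le_max_left _ _) fun _ h => h)
      (fun hb => (ihd (h.2 hb)).mono (le_max_right _ _) fun _ h => h)
  | loop b c => exact h.elim

/-! ### Frames -/

/-- The cells that a program may write: `(kind, index)`, the kinds being word registers, real
registers, word arrays and real arrays. -/
def Prog.mods : Prog → List (Fin 4 × ℕ)
  | .skip => []
  | .setWord x _ => [(0, x)]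
  | .setReal x _ => [(1, x)]
  | .putWord a _ _ => [(2, a)]
  | .putReal a _ _ => [(3, a)]
  | .seq c d => c.mods ++ d.mods
  | .branch _ c d => c.mods ++ d.mods
  | .loop _ c => c.mods

/-- `s` and `s'` agree outside of the cells listed in `l`. -/
structure Agree (l : List (Fin 4 × ℕ)) (s s' : State) : Prop where
  word : ∀ x, (0, x) ∉ l → s'.word x = s.word x
  real : ∀ x, (1, x) ∉ l → s'.real x = s.real x
  wordArr : ∀ x, (2, x) ∉ l → s'.wordArr x = s.wordArr x
  realArr : ∀ x, (3, x) ∉ l → s'.realArr x = s.realArr x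

theorem Agree.refl (l : List (Fin 4 × ℕ)) (s : State) : Agree l s s :=
  ⟨fun _ _ => rfl, fun _ _ => rfl, fun _ _ => rfl, fun _ _ => rfl⟩

theorem Agree.trans {l : List (Fin 4 × ℕ)} {s s' s'' : State} (h : Agree l s s')
    (h' : Agree l s' s'') : Agree l s s'' :=
  ⟨fun x hx => (h'.word x hx).trans (h.word x hx), fun x hx => (h'.real x hx).trans (h.real x hx),
    fun x hx => (h'.wordArr x hx).trans (h.wordArr x hx),
    fun x hx => (h'.realArr x hx).trans (h.realArr x hx)⟩

theorem Agree.mono {l l' : List (Fin 4 × ℕ)} {s s' : State} (h : Agree l s s') (hl : l ⊆ l') :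
    Agree l' s s' :=
  ⟨fun x hx => h.word x fun h => hx (hl h), fun x hx => h.real x fun h => hx (hl h),
    fun x hx => h.wordArr x fun h => hx (hl h), fun x hx => h.realArr x fun h => hx (hl h)⟩

/-- The frame depends on the text of the program only, so membership in `Prog.mods` can be settled
by `decide` whenever an old value has to be carried across a piece of code. -/
theorem Exec.agree {W : ℕ} {c : Prog} {s s' : State} {t : ℕ} (h : Exec W c s s' t) :
    Agree c.mods s s' := by
  induction h with
  | skip s => exact .refl _ _
  | setWord s x e h =>
    refine ⟨fun y hy => ?_, fun _ _ => rfl, fun _ _ => rfl, fun _ _ => rfl⟩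
    have : y ≠ x := by rintro rfl; simp [Prog.mods] at hy
    simp [State.setWord, this]
  | setReal s x e =>
    refine ⟨fun _ _ => rfl, fun y hy => ?_, fun _ _ => rfl, fun _ _ => rfl⟩
    have : y ≠ x := by rintro rfl; simp [Prog.mods] at hy
    simp [State.setReal, this]
  | putWord s x i e h =>
    refine ⟨fun _ _ => rfl, fun _ _ => rfl, fun y hy => ?_, fun _ _ => rfl⟩
    have : y ≠ x := by rintro rfl; simp [Prog.mods] at hy
    simp [State.putWord, this]
  | putReal s x i e h =>
    refine ⟨fun _ _ => rfl, fun _ _ => rfl, fun _ _ => rfl, fun y hy => ?_⟩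
    have : y ≠ x := by rintro rfl; simp [Prog.mods] at hy
    simp [State.putReal, this]
  | seq h₁ h₂ ih₁ ih₂ =>
    exact (ih₁.mono (List.subset_append_left _ _)).trans (ih₂.mono (List.subset_append_right _ _))
  | branchTrue hb h ih => exact ih.mono (List.subset_append_left _ _)
  | branchFalse hb h ih => exact ih.mono (List.subset_append_right _ _)
  | loopDone hb => exact .refl _ _
  | loopStep hb h₁ h₂ ih₁ ih₂ => exact ih₁.trans ih₂

theorem Run.agree {W : ℕ} {c : Prog} {s : State} {T : ℕ} {Q : State → Prop}
    (h : Run W c s T Q) : Run W c s T fun s' => Q s' ∧ Agree c.mods s s' := by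
  obtain ⟨s', t, h1, h2, h3⟩ := h
  exact ⟨s', t, h1, h2, h3, h1.agree⟩

/-! ### Notation for expressions, and simplification of memory accesses -/

instance : Add WExp := ⟨.add⟩
instance : Sub WExp := ⟨.sub⟩
instance : Mul WExp := ⟨.mul⟩
instance : Div WExp := ⟨.div⟩
instance (k : ℕ) : OfNat WExp k := ⟨.const k⟩
instance : Add RExp := ⟨.add⟩
instance : Sub RExp := ⟨.sub⟩
instance : Mul RExp := ⟨.mul⟩
instance : Div RExp := ⟨.div⟩
instance (k : ℕ) : OfNat RExp k := ⟨.const k⟩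

namespace State
variable (s : State)

@[simp] theorem setWord_word (x v y : ℕ) :
    (s.setWord x v).word y = if y = x then v else s.word y := by
  simp [setWord, Function.update_apply]
@[simp] theorem setWord_real (x v : ℕ) : (s.setWord x v).real = s.real := rfl
@[simp] theorem setWord_wordArr (x v : ℕ) : (s.setWord x v).wordArr = s.wordArr := rfl
@[simp] theorem setWord_realArr (x v : ℕ) : (s.setWord x v).realArr = s.realArr := rfl
@[simp] theorem setReal_real (x : ℕ) (v : ℝ) (y : ℕ) :
    (s.setReal x v).real y = if y = x then v else s.real y := by
  simp [setReal, Function.update_apply]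
@[simp] theorem setReal_word (x : ℕ) (v : ℝ) : (s.setReal x v).word = s.word := rfl
@[simp] theorem setReal_wordArr (x : ℕ) (v : ℝ) : (s.setReal x v).wordArr = s.wordArr := rfl
@[simp] theorem setReal_realArr (x : ℕ) (v : ℝ) : (s.setReal x v).realArr = s.realArr := rfl
@[simp] theorem putWord_wordArr (a i v b : ℕ) :
    (s.putWord a i v).wordArr b = if b = a then Function.update (s.wordArr a) i v
      else s.wordArr b := by
  simp [putWord, Function.update_apply]
@[simp] theorem putWord_word (a i v : ℕ) : (s.putWord a i v).word = s.word := rfl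
@[simp] theorem putWord_real (a i v : ℕ) : (s.putWord a i v).real = s.real := rfl
@[simp] theorem putWord_realArr (a i v : ℕ) : (s.putWord a i v).realArr = s.realArr := rfl
@[simp] theorem putReal_realArr (a i : ℕ) (v : ℝ) (b : ℕ) :
    (s.putReal a i v).realArr b = if b = a then Function.update (s.realArr a) i v
      else s.realArr b := by
  simp [putReal, Function.update_apply]
@[simp] theorem putReal_word (a i : ℕ) (v : ℝ) : (s.putReal a i v).word = s.word := rfl
@[simp] theorem putReal_real (a i : ℕ) (v : ℝ) : (s.putReal a i v).real = s.real := rfl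
@[simp] theorem putReal_wordArr (a i : ℕ) (v : ℝ) : (s.putReal a i v).wordArr = s.wordArr := rfl

end State

section Eval
variable (s : State)

@[simp] theorem WExp.eval_ofNat (k : ℕ) : (no_index (OfNat.ofNat k) : WExp).eval s = OfNat.ofNat k := rfl
@[simp] theorem WExp.eval_reg (x : ℕ) : (WExp.reg x).eval s = s.word x := rfl
@[simp] theorem WExp.eval_get (a : ℕ) (i : WExp) :
    (WExp.get a i).eval s = s.wordArr a (i.eval s) := rfl
@[simp] theorem WExp.eval_add (e f : WExp) : (e + f).eval s = e.eval s + f.eval s := rfl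
@[simp] theorem WExp.eval_sub (e f : WExp) : (e - f).eval s = e.eval s - f.eval s := rfl
@[simp] theorem WExp.eval_mul (e f : WExp) : (e * f).eval s = e.eval s * f.eval s := rfl
@[simp] theorem WExp.eval_div (e f : WExp) : (e / f).eval s = e.eval s / f.eval s := rfl
@[simp] theorem RExp.eval_ofNat (k : ℕ) : (no_index (OfNat.ofNat k) : RExp).eval s =
    ((OfNat.ofNat k : ℕ) : ℝ) := by
  show ((k : ℚ) : ℝ) = (k : ℕ)
  simp
@[simp] theorem RExp.eval_reg (x : ℕ) : (RExp.reg x).eval s = s.real x := rfl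
@[simp] theorem RExp.eval_get (a : ℕ) (i : WExp) :
    (RExp.get a i).eval s = s.realArr a (i.eval s) := rfl
@[simp] theorem RExp.eval_add (e f : RExp) : (e + f).eval s = e.eval s + f.eval s := rfl
@[simp] theorem RExp.eval_sub (e f : RExp) : (e - f).eval s = e.eval s - f.eval s := rfl
@[simp] theorem RExp.eval_mul (e f : RExp) : (e * f).eval s = e.eval s * f.eval s := rfl
@[simp] theorem RExp.eval_div (e f : RExp) : (e / f).eval s = e.eval s / f.eval s := rfl
@[simp] theorem RExp.eval_sqrt (e : RExp) : (RExp.sqrt e).eval s = Real.sqrt (e.eval s) := rfl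

end Eval

attribute [simp] Test.holds

end CircleSep

namespace CircleSep

/-! ### The programs

Word registers: `2` holds `m = n - 1`, `3` the number of columns of the rank table, `4` the last
vertex of the chain, `5` the number of leaves of the tournament, `6` the item to be handled, `7` the
current node of the tournament; the other ones are temporary.

Word arrays: `0` winners of the tournament, `1` class of an item, `2` successor and `3` predecessor
in the chain, `4` triangle below the edge that starts at a vertex, `5` left child of a triangle,
`6` opposite apex of a triangle, `7` the rank table.

Real arrays: `2` and `3` coordinates (relative to the base point) by position, `4` and `5` keys.

Real registers: `3` and `4` the base point; the other ones are temporary. -/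

/-- a word register -/
abbrev wr (x : ℕ) : WExp := .reg x
/-- a real register -/
abbrev rr (x : ℕ) : RExp := .reg x
/-- an entry of a word array -/
abbrev wa (a : ℕ) (i : WExp) : WExp := .get a i
/-- an entry of a real array -/
abbrev ra (a : ℕ) (i : WExp) : RExp := .get a i

/-- item `j` loses against item `i` -/
def better (i j : WExp) : Test :=
  .disj (.wordLt (wa 1 j) (wa 1 i)) (.conj (.wordEq (wa 1 j) (wa 1 i))
    (.disj (.realLt (ra 4 j) (ra 4 i)) (.conj (.realEq (ra 4 j) (ra 4 i))
      (.realLt (ra 5 j) (ra 5 i)))))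

/-- play the match at node `7` of the tournament -/
def pull : Prog :=
  .branch (better (wa 0 (2 * wr 7 + 1)) (wa 0 (2 * wr 7)))
    (.putWord 0 (wr 7) (wa 0 (2 * wr 7 + 1))) (.putWord 0 (wr 7) (wa 0 (2 * wr 7)))

/-- fill the leaves of the tournament -/
def leaves : Prog :=
  .setWord 7 0 ;; .loop (.wordLt (wr 7) (wr 5))
    (.putWord 0 (wr 5 + wr 7) (wr 7) ;; .setWord 7 (wr 7 + 1))

/-- play all matches of the tournament -/
def matches_ : Prog :=
  .setWord 7 (wr 5 - 1) ;; .loop (.wordLt 0 (wr 7)) (pull ;; .setWord 7 (wr 7 - 1))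

/-- build the tournament -/
def build : Prog := leaves ;; matches_

/-- replay the matches of item `6` -/
def climb : Prog :=
  .setWord 7 ((wr 5 + wr 6) / 2) ;; .loop (.wordLt 0 (wr 7)) (pull ;; .setWord 7 (wr 7 / 2))

/-- find the lexicographically first point (register `9`) -/
def findBase : Prog :=
  .setWord 9 0 ;; .setWord 8 1 ;;
  .loop (.wordLt (wr 8) (wr 0))
    (.branch (.disj (.realLt (ra 0 (wr 8)) (ra 0 (wr 9)))
        (.conj (.realEq (ra 0 (wr 8)) (ra 0 (wr 9))) (.realLt (ra 1 (wr 8)) (ra 1 (wr 9)))))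
      (.setWord 9 (wr 8)) .skip ;; .setWord 8 (wr 8 + 1)) ;;
  .setReal 3 (ra 0 (wr 9)) ;; .setReal 4 (ra 1 (wr 9)) ;; .setWord 2 (wr 0 - 1)

/-- count the binary digits of `n` -/
def digits : Prog :=
  .setWord 3 0 ;; .setWord 8 (wr 0) ;;
  .loop (.wordLt 0 (wr 8)) (.setWord 8 (wr 8 / 2) ;; .setWord 3 (wr 3 + 1))

/-- the keys for sorting by angle around the base point -/
def angleKeys : Prog :=
  .setWord 8 0 ;;
  .loop (.wordLt (wr 8) (wr 0))
    (.branch (.wordEq (wr 8) (wr 9)) .skip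
      (.setReal 5 (ra 0 (wr 8) - rr 3) ;; .setReal 6 (ra 1 (wr 8) - rr 4) ;;
        .branch (.realLt 0 (rr 5))
          (.putWord 1 (wr 8) 2 ;; .putReal 4 (wr 8) (0 - rr 6 / rr 5))
          (.putWord 1 (wr 8) 1) ;;
        .putReal 5 (wr 8) (0 - (rr 5 * rr 5 + rr 6 * rr 6))) ;;
      .setWord 8 (wr 8 + 1))

/-- extract the points in sorted order -/
def extract : Prog :=
  .setWord 8 1 ;;
  .loop (.wordLt (wr 8) (wr 0))
    ((.setWord 6 (wa 0 1) ;; .putReal 2 (wr 8) (ra 0 (wr 6) - rr 3) ;;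
      .putReal 3 (wr 8) (ra 1 (wr 6) - rr 4) ;; .putWord 1 (wr 6) 0 ;;
      .setWord 8 (wr 8 + 1)) ;; climb)

/-- cross product of the vectors at positions `i` and `j` -/
def crE (i j : WExp) : RExp := ra 2 i * ra 3 j - ra 3 i * ra 2 j
/-- squared norm of the vector at position `i` -/
def nqE (i : WExp) : RExp := ra 2 i * ra 2 i + ra 3 i * ra 3 i

/-- compute the key of the vertex `6` of the chain -/
def chainKey : Prog :=
  .setWord 17 (wa 3 (wr 6)) ;; .setWord 18 (wa 2 (wr 6)) ;;
  .setReal 5 (crE (wr 17) (wr 6)) ;; .setReal 6 (crE (wr 6) (wr 18)) ;;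
  .setReal 7 (crE (wr 17) (wr 18)) ;; .setReal 8 (rr 5 + rr 6 - rr 7) ;;
  .putReal 5 (wr 6) 0 ;;
  .branch (.conj (.neg (.realLt 0 (rr 8))) (.neg (.wordEq (wr 18) (wr 2 + 1))))
    (.putWord 1 (wr 6) 2 ;; .putReal 4 (wr 6) 0)
    (.putWord 1 (wr 6) 1 ;; .putReal 4 (wr 6)
      ((nqE (wr 18) * rr 5 + nqE (wr 17) * rr 6 - nqE (wr 6) * rr 7) / rr 8))

/-- link the chain -/
def links : Prog :=
  .setWord 8 0 ;;
  .loop (.wordLt (wr 8) (wr 2 + 1))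
    (.putWord 2 (wr 8) (wr 8 + 1) ;; .putWord 3 (wr 8 + 1) (wr 8) ;; .setWord 8 (wr 8 + 1))

/-- compute the keys of the chain -/
def chainKeys : Prog :=
  .setWord 6 1 ;;
  .loop (.wordLt (wr 6) (wr 2 + 1)) (chainKey ;; .setWord 6 (wr 6 + 1))

/-- address of an entry of the rank table -/
def cell (t j : WExp) : WExp := t * (wr 2 + 2) + j

/-- compute the rank of a triangle with the children `12`, `13` -/
def findRank : Prog :=
  .setWord 15 0 ;; .setWord 14 0 ;;
  .loop (.wordLt (wr 14) (wr 3))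
    (.setWord 19 (wa 7 (cell (wr 12) (wr 14))) ;; .setWord 20 (wa 7 (cell (wr 13) (wr 14))) ;;
      .branch (.disj (.conj (.wordLt 0 (wr 19)) (.wordLt 0 (wr 20)))
          (.conj (.wordEq (wr 14) (wr 15)) (.wordLt 0 (wr 19 + wr 20))))
        (.setWord 15 (wr 14 + 1)) .skip ;;
      .setWord 14 (wr 14 + 1))

/-- fill the row of the triangle `9` -/
def fillRow : Prog :=
  .setWord 14 0 ;;
  .loop (.wordLt (wr 14) (wr 3))
    (.branch (.wordLt (wr 14) (wr 15)) (.putWord 7 (cell (wr 9) (wr 14)) 0)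
        (.branch (.wordEq (wr 14) (wr 15)) (.putWord 7 (cell (wr 9) (wr 14)) (wr 9))
          (.putWord 7 (cell (wr 9) (wr 14))
            (wa 7 (cell (wr 12) (wr 14)) + wa 7 (cell (wr 13) (wr 14))))) ;;
      .setWord 14 (wr 14 + 1))

/-- record the triangle with apex `9` -/
def record : Prog :=
  (.setWord 12 (wa 4 (wr 10)) ;; .setWord 13 (wa 4 (wr 9)) ;;
    .putWord 5 (wr 9) (wr 12) ;; .putWord 6 (wr 12) (wr 11) ;; .putWord 6 (wr 13) (wr 10) ;;
    .putWord 4 (wr 10) (wr 9)) ;;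
  findRank ;; fillRow

/-- take the best vertex out of the chain -/
def cut : Prog :=
  (.setWord 9 (wa 0 1) ;; .setWord 10 (wa 3 (wr 9)) ;; .setWord 11 (wa 2 (wr 9))) ;;
  .branch (.wordEq (wa 1 (wr 9)) 1) record .skip ;;
  (.putWord 2 (wr 10) (wr 11) ;; .putWord 3 (wr 11) (wr 10) ;; .putWord 1 (wr 9) 0 ;;
    .setWord 6 (wr 9)) ;;
  climb ;;
  .branch (.wordEq (wr 10) 0) .skip (.setWord 6 (wr 10) ;; chainKey ;; climb) ;;
  .branch (.wordEq (wr 11) (wr 2 + 1)) .skip (.setWord 6 (wr 11) ;; chainKey ;; climb)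

/-- take all vertices but one out of the chain -/
def cuts : Prog :=
  .setWord 8 1 ;;
  .loop (.wordLt (wr 8) (wr 2)) (cut ;; .setWord 8 (wr 8 + 1))

/-- the root of the tree of triangles -/
def root : Prog :=
  .setWord 4 (wa 2 0) ;; .putWord 6 (wa 4 0) (wa 4 (wr 4)) ;; .putWord 6 (wa 4 (wr 4)) (wa 4 0)

/-- sort the points around the base point -/
def sortPoints : Prog :=
  findBase ;; digits ;; angleKeys ;; .setWord 5 (wr 0) ;; build ;; extract

/-- triangulate the sorted points -/
def triangulate : Prog :=
  links ;; chainKeys ;; .setWord 5 (wr 2 + 2) ;; build ;; cuts ;; root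

/-- the preprocessing program -/
def preprocess : Prog := sortPoints ;; .branch (.wordEq (wr 2) 0) .skip triangulate

/-- power of the vertex `i` with respect to the current circle -/
def dist2 (i : WExp) : RExp :=
  (ra 2 i - rr 23) * (ra 2 i - rr 23) + (ra 3 i - rr 24) * (ra 3 i - rr 24)

/-- minimum circle for the points `20`, `21` and the query -/
def pairCircle : Prog :=
  (.setReal 12 (ra 2 (wr 21) - ra 2 (wr 20)) ;; .setReal 13 (ra 3 (wr 21) - ra 3 (wr 20)) ;;
    .setReal 14 (rr 12 * rr 12 + rr 13 * rr 13) ;;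
    .setReal 15 ((ra 2 (wr 20) + ra 2 (wr 21)) / 2) ;;
    .setReal 16 ((ra 3 (wr 20) + ra 3 (wr 21)) / 2) ;;
    .setReal 17 ((rr 15 - rr 10) * (rr 15 - rr 10) + (rr 16 - rr 11) * (rr 16 - rr 11)
      - rr 14 / 4 - rr 2 * rr 2) ;;
    .setReal 18 ((rr 16 - rr 11) * rr 12 - (rr 15 - rr 10) * rr 13)) ;;
  (.setReal 19 (rr 2 * .sqrt (rr 14)) ;; .setReal 20 (.sqrt (rr 18 * rr 18)) ;;
    .setReal 21 (.sqrt (rr 20 * rr 20 + rr 17 * rr 17 - rr 19 * rr 19)) ;;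
    .setWord 24 1 ;;
    .branch (.neg (.realLt (rr 17) (rr 19))) (.setReal 22 0)
      (.branch (.realLt (rr 19) (rr 20))
        (.setReal 22 ((rr 19 * rr 21 - rr 20 * rr 17) / (2 * (rr 20 * rr 20 - rr 19 * rr 19))))
        (.branch (.conj (.realLt 0 (rr 17))
            (.neg (.realLt (rr 20 * rr 20 + rr 17 * rr 17) (rr 19 * rr 19))))
          (.setReal 22 ((rr 19 * rr 19 - rr 17 * rr 17) / (2 * (rr 20 * rr 17 + rr 19 * rr 21))))
          (.setWord 24 0))) ;;
    .branch (.realLt (rr 18) 0) (.setReal 22 (0 - rr 22)) .skip) ;;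
  (.setReal 23 (rr 15 - rr 22 * rr 13) ;; .setReal 24 (rr 16 + rr 22 * rr 12) ;;
    .setReal 25 (dist2 (wr 20)))

/-- test the edge `20`, `21` whose triangles have the apexes `22`, `23`; the result is `0` if there
is no circle, `1` if the circle contains both apexes, `3` if it misses `22`, and `2` if it contains
`22` but not `23` -/
def tryEdge : Prog :=
  pairCircle ;;
  .branch (.wordEq (wr 24) 0) .skip
    (.branch (.realLt (rr 25) (dist2 (wr 22))) (.setWord 24 3)
      (.branch (.realLt (rr 25) (dist2 (wr 23))) (.setWord 24 2) .skip))

/-- the circumcircle of the triangle `29`, `27`, `30` -/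
def circum : Prog :=
  .setReal 12 (ra 2 (wr 27) - ra 2 (wr 29)) ;; .setReal 13 (ra 3 (wr 27) - ra 3 (wr 29)) ;;
  .setReal 15 (ra 2 (wr 30) - ra 2 (wr 29)) ;; .setReal 16 (ra 3 (wr 30) - ra 3 (wr 29)) ;;
  .setReal 17 (rr 12 * rr 12 + rr 13 * rr 13) ;; .setReal 18 (rr 15 * rr 15 + rr 16 * rr 16) ;;
  .setReal 19 (2 * (rr 12 * rr 16 - rr 13 * rr 15)) ;;
  .setReal 23 (ra 2 (wr 29) + (rr 17 * rr 16 - rr 18 * rr 13) / rr 19) ;;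
  .setReal 24 (ra 3 (wr 29) + (rr 12 * rr 18 - rr 15 * rr 17) / rr 19) ;;
  .setReal 25 (dist2 (wr 29)) ;;
  .branch (.realLt ((rr 23 - rr 10) * (rr 23 - rr 10) + (rr 24 - rr 11) * (rr 24 - rr 11))
      ((.sqrt (rr 25) + rr 2) * (.sqrt (rr 25) + rr 2)))
    (.setWord 28 2) (.setWord 28 1)

/-- act on the result of `tryEdge`: stop, go outward, or go on -/
def dispatch (outward onward : Prog) : Prog :=
  .branch (.wordEq (wr 24) 0) (.setWord 28 2)
    (.branch (.wordEq (wr 24) 1) (.setWord 28 1)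
      (.branch (.wordEq (wr 24) 2) outward onward))

/-- handle the triangle `27` -/
def visit : Prog :=
  (.setWord 29 (wa 3 (wr 27)) ;; .setWord 30 (wa 2 (wr 27)) ;;
    .setWord 31 (wa 5 (wr 27)) ;; .setWord 32 (wa 4 (wr 27)) ;;
    .setWord 20 (wr 29) ;; .setWord 21 (wr 27) ;; .setWord 22 (wr 30) ;;
    .branch (.wordEq (wr 31) 0) (.setWord 23 (wr 29)) (.setWord 23 (wr 31))) ;;
  tryEdge ;;
  dispatch (.setWord 25 (wr 31))
    ((.setWord 20 (wr 27) ;; .setWord 21 (wr 30) ;; .setWord 22 (wr 29) ;;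
        .branch (.wordEq (wr 32) 0) (.setWord 23 (wr 27)) (.setWord 23 (wr 32))) ;;
      tryEdge ;;
      dispatch (.setWord 25 (wr 32))
        ((.setWord 20 (wr 29) ;; .setWord 21 (wr 30) ;; .setWord 22 (wr 27) ;;
            .setWord 23 (wa 6 (wr 27))) ;;
          tryEdge ;;
          dispatch .skip circum))

/-- the search in the tree of triangles -/
def search : Prog :=
  .loop (.conj (.wordEq (wr 28) 0) (.wordLt 0 (wr 26)))
    ((.setWord 26 (wr 26 - 1) ;; .setWord 27 (wa 7 (cell (wr 25) (wr 26)))) ;;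
      .branch (.wordEq (wr 27) 0) .skip visit)

/-- the query program -/
def query : Prog :=
  .branch (.wordEq (wr 2) 0)
    (.setReal 0 (rr 3) ;; .setReal 1 (rr 4) ;; .setReal 2 0 ;; .setWord 1 1)
    ((.setReal 10 (rr 0 - rr 3) ;; .setReal 11 (rr 1 - rr 4) ;;
        .setWord 20 0 ;; .setWord 21 (wr 4) ;; .setWord 22 (wa 4 0) ;; .setWord 23 (wa 4 (wr 4))) ;;
      tryEdge ;;
      (.setWord 28 0 ;; .setWord 26 (wr 3) ;;
        dispatch (.setWord 25 (wa 4 (wr 4))) (.setWord 25 (wa 4 0))) ;;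
      search ;;
      .branch (.wordEq (wr 28) 1)
        (.setReal 0 (rr 23 + rr 3) ;; .setReal 1 (rr 24 + rr 4) ;; .setReal 2 (.sqrt (rr 25)) ;;
          .setWord 1 1)
        (.setWord 1 0))

end CircleSep

namespace CircleSep

/-! ### Chains of vectors sorted by angle -/

section Chains
variable (X Y : ℕ → ℝ)

/-- cross product -/
def cr (i j : ℕ) : ℝ := X i * Y j - Y i * X j
/-- orientation -/
def tri (i j k : ℕ) : ℝ := cr X Y i j + cr X Y j k - cr X Y i k
/-- squared norm -/
def nq (i : ℕ) : ℝ := X i * X i + Y i * Y i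
/-- orientation of the points lifted to the paraboloid, seen from the base point -/
def lift (i j k : ℕ) : ℝ := nq X Y k * cr X Y i j + nq X Y i * cr X Y j k - nq X Y j * cr X Y i k
/-- the excess of the squared norm over an affine function; it is nonpositive inside of a circle and
zero on it -/
def exc (A B C : ℝ) (i : ℕ) : ℝ := nq X Y i - (A * X i + B * Y i + C)

/-- The quadratic parts of two excesses cancel. Their difference is affine, and its value at `x` is
interpolated from `u`, `v`, `w` with orientations as barycentric weights. All comparisons of two
circles rest on this. -/
theorem tri_exc (A B C A' B' C' : ℝ) (u v w x : ℕ) :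
    tri X Y u v w * (exc X Y A B C x - exc X Y A' B' C' x) =
      tri X Y x v w * (exc X Y A B C u - exc X Y A' B' C' u) +
      tri X Y u x w * (exc X Y A B C v - exc X Y A' B' C' v) +
      tri X Y u v x * (exc X Y A B C w - exc X Y A' B' C' w) := by
  simp only [exc, tri, cr]; ring

theorem tri_rot (i j k : ℕ) : tri X Y j k i = tri X Y i j k := by
  simp only [tri, cr]; ring

/-- The sequence `nx`, `pv` links the positions satisfying `Al`, from `0` to `m + 1`. -/
structure Chain (m : ℕ) (Al : ℕ → Prop) (nx pv : ℕ → ℕ) : Prop where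
  zero : Al 0
  last : Al (m + 1)
  le : ∀ i, Al i → i ≤ m + 1
  next : ∀ i, Al i → i < m + 1 → i < nx i ∧ Al (nx i) ∧ pv (nx i) = i ∧
    ∀ k, i < k → k < nx i → ¬ Al k
  prev : ∀ i, Al i → 0 < i → pv i < i ∧ Al (pv i) ∧ nx (pv i) = i

variable {X Y}
variable {m : ℕ} {Al : ℕ → Prop} {nx pv : ℕ → ℕ}

theorem Chain.gap (h : Chain m Al nx pv) {i k : ℕ} (hi : Al i) (h0 : 0 < i) (h1 : pv i < k)
    (h2 : k < i) : ¬ Al k := by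
  obtain ⟨a, b, c⟩ := h.prev i hi h0
  have := (h.next _ b (by have := h.le i hi; omega)).2.2.2 k h1
  rw [c] at this
  exact this h2

theorem Chain.next_le (h : Chain m Al nx pv) {i k : ℕ} (hi : Al i) (hk : Al k) (hik : i < k) :
    nx i ≤ k := by
  by_contra hc
  exact (h.next i hi (by have := h.le k hk; omega)).2.2.2 k hik (by omega) hk

theorem Chain.le_prev (h : Chain m Al nx pv) {i k : ℕ} (hi : Al i) (hk : Al k) (hik : k < i) :
    k ≤ pv i := by
  by_contra hc
  exact h.gap hi (by omega) (by omega) hik hk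

/-- Every position lies on an edge of the chain. -/
theorem Chain.exists_edge (h : Chain m Al nx pv) {x : ℕ} (hx : x ≤ m) :
    ∃ u, Al u ∧ u ≤ x ∧ x < nx u := by
  induction x with
  | zero => exact ⟨0, h.zero, le_rfl, (h.next 0 h.zero (by omega)).1⟩
  | succ x ih =>
    obtain ⟨u, h1, h2, h3⟩ := ih (by omega)
    by_cases hu : x + 1 = nx u
    · have := h.next u h1 (by omega)
      rw [← hu] at this
      exact ⟨x + 1, this.2.1, le_rfl, (h.next (x + 1) this.2.1 (by omega)).1⟩
    · exact ⟨u, h1, by omega, by omega⟩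

theorem Chain.remove (h : Chain m Al nx pv) {p : ℕ} (hp : Al p) (h0 : 0 < p) (h1 : p < m + 1) :
    Chain m (fun i => Al i ∧ i ≠ p) (Function.update nx (pv p) (nx p))
      (Function.update pv (nx p) (pv p)) := by
  obtain ⟨n1, n2, n3, n4⟩ := h.next p hp h1
  obtain ⟨p1, p2, p3⟩ := h.prev p hp h0
  have hg := fun k => h.gap (k := k) hp h0
  refine ⟨⟨h.zero, by omega⟩, ⟨h.last, by omega⟩, fun i hi => h.le i hi.1, ?_, ?_⟩
  · rintro i ⟨hi, hip⟩ him
    by_cases hia : i = pv p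
    · subst hia
      simp only [Function.update_self, true_and]
      refine ⟨by omega, ⟨n2, by omega⟩, fun k hk1 hk2 hk => ?_⟩
      rcases lt_trichotomy k p with hkp | hkp | hkp
      · exact hg k hk1 hkp hk.1
      · exact hk.2 hkp
      · exact n4 k hkp hk2 hk.1
    · obtain ⟨a, b, c, d⟩ := h.next i hi him
      have hne : nx i ≠ nx p := fun e => hip (by rw [← c, e, n3])
      have hnp : nx i ≠ p := fun e => hia (by rw [← c, e])
      simp only [Function.update_of_ne hia, Function.update_of_ne hne]
      exact ⟨a, ⟨b, hnp⟩, c, fun k k1 k2 k3 => d k k1 k2 k3.1⟩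
  · rintro i ⟨hi, hip⟩ hi0
    by_cases hib : i = nx p
    · subst hib
      simp only [Function.update_self, and_true]
      exact ⟨by omega, p2, by omega⟩
    · obtain ⟨a, b, c⟩ := h.prev i hi hi0
      have hne : pv i ≠ pv p := fun e => hip (by rw [← c, e, p3])
      have hnp : pv i ≠ p := fun e => hib (by rw [← c, e])
      simp only [Function.update_of_ne hib, Function.update_of_ne hne]
      exact ⟨a, ⟨b, hnp⟩, c⟩

variable (X Y) in
/-- The vector at position `j` comes after the one at position `i`: at a greater angle, or at the
same angle but not nearer. -/
def After (i j : ℕ) : Prop := 0 < cr X Y i j ∨ ∃ s : ℝ, 1 ≤ s ∧ X j = s * X i ∧ Y j = s * Y i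

variable (X Y) in
/-- The vectors at the positions `1, …, m` are sorted by angle; the positions `0` and `m + 1` carry
the base point. -/
structure Sorted (m : ℕ) : Prop where
  X0 : X 0 = 0
  Y0 : Y 0 = 0
  Xm : X (m + 1) = 0
  Ym : Y (m + 1) = 0
  after : ∀ i j, 1 ≤ i → i < j → j ≤ m → After X Y i j

theorem After.nonneg {i j : ℕ} (h : After X Y i j) : 0 ≤ cr X Y i j := by
  obtain h | ⟨s, _, h1, h2⟩ := h
  · exact h.le
  · simp only [cr, h1, h2]; exact le_of_eq (by ring)

variable (X Y) in
/-- All vertices of the chain are convex. -/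
def Convex (m : ℕ) (Al : ℕ → Prop) (nx pv : ℕ → ℕ) : Prop :=
  ∀ i, Al i → 0 < i → i < m + 1 → 0 < tri X Y (pv i) i (nx i) ∨ nx i = m + 1

/-- If the next vertex lay on the same ray, it would be at least as far out, and the turn at `i`
would not be positive. -/
theorem Sorted.cr_next (hs : Sorted X Y m) (h : Chain m Al nx pv) (hc : Convex X Y m Al nx pv)
    {i : ℕ} (hi : Al i) (h0 : 0 < i) (him : i < m + 1) (h1 : nx i < m + 1) :
    0 < cr X Y i (nx i) := by
  obtain ⟨n1, n2, n3, n4⟩ := h.next i hi him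
  obtain ⟨p1, p2, p3⟩ := h.prev i hi h0
  rcases hs.after i (nx i) h0 n1 (by omega) with h' | ⟨s, hs1, hx, hy⟩
  · exact h'
  · exfalso
    have ht := (hc i hi h0 him).resolve_right (by omega)
    have h2 : 0 ≤ cr X Y (pv i) i := by
      rcases Nat.eq_zero_or_pos (pv i) with e | e
      · rw [e]; simp [cr, hs.X0, hs.Y0]
      · exact (hs.after _ _ e p1 (by omega)).nonneg
    have : tri X Y (pv i) i (nx i) = (1 - s) * cr X Y (pv i) i := by
      simp only [tri, cr, hx, hy]; ring
    nlinarith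

/-- If `k` lay on the ray of `i`, then the vertex `nx i`, which is strictly beyond this ray in
angle, would be followed by a vector of smaller angle. -/
theorem Sorted.cr_pos (hs : Sorted X Y m) (h : Chain m Al nx pv) (hc : Convex X Y m Al nx pv)
    {i k : ℕ} (hi : Al i) (hk : Al k) (h0 : 0 < i) (hik : i < k) (h1 : k < m + 1) :
    0 < cr X Y i k := by
  have hn := h.next_le hi hk hik
  have hp := hs.cr_next h hc hi h0 (by omega) (by omega)
  obtain ⟨n1, n2, n3, n4⟩ := h.next i hi (by omega)
  rcases hs.after i k h0 hik (by omega) with h' | ⟨s, hs1, hx, hy⟩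
  · exact h'
  · exfalso
    rcases hn.eq_or_lt with e | hlt
    · have : cr X Y i (nx i) = 0 := by rw [e]; simp only [cr, hx, hy]; ring
      linarith
    · have h2 := (hs.after (nx i) k (by omega) hlt (by omega)).nonneg
      have : cr X Y (nx i) k = -s * cr X Y i (nx i) := by simp only [cr, hx, hy]; ring
      nlinarith

/-- The linear relation between three vectors of the plane writes the turn `i, j, k` as a
combination of `i, j, l` and `j, l, k`. On a convex chain the cross products that serve as weights
are positive, so positive turns propagate. -/
theorem tri_step (i j l k : ℕ) : tri X Y i j k * cr X Y j l =
    tri X Y i j l * cr X Y j k + tri X Y j l k * cr X Y i j := by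
  simp only [tri, cr]; ring

theorem tri_step' (i l j k : ℕ) : tri X Y i j k * cr X Y l j =
    tri X Y i l j * cr X Y j k + tri X Y l j k * cr X Y i j := by
  simp only [tri, cr]; ring

/-- Induction on the distance from `j` to `k`: inserting the vertex after `nx j` leaves local
convexity at `nx j` and a shorter instance. -/
theorem Sorted.tri_next (hs : Sorted X Y m) (h : Chain m Al nx pv) (hc : Convex X Y m Al nx pv)
    {k : ℕ} (hk : Al k) (h1 : k < m + 1) {j : ℕ} (hj : Al j) (h0 : 0 < j) (hjm : j < m + 1)
    (hjk : nx j < k) : 0 < tri X Y j (nx j) k := by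
  induction hd : k - j using Nat.strong_induction_on generalizing j with
  | _ d ih =>
  obtain ⟨n1, n2, n3, n4⟩ := h.next j hj hjm
  obtain ⟨q1, q2, q3, q4⟩ := h.next (nx j) n2 (by omega)
  have hle := h.next_le n2 hk hjk
  have ht := (hc (nx j) n2 (by omega) (by omega)).resolve_right (by omega)
  rw [n3] at ht
  rcases hle.eq_or_lt with e | hlt
  · rwa [e] at ht
  · have h2 := ih (k - nx j) (by omega) n2 (by omega) (by omega) hlt rfl
    have h3 := tri_step (X := X) (Y := Y) j (nx j) (nx (nx j)) k
    have h4 := hs.cr_pos h hc n2 q2 (by omega) q1 (by omega)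
    have h5 := hs.cr_pos h hc n2 hk (by omega) hjk (by omega)
    have h6 := hs.cr_pos h hc hj n2 h0 n1 (by omega)
    have h7 : 0 < tri X Y j (nx j) k * cr X Y (nx j) (nx (nx j)) := by rw [h3]; positivity
    exact pos_of_mul_pos_left h7 h4.le

theorem Sorted.tri_prev (hs : Sorted X Y m) (h : Chain m Al nx pv) (hc : Convex X Y m Al nx pv)
    {i : ℕ} (hi : Al i) (h0 : 0 < i) {j : ℕ} (hj : Al j) (hij : i < j) (h1 : nx j < m + 1)
    (hjm : j < m + 1) : 0 < tri X Y i j (nx j) := by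
  induction hd : j - i using Nat.strong_induction_on generalizing j with
  | _ d ih =>
  obtain ⟨n1, n2, n3, n4⟩ := h.next j hj hjm
  obtain ⟨p1, p2, p3⟩ := h.prev j hj (by omega)
  have hle := h.le_prev hj hi hij
  have ht := (hc j hj (by omega) (by omega)).resolve_right (by omega)
  rcases hle.eq_or_lt with e | hlt
  · rwa [← e] at ht
  · have h2 := ih (pv j - i) (by omega) p2 hlt (by omega) (by omega) rfl
    rw [p3] at h2
    have h3 := tri_step' (X := X) (Y := Y) i (pv j) j (nx j)
    have h4 := hs.cr_pos h hc p2 hj (by omega) p1 (by omega)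
    have h5 := hs.cr_pos h hc hj n2 (by omega) n1 (by omega)
    have h6 := hs.cr_pos h hc hi hj h0 hij (by omega)
    have h7 : 0 < tri X Y i j (nx j) * cr X Y (pv j) j := by rw [h3]; positivity
    exact pos_of_mul_pos_left h7 h4.le

/-- Local convexity implies convexity. -/
theorem Sorted.tri_pos (hs : Sorted X Y m) (h : Chain m Al nx pv) (hc : Convex X Y m Al nx pv)
    {i j k : ℕ} (hi : Al i) (hj : Al j) (hk : Al k) (hij : i < j) (hjk : j < k)
    (hn : ¬ (i = 0 ∧ k = m + 1)) : 0 < tri X Y i j k := by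
  have hkm := h.le k hk
  -- With the base point at one end, the orientation is a single cross product; only the triple with
  -- the base point at both ends degenerates.
  rcases Nat.eq_zero_or_pos i with e | h0
  · have := hs.cr_pos h hc hj hk (by omega) hjk (by omega)
    subst e; simpa [tri, cr, hs.X0, hs.Y0] using this
  rcases hkm.eq_or_lt with e | h1
  · have := hs.cr_pos h hc hi hj (by omega) hij (by omega)
    subst e; simpa [tri, cr, hs.Xm, hs.Ym] using this
  obtain ⟨n1, n2, n3, n4⟩ := h.next j hj (by omega)
  rcases (h.next_le hj hk hjk).eq_or_lt with e | hlt
  · rw [← e]; exact hs.tri_prev h hc hi h0 hj hij (by omega) (by omega)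
  have h2 := hs.tri_prev h hc hi h0 hj hij (by omega) (by omega)
  have h2' := hs.tri_next h hc hk h1 hj (by omega) (by omega) hlt
  have h3 := tri_step (X := X) (Y := Y) i j (nx j) k
  have h4 := hs.cr_pos h hc hj n2 (by omega) n1 (by omega)
  have h5 := hs.cr_pos h hc hj hk (by omega) hjk (by omega)
  have h6 := hs.cr_pos h hc hi hj h0 hij (by omega)
  have h7 : 0 < tri X Y i j k * cr X Y j (nx j) := by rw [h3]; positivity
  exact pos_of_mul_pos_left h7 h4.le

/-- The cross products are the coefficients of the linear relation between the three vectors, so `A`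
and `B` drop out. A bound on the keys thereby becomes a three-term inequality for the excess along
the chain. -/
theorem exc_lift (A B C : ℝ) (a p b : ℕ) :
    exc X Y A B C b * cr X Y a p + exc X Y A B C a * cr X Y p b - exc X Y A B C p * cr X Y a b =
      lift X Y a p b - C * tri X Y a p b := by
  simp only [exc, lift, tri, cr]; ring

/-- One step of the concavity argument: `w` is concave with respect to the gauge `u`. -/
theorem concave_step {wa wj wb ua uj ub ab ja jb : ℝ} (hab : 0 < ab) (hja : 0 < ja)
    (hu : ua * ja - uj * jb + ub * ab = 0) (hw : wb * ab + wa * ja - wj * jb ≤ 0) (huj : 0 < uj)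
    (hub : 0 < ub) (hwj : wj ≤ 0) (hprev : wj * ua ≤ wa * uj) : wb ≤ 0 ∧ wb * uj ≤ wj * ub := by
  have h1 : (wb * uj - wj * ub) * ab ≤ 0 := by
    -- This is a discrete Wronskian: the gauge satisfies the three-term recursion with equality, the
    -- sequence `w` with an inequality, so the quotient of `w` by the gauge cannot increase.
    have e : (wb * uj - wj * ub) * ab = (wb * ab + wa * ja - wj * jb) * uj +
        ja * (wj * ua - wa * uj) - wj * (ua * ja - uj * jb + ub * ab) := by ring
    rw [e, hu]
    nlinarith
  have h2 : wb * uj - wj * ub ≤ 0 := by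
    by_contra hc
    push Not at hc
    nlinarith
  refine ⟨?_, by linarith⟩
  by_contra hc
  push Not at hc
  nlinarith

/-- Comparison with the gauge `cr X Y p`, which satisfies the recursion of the excess exactly. The
quotient of excess and gauge does not increase along the chain and starts at zero. It is written as
a product because the gauge vanishes at `p`. -/
theorem Chain.exc_up (hs : Sorted X Y m) (h : Chain m Al nx pv) (hc : Convex X Y m Al nx pv)
    {p : ℕ} (hp : Al p) (hp0 : 0 < p) {A B C : ℝ}
    (hG : ∀ i, Al i → 0 < i → i < m + 1 →
      lift X Y (pv i) i (nx i) ≤ C * tri X Y (pv i) i (nx i))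
    (hpp : exc X Y A B C p = 0) (hb : exc X Y A B C (nx p) = 0)
    {i : ℕ} (hi : Al i) (hpi : p ≤ i) (him : i < m + 1) (hn : nx i < m + 1) :
    exc X Y A B C (nx i) ≤ 0 ∧ exc X Y A B C (nx i) * cr X Y p i ≤
      exc X Y A B C i * cr X Y p (nx i) ∧ exc X Y A B C i ≤ 0 := by
  induction i using Nat.strong_induction_on with
  | _ i ih =>
  rcases hpi.eq_or_lt with e | hlt
  · subst e; simp [hb, hpp]
  obtain ⟨n1, n2, n3, n4⟩ := h.next i hi him
  obtain ⟨p1, p2, p3⟩ := h.prev i hi (by omega)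
  have hle := h.le_prev hi hp hlt
  obtain ⟨i1, i2, i3⟩ := ih (pv i) p1 p2 hle (by omega) (by omega)
  rw [p3] at i1 i2
  have hg := hG i hi (by omega) him
  have hl := exc_lift (X := X) (Y := Y) A B C (pv i) i (nx i)
  have h4 := hs.cr_pos h hc p2 hi (by omega) p1 (by omega)
  have h5 := hs.cr_pos h hc hi n2 (by omega) n1 (by omega)
  have := concave_step (wa := exc X Y A B C (pv i)) (wj := exc X Y A B C i)
    (wb := exc X Y A B C (nx i)) (ua := cr X Y p (pv i)) (uj := cr X Y p i)
    (ub := cr X Y p (nx i)) (jb := cr X Y (pv i) (nx i)) h4 h5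
    (by simp only [cr]; ring) (by linarith) (hs.cr_pos h hc hp hi hp0 hlt him)
    (hs.cr_pos h hc hp n2 hp0 (by omega) hn) i1 i2
  exact ⟨this.1, this.2, i1⟩

/-- The mirror image of `Chain.exc_up`, with the cross product with `p` on the right as the gauge
and the induction running down from `p`. -/
theorem Chain.exc_down (hs : Sorted X Y m) (h : Chain m Al nx pv) (hc : Convex X Y m Al nx pv)
    {p : ℕ} (hp : Al p) (hp0 : 0 < p) (hpm : p < m + 1) {A B C : ℝ}
    (hG : ∀ i, Al i → 0 < i → i < m + 1 →
      lift X Y (pv i) i (nx i) ≤ C * tri X Y (pv i) i (nx i))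
    (ha : exc X Y A B C (pv p) = 0) (hpp : exc X Y A B C p = 0) 
    {i : ℕ} (hi : Al i) (hi0 : 0 < i) (hpi : i ≤ p) (hn : 0 < pv i) :
    exc X Y A B C (pv i) ≤ 0 ∧ exc X Y A B C (pv i) * cr X Y i p ≤
      exc X Y A B C i * cr X Y (pv i) p ∧ exc X Y A B C i ≤ 0 := by
  induction hd : p - i using Nat.strong_induction_on generalizing i with
  | _ d ih =>
  rcases hpi.eq_or_lt with e | hlt
  · subst e; simp [ha, hpp]
  obtain ⟨n1, n2, n3, n4⟩ := h.next i hi (by omega)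
  obtain ⟨p1, p2, p3⟩ := h.prev i hi (by omega)
  have hle := h.next_le hi hp hlt
  obtain ⟨i1, i2, i3⟩ := ih (p - nx i) (by omega) n2 (by omega) hle (by omega) rfl
  rw [n3] at i1 i2
  have hg := hG i hi (by omega) (by omega)
  have hl := exc_lift (X := X) (Y := Y) A B C (pv i) i (nx i)
  have h4 := hs.cr_pos h hc p2 hi (by omega) p1 (by omega)
  have h5 := hs.cr_pos h hc hi n2 (by omega) n1 (by omega)
  have := concave_step (wb := exc X Y A B C (pv i)) (wj := exc X Y A B C i)
    (wa := exc X Y A B C (nx i)) (ub := cr X Y (pv i) p) (uj := cr X Y i p)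
    (ua := cr X Y (nx i) p) (jb := cr X Y (pv i) (nx i)) h5 h4
    (by simp only [cr]; ring) (by linarith) (hs.cr_pos h hc hi hp (by omega) hlt (by omega))
    (hs.cr_pos h hc p2 hp (by omega) (by omega) (by omega)) i1 i2
  exact ⟨this.1, this.2, i1⟩

/-- The circle of the vertex with the greatest key contains the whole chain. -/
theorem Chain.exc_nonpos (hs : Sorted X Y m) (h : Chain m Al nx pv) (hc : Convex X Y m Al nx pv)
    {p : ℕ} (hp : Al p) (hp0 : 0 < p) (hpm : p < m + 1) {A B C : ℝ}
    (hG : ∀ i, Al i → 0 < i → i < m + 1 →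
      lift X Y (pv i) i (nx i) ≤ C * tri X Y (pv i) i (nx i))
    (ha : exc X Y A B C (pv p) = 0) (hpp : exc X Y A B C p = 0) (hb : exc X Y A B C (nx p) = 0)
    (hne : ¬ (pv p = 0 ∧ nx p = m + 1)) {i : ℕ} (hi : Al i) :
    exc X Y A B C i ≤ 0 := by
  -- The excess of the base point is `-C`. The circle of the first vertex passes through the base
  -- point, so its lift is zero, and the bound on the keys forces `C` to be nonnegative. Its
  -- orientation is positive because a second vertex exists.
  have hC : 0 ≤ C := by
    have hpn := h.next p hp hpm
    have hpv := h.prev p hp hp0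
    have hn := h.next 0 h.zero (by omega)
    have hle := h.next_le h.zero hp hp0
    have hn' := h.next (nx 0) hn.2.1 (by omega)
    have hlt : nx (nx 0) < m + 1 := by
      rcases hle.eq_or_lt with e | e
      · rw [e] at hn ⊢
        have := h.le _ hpn.2.1
        by_contra hh
        exact hne ⟨by omega, by omega⟩
      · have := h.next_le hn.2.1 hp e
        omega
    have hg := hG _ hn.2.1 hn.1 (by omega)
    rw [hn.2.2.1] at hg
    have ht := hs.tri_pos h hc h.zero hn.2.1 hn'.2.1 hn.1 hn'.1 (by omega)
    have hl : lift X Y 0 (nx 0) (nx (nx 0)) = 0 := by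
      simp [lift, cr, nq, hs.X0, hs.Y0]
    rw [hl] at hg
    exact nonneg_of_mul_nonneg_left hg ht
  have h0 : exc X Y A B C 0 ≤ 0 := by simpa [exc, nq, hs.X0, hs.Y0] using hC
  have hm : exc X Y A B C (m + 1) ≤ 0 := by simpa [exc, nq, hs.Xm, hs.Ym] using hC
  rcases Nat.eq_zero_or_pos i with e | i0
  · rwa [e]
  rcases (h.le i hi).eq_or_lt with e | im
  · rwa [e]
  rcases lt_trichotomy i p with hlt | e | hlt
  · have hn := h.next i hi im
    have := (Chain.exc_down hs h hc hp hp0 hpm hG ha hpp hn.2.1 (by omega) (h.next_le hi hp hlt)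
      (by rw [hn.2.2.1]; exact i0)).1
    rwa [hn.2.2.1] at this
  · rw [e, hpp]
  · have hn := h.prev i hi i0
    have := (Chain.exc_up hs h hc hp hp0 hG hpp hb hn.2.1 (h.le_prev hi hp hlt)
      (by omega) (by omega)).1
    rwa [hn.2.2] at this

/-- The circle through three points. -/
theorem exists_exc {a p b : ℕ} (ht : tri X Y a p b ≠ 0) :
    ∃ A B, exc X Y A B (lift X Y a p b / tri X Y a p b) a = 0 ∧
      exc X Y A B (lift X Y a p b / tri X Y a p b) p = 0 ∧
      exc X Y A B (lift X Y a p b / tri X Y a p b) b = 0 := by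
  set t := tri X Y a p b with htd
  -- Cramer's rule for the linear system of the three vanishing excesses.
  refine ⟨(nq X Y a * (Y p - Y b) + nq X Y p * (Y b - Y a) + nq X Y b * (Y a - Y p)) / t,
    (nq X Y a * (X b - X p) + nq X Y p * (X a - X b) + nq X Y b * (X p - X a)) / t, ?_, ?_, ?_⟩ <;>
  · simp only [exc, lift]
    field_simp
    simp only [htd, tri, cr]
    ring

end Chains
end CircleSep

namespace CircleSep

/-! ### The farthest-point triangulation -/

section Forest
variable {X Y : ℕ → ℝ} {m : ℕ} {Al H : ℕ → Prop} {nx pv ch lc op : ℕ → ℕ}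

/-- A convex combination of two points and the base point lies in every circle that contains
these. -/
theorem exc_comb {A B C α β : ℝ} {a b p : ℕ} (hC : 0 ≤ C) (hα : 0 ≤ α) (hβ : 0 ≤ β)
    (hαβ : α + β ≤ 1) (hx : X p = α * X a + β * X b) (hy : Y p = α * Y a + β * Y b)
    (ha : exc X Y A B C a ≤ 0) (hb : exc X Y A B C b ≤ 0) : exc X Y A B C p ≤ 0 := by
  -- The defect of the excess under a convex combination is the weighted sum of the squared
  -- distances between the three points, one of which is the base point at the origin; its excess is
  -- `-C`.
  have e : exc X Y A B C p = α * exc X Y A B C a + β * exc X Y A B C b - (1 - α - β) * C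
      - (α * (1 - α - β) * (X a ^ 2 + Y a ^ 2) + β * (1 - α - β) * (X b ^ 2 + Y b ^ 2)
        + α * β * ((X a - X b) ^ 2 + (Y a - Y b) ^ 2)) := by
    simp only [exc, nq, hx, hy]; ring
  have h1 : 0 ≤ 1 - α - β := by linarith
  have h2 : 0 ≤ α * (1 - α - β) * (X a ^ 2 + Y a ^ 2) + β * (1 - α - β) * (X b ^ 2 + Y b ^ 2)
        + α * β * ((X a - X b) ^ 2 + (Y a - Y b) ^ 2) := by positivity
  have h3 := mul_nonneg h1 hC
  have h4 := mul_nonpos_of_nonneg_of_nonpos hα ha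
  have h5 := mul_nonpos_of_nonneg_of_nonpos hβ hb
  linarith

/-- A reflex vertex lies in every circle that contains its neighbours and the base point. -/
theorem Sorted.exc_reflex (hs : Sorted X Y m) {a p b : ℕ} (hap : a < p) (hpb : p < b)
    (hb : b < m + 1) (ht : tri X Y a p b ≤ 0) {A B C : ℝ} (hC : 0 ≤ C)
    (h1 : exc X Y A B C a ≤ 0) (h2 : exc X Y A B C b ≤ 0) : exc X Y A B C p ≤ 0 := by
  rcases hs.after p b (by omega) hpb (by omega) with h | ⟨s, hs1, hx, hy⟩
  · have h3 : 0 ≤ cr X Y a p := by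
      rcases Nat.eq_zero_or_pos a with e | e
      · rw [e]; simp [cr, hs.X0, hs.Y0]
      · exact (hs.after a p e hap (by omega)).nonneg
    have h4 : 0 < cr X Y a b := by simp only [tri] at ht; linarith
    -- Cramer's coefficients of `p` with respect to `a` and `b`; that the turn is not positive says
    -- exactly that their sum is at most one.
    refine exc_comb (α := cr X Y p b / cr X Y a b) (β := cr X Y a p / cr X Y a b) hC
      (by positivity) (by positivity) ?_ ?_ ?_ h1 h2
    · rw [← add_div, div_le_one h4]; simp only [tri] at ht; linarith
    · field_simp; simp only [cr]; ring
    · field_simp; simp only [cr]; ring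
  · have hs0 : 0 < s := by linarith
    -- Here `p` lies on the segment from the base point to `b`.
    refine exc_comb (α := 0) (β := 1 / s) hC le_rfl (by positivity) ?_ ?_ ?_ h1 h2
    · rw [zero_add, div_le_one hs0]; exact hs1
    · rw [hx]; field_simp; ring
    · rw [hy]; field_simp; ring

theorem Sorted.exc_last (hs : Sorted X Y m) (A B C : ℝ) :
    exc X Y A B C (m + 1) = exc X Y A B C 0 := by
  simp [exc, nq, hs.X0, hs.Y0, hs.Xm, hs.Ym]

variable (m Al H nx pv) in
/-- `c` is the triangle below the edge `u`, `v`, or `0` if this is an edge of the hull. -/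
def Below (u v c : ℕ) : Prop :=
  (c = 0 ∧ ∀ i, H i → u < i → i < v → False) ∨ (H c ∧ ¬ Al c ∧ pv c = u ∧ nx c = v)

variable (X Y m H) in
/-- The hull is strictly convex. -/
def HullConvex : Prop := ∀ i j k, (i = 0 ∨ H i) → H j → (k = m + 1 ∨ H k) → i < j → j < k →
  ¬ (i = 0 ∧ k = m + 1) → 0 < tri X Y i j k

variable (X Y m H) in
/-- Circles that contain the hull contain all points. -/
def Hull : Prop := ∀ A B C : ℝ, 0 ≤ C → (∀ i, H i → exc X Y A B C i ≤ 0) →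
  ∀ i, 0 < i → i < m + 1 → exc X Y A B C i ≤ 0

variable (X Y m Al H nx pv ch lc op) in
/-- The triangles found so far. The hull vertices that are not alive are the apexes of triangles
with base `pv t`, `nx t`. -/
structure Forest : Prop where
  chain : Chain m Al nx pv
  sub : ∀ i, Al i → 0 < i → i < m + 1 → H i
  range : ∀ i, H i → 0 < i ∧ i < m + 1
  hull : Hull X Y m H
  conv : ∀ t, H t → ¬ Al t → HullConvex X Y m H
  node : ∀ t, H t → ¬ Al t → (pv t = 0 ∨ H (pv t)) ∧ (nx t = m + 1 ∨ H (nx t)) ∧ pv t < t ∧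
    t < nx t ∧ ¬ (pv t = 0 ∧ nx t = m + 1)
  circ : ∀ t, H t → ¬ Al t → ∃ A B C, exc X Y A B C (pv t) = 0 ∧ exc X Y A B C t = 0 ∧
    exc X Y A B C (nx t) = 0 ∧ ∀ i, i = 0 ∨ H i → exc X Y A B C i ≤ 0
  left : ∀ t, H t → ¬ Al t → Below Al H nx pv (pv t) t (lc t)
  right : ∀ t, H t → ¬ Al t → Below Al H nx pv t (nx t) (ch t)
  edge : ∀ i, Al i → i < m + 1 → Below Al H nx pv i (nx i) (ch i)
  opLeft : ∀ t, H t → ¬ Al t → lc t ≠ 0 → op (lc t) = nx t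
  opRight : ∀ t, H t → ¬ Al t → ch t ≠ 0 → op (ch t) = pv t
  up : ∀ t, H t → ¬ Al t → (Al (pv t) ∧ nx (pv t) = nx t ∧ ch (pv t) = t) ∨
    ∃ f, H f ∧ ¬ Al f ∧ (lc f = t ∨ ch f = t)

/-- Dropping a reflex vertex. -/
theorem Forest.drop (hs : Sorted X Y m) (h : Forest X Y m Al H nx pv ch lc op)
    (h0 : ∀ t, H t → Al t) {p : ℕ} (hp : Al p) (hp0 : 0 < p) (hpm : p < m + 1)
    (ht : tri X Y (pv p) p (nx p) ≤ 0) (hb : nx p ≠ m + 1) :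
    Forest X Y m (fun i => Al i ∧ i ≠ p) (fun i => H i ∧ i ≠ p)
      (Function.update nx (pv p) (nx p)) (Function.update pv (nx p) (pv p)) ch lc op := by
  have hn := h.chain.next p hp hpm
  have hv := h.chain.prev p hp hp0
  have hbm : nx p < m + 1 := lt_of_le_of_ne (h.chain.le _ hn.2.1) hb
  have hR := h.chain.remove hp hp0 hpm
  refine ⟨hR, fun i hi h1 h2 => ⟨h.sub i hi.1 h1 h2, hi.2⟩,
    fun i hi => h.range i hi.1, ?_, ?_, ?_, ?_, ?_, ?_, ?_, ?_, ?_, ?_⟩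
  · intro A B C hC hH
    refine h.hull A B C hC fun i hi => ?_
    by_cases hip : i = p
    · subst hip
      refine hs.exc_reflex hv.1 hn.1 hbm ht hC ?_ (hH _ ⟨h.sub _ hn.2.1 (by omega) hbm, by omega⟩)
      rcases Nat.eq_zero_or_pos (pv i) with e | e
      · rw [e]; simpa [exc, nq, hs.X0, hs.Y0] using hC
      · exact hH _ ⟨h.sub _ hv.2.1 e (by omega), by omega⟩
    · exact hH i ⟨hi, hip⟩
  -- There are no triangles yet, so everything said about vertices that are not alive is vacuous;
  -- only the edges of the chain remain.
  all_goals try exact fun t ht ht' => absurd ⟨h0 t ht.1, ht.2⟩ ht'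
  intro i hi him
  refine Or.inl ⟨?_, fun k hk h1 h2 => ?_⟩
  · rcases h.edge i hi.1 him with h | h
    · exact h.1
    · exact absurd (h0 _ h.1) h.2.1
  · exact (hR.next i hi him).2.2.2 k h1 h2 ⟨h0 k hk.1, hk.2⟩

/-- The circle of a new triangle contains the apexes of the old triangles. -/
theorem exc_nonpos_of_crossing {A B C A' B' C' : ℝ} {u x v w : ℕ} (h1 : 0 < tri X Y u v w)
    (h2 : 0 ≤ tri X Y x v w) (h3 : 0 ≤ tri X Y u x w) (h4 : 0 ≤ tri X Y u x v)
    (hu : exc X Y A B C u = 0) (hv : exc X Y A B C v = 0) (hw : exc X Y A B C w ≤ 0)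
    (hx : exc X Y A B C x ≤ 0) (hu' : exc X Y A' B' C' u ≤ 0) (hv' : exc X Y A' B' C' v ≤ 0)
    (hw' : exc X Y A' B' C' w = 0) : exc X Y A' B' C' x ≤ 0 := by
  -- The new excess minus the old one is affine, at most zero at `u` and `v`, and at least zero at
  -- `w`. Since `x` lies beyond the line `u v`, within the angle seen from `w`, the difference is at
  -- most zero at `x`.
  have e := tri_exc X Y A' B' C' A B C u v w x
  have e2 : tri X Y u v x = -tri X Y u x v := by simp only [tri, cr]; ring
  rw [hu, hv, hw', e2] at e
  have h5 := mul_nonpos_of_nonneg_of_nonpos h2 hu'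
  have h6 := mul_nonpos_of_nonneg_of_nonpos h3 hv'
  have h7 := mul_nonpos_of_nonneg_of_nonpos h4 hw
  have h8 : exc X Y A' B' C' x - exc X Y A B C x ≤ 0 := by
    by_contra hc
    push Not at hc
    have := mul_pos h1 hc
    linarith
  linarith

/-- The circle of a new triangle contains all hull vertices. -/
theorem Forest.circ_new (hs : Sorted X Y m) (h : Forest X Y m Al H nx pv ch lc op)
    (hH : HullConvex X Y m H) {p : ℕ} (hp : Al p) (hp0 : 0 < p) (hpm : p < m + 1)
    (hne : ¬ (pv p = 0 ∧ nx p = m + 1)) {A B C : ℝ}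
    (ha : exc X Y A B C (pv p) = 0) (hpp : exc X Y A B C p = 0) (hb : exc X Y A B C (nx p) = 0)
    (hal : ∀ i, Al i → exc X Y A B C i ≤ 0) {x : ℕ} (hx : H x) : exc X Y A B C x ≤ 0 := by
  by_cases hxa : Al x
  · exact hal x hxa
  have hxr := h.range x hx
  obtain ⟨u, hu, h1, h2⟩ := h.chain.exists_edge (x := x) (by omega)
  have hux : u < x := lt_of_le_of_ne h1 fun e => hxa (e ▸ hu)
  have hn := h.chain.next u hu (by omega)
  have hvm := h.chain.le _ hn.2.1
  have hpn := h.chain.next p hp hpm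
  have hpv := h.chain.prev p hp hp0
  have hbm := h.chain.le _ hpn.2.1
  have HL : ∀ i, Al i → i < m + 1 → i = 0 ∨ H i := fun i hi him => by
    rcases Nat.eq_zero_or_pos i with e | e
    · exact .inl e
    · exact .inr (h.sub i hi e him)
  have HR : ∀ i, Al i → 0 < i → i = m + 1 ∨ H i := fun i hi him => by
    rcases (h.chain.le i hi).eq_or_lt with e | e
    · exact .inl e
    · exact .inr (h.sub i hi him e)
  rcases h.edge u hu (by omega) with hE | ⟨e1, e2, e3, e4⟩
  · exact (hE.2 x hx hux h2).elim
  obtain ⟨A', B', C', c1, c2, c3, c4⟩ := h.circ _ e1 e2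
  rw [e3] at c1
  rw [e4] at c3
  have c4' : ∀ i, Al i → exc X Y A' B' C' i ≤ 0 := fun i hi => by
    rcases (h.chain.le i hi).eq_or_lt with e | e
    · rw [e, hs.exc_last]; exact c4 0 (.inl rfl)
    · exact c4 i (HL i hi e)
  have hpH := h.sub p hp hp0 hpm
  have T4 : 0 ≤ tri X Y u x (nx u) := by
    by_cases hc : u = 0 ∧ nx u = m + 1
    · have := h.chain.next_le hu hp (by omega)
      omega
    · exact (hH u x (nx u) (HL u hu (by omega)) hx (HR _ hn.2.1 (by omega)) hux h2 hc).le
  -- The old triangle lies below an edge of the chain. Of the three vertices on the new circle one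
  -- is not an endpoint of this edge and can serve as the witness on its other side: `p` itself, or
  -- a neighbour of `p` if `p` is an endpoint.
  have hwit : ∃ w, Al w ∧ exc X Y A B C w = 0 ∧ 0 < tri X Y u (nx u) w ∧
      0 ≤ tri X Y x (nx u) w ∧ 0 ≤ tri X Y u x w := by
    have hright : ∀ w, Al w → nx u < w → ¬ (u = 0 ∧ w = m + 1) → 0 < tri X Y u (nx u) w ∧
      0 ≤ tri X Y x (nx u) w ∧ 0 ≤ tri X Y u x w := fun w hw h3 h4 => by
      have := h.chain.le w hw
      have hvH := h.sub _ hn.2.1 (by omega) (by omega)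
      exact ⟨hH _ _ _ (HL u hu (by omega)) hvH (HR w hw (by omega)) (by omega) h3 h4,
        (hH _ _ _ (.inr hx) hvH (HR w hw (by omega)) h2 h3 (by omega)).le,
        (hH _ _ _ (HL u hu (by omega)) hx (HR w hw (by omega)) hux (by omega) h4).le⟩
    have hleft : ∀ w, Al w → w < u → ¬ (w = 0 ∧ nx u = m + 1) → 0 < tri X Y u (nx u) w ∧
      0 ≤ tri X Y x (nx u) w ∧ 0 ≤ tri X Y u x w := fun w hw h3 h4 => by
      have huH := h.sub u hu (by omega) (by omega)
      rw [tri_rot X Y w u (nx u), tri_rot X Y w x (nx u), tri_rot X Y w u x]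
      exact ⟨hH _ _ _ (HL w hw (by omega)) huH (HR _ hn.2.1 (by omega)) h3 (by omega) h4,
        (hH _ _ _ (HL w hw (by omega)) hx (HR _ hn.2.1 (by omega)) (by omega) h2 h4).le,
        (hH _ _ _ (HL w hw (by omega)) huH (.inr hx) h3 hux (by omega)).le⟩
    rcases lt_trichotomy p u with hlt | e | hlt
    · exact ⟨p, hp, hpp, hleft p hp hlt (by omega)⟩
    · exact ⟨pv p, hpv.2.1, ha, hleft _ hpv.2.1 (by omega) (by rw [← e]; exact hne)⟩
    · have := h.chain.next_le hu hp hlt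
      rcases this.eq_or_lt with e | hlt'
      · refine ⟨nx p, hpn.2.1, hb, hright _ hpn.2.1 (by omega) ?_⟩
        have : pv p = u := by rw [← e]; exact hn.2.2.1
        omega
      · exact ⟨p, hp, hpp, hright p hp hlt' (by omega)⟩
  obtain ⟨w, hw, hw0, T1, T2, T3⟩ := hwit
  exact exc_nonpos_of_crossing T1 T2 T3 T4 c1 c3 (c4' w hw) (c4 x (.inr hx)) (hal u hu)
    (hal _ hn.2.1) hw0

/-- Convexity of the hull is recorded together with any triangle. Without triangles all hull
vertices are alive, and local convexity of the chain suffices. -/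
theorem Forest.convex (hs : Sorted X Y m) (h : Forest X Y m Al H nx pv ch lc op)
    (hc : Convex X Y m Al nx pv) : HullConvex X Y m H := by
  by_cases h0 : ∃ t, H t ∧ ¬ Al t
  · obtain ⟨t, h1, h2⟩ := h0
    exact h.conv t h1 h2
  · push Not at h0
    intro i j k hi hj hk hij hjk hn
    refine hs.tri_pos h.chain hc ?_ (h0 j hj) ?_ hij hjk hn
    · rcases hi with e | e
      · rw [e]; exact h.chain.zero
      · exact h0 i e
    · rcases hk with e | e
      · rw [e]; exact h.chain.last
      · exact h0 k e

/-- Adding the triangle of the vertex with the greatest key. -/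
theorem Forest.add (hs : Sorted X Y m) (h : Forest X Y m Al H nx pv ch lc op)
    (hc : Convex X Y m Al nx pv) {p : ℕ} (hp : Al p) (hp0 : 0 < p) (hpm : p < m + 1)
    (hne : ¬ (pv p = 0 ∧ nx p = m + 1))
    (hG : ∀ i, Al i → 0 < i → i < m + 1 → lift X Y (pv i) i (nx i) ≤
      lift X Y (pv p) p (nx p) / tri X Y (pv p) p (nx p) * tri X Y (pv i) i (nx i)) :
    Forest X Y m (fun i => Al i ∧ i ≠ p) H
      (Function.update nx (pv p) (nx p)) (Function.update pv (nx p) (pv p))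
      (Function.update ch (pv p) p) (Function.update lc p (ch (pv p)))
      (Function.update (Function.update op (ch (pv p)) (nx p)) (ch p) (pv p)) := by
  have hn := h.chain.next p hp hpm
  have hv := h.chain.prev p hp hp0
  have hbm := h.chain.le _ hn.2.1
  have hR := h.chain.remove hp hp0 hpm
  have hH := h.convex hs hc
  have hpH := h.sub p hp hp0 hpm
  have ht := hs.tri_pos h.chain hc hv.2.1 hp hn.2.1 hv.1 hn.1 hne
  obtain ⟨A, B, ha, hpp, hb⟩ := exists_exc ht.ne'
  have hal : ∀ i, Al i → exc X Y A B _ i ≤ 0 := fun i hi =>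
    Chain.exc_nonpos hs h.chain hc hp hp0 hpm hG ha hpp hb hne hi
  -- old triangles
  have hold : ∀ t, H t → ¬ (Al t ∧ t ≠ p) → t ≠ p → ¬ Al t := fun t _ h2 h3 h4 => h2 ⟨h4, h3⟩
  have hnx : ∀ t, ¬ Al t → Function.update nx (pv p) (nx p) t = nx t := fun t ht =>
    Function.update_of_ne (fun e => ht (by rw [e]; exact hv.2.1)) _ _
  have hpv : ∀ t, ¬ Al t → Function.update pv (nx p) (pv p) t = pv t := fun t ht =>
    Function.update_of_ne (fun e => ht (by rw [e]; exact hn.2.1)) _ _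
  have hch : ∀ t, ¬ Al t → Function.update ch (pv p) p t = ch t := fun t ht =>
    Function.update_of_ne (fun e => ht (by rw [e]; exact hv.2.1)) _ _
  have hnxp : Function.update nx (pv p) (nx p) p = nx p := Function.update_of_ne (by omega) _ _
  have hpvp : Function.update pv (nx p) (pv p) p = pv p := Function.update_of_ne (by omega) _ _
  have hchp : Function.update ch (pv p) p p = ch p := Function.update_of_ne (by omega) _ _
  -- Unlinking `p` rewrites `nx` and `pv` only at living vertices, so a vertex that is not alive
  -- keeps as its base the neighbours it had when it was cut off.
  have hbel : ∀ u v c, Below Al H nx pv u v c → Below (fun i => Al i ∧ i ≠ p) H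
      (Function.update nx (pv p) (nx p)) (Function.update pv (nx p) (pv p)) u v c := by
    rintro u v c (hE | ⟨e1, e2, e3, e4⟩)
    · exact .inl hE
    · exact .inr ⟨e1, fun hh => e2 hh.1, by rw [hpv c e2]; exact e3, by rw [hnx c e2]; exact e4⟩
  have hbne : ∀ {u v c}, Below Al H nx pv u v c → c ≠ 0 → H c ∧ ¬ Al c ∧ pv c = u ∧ nx c = v :=
    fun hB hc0 => hB.resolve_left fun hh => hc0 hh.1
  have ea := h.edge _ hv.2.1 (by omega)
  have ep := h.edge p hp hpm
  rw [hv.2.2] at ea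
  refine ⟨hR, fun i hi => h.sub i hi.1, h.range, h.hull, fun _ _ _ => hH, ?_, ?_, ?_, ?_, ?_, ?_,
    ?_, ?_⟩
  · intro t h1 h2
    by_cases htp : t = p
    · subst htp
      rw [hnxp, hpvp]
      refine ⟨?_, ?_, hv.1, hn.1, hne⟩
      · rcases Nat.eq_zero_or_pos (pv t) with e | e
        · exact .inl e
        · exact .inr (h.sub _ hv.2.1 e (by omega))
      · rcases hbm.eq_or_lt with e | e
        · exact .inl e
        · exact .inr (h.sub _ hn.2.1 (by omega) e)
    · have h3 := hold t h1 h2 htp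
      rw [hnx t h3, hpv t h3]
      exact h.node t h1 h3
  · intro t h1 h2
    by_cases htp : t = p
    · subst htp
      rw [hnxp, hpvp]
      refine ⟨A, B, _, ha, hpp, hb, ?_⟩
      rintro i (e | e)
      · rw [e]; exact hal 0 h.chain.zero
      · exact h.circ_new hs hH hp hp0 hpm hne ha hpp hb hal e
    · have h3 := hold t h1 h2 htp
      rw [hnx t h3, hpv t h3]
      exact h.circ t h1 h3
  · intro t h1 h2
    by_cases htp : t = p
    · subst htp
      rw [hpvp, Function.update_self]
      exact hbel _ _ _ ea
    · have h3 := hold t h1 h2 htp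
      rw [hpv t h3, Function.update_of_ne htp]
      exact hbel _ _ _ (h.left t h1 h3)
  · intro t h1 h2
    by_cases htp : t = p
    · subst htp
      rw [hnxp, hchp]
      exact hbel _ _ _ ep
    · have h3 := hold t h1 h2 htp
      rw [hnx t h3, hch t h3]
      exact hbel _ _ _ (h.right t h1 h3)
  · intro i hi him
    by_cases hia : i = pv p
    · subst hia
      rw [Function.update_self, Function.update_self]
      exact .inr ⟨hpH, fun hh => hh.2 rfl, hpvp, hnxp⟩
    · rw [Function.update_of_ne hia, Function.update_of_ne hia]
      exact hbel _ _ _ (h.edge i hi.1 him)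
  · intro t h1 h2 h3
    by_cases htp : t = p
    · subst htp
      rw [Function.update_self] at h3 ⊢
      rw [hnxp]
      have k1 := hbne ea h3
      -- The two writes to `op` do not collide: a common child would have a base starting both at
      -- `pv t` and at `t`.
      rw [Function.update_of_ne, Function.update_self]
      intro e
      rw [e] at k1
      have k2 := hbne ep (by rwa [← e])
      omega
    · have h4 := hold t h1 h2 htp
      rw [Function.update_of_ne htp] at h3 ⊢
      have k1 := hbne (h.left t h1 h4) h3
      rw [hnx t h4, Function.update_of_ne, Function.update_of_ne]
      · exact h.opLeft t h1 h4 h3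
      · intro e
        rw [e] at k1 h3
        have k2 := hbne ea h3
        exact h4 (by rw [← k1.2.2.2, k2.2.2.2]; exact hp)
      · intro e
        rw [e] at k1 h3
        have k2 := hbne ep h3
        exact h4 (by rw [← k1.2.2.2, k2.2.2.2]; exact hn.2.1)
  · intro t h1 h2 h3
    by_cases htp : t = p
    · subst htp
      rw [hchp] at h3 ⊢
      rw [hpvp, Function.update_self]
    · have h4 := hold t h1 h2 htp
      rw [hch t h4] at h3 ⊢
      have k1 := hbne (h.right t h1 h4) h3
      rw [hpv t h4, Function.update_of_ne, Function.update_of_ne]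
      · exact h.opRight t h1 h4 h3
      · intro e
        rw [e] at k1 h3
        have k2 := hbne ea h3
        exact h4 (by rw [← k1.2.2.1, k2.2.2.1]; exact hv.2.1)
      · intro e
        rw [e] at k1 h3
        have k2 := hbne ep h3
        exact h4 (by rw [← k1.2.2.1, k2.2.2.1]; exact hp)
  · intro t h1 h2
    by_cases htp : t = p
    · subst htp
      rw [hnxp, hpvp, Function.update_self, Function.update_self]
      exact .inl ⟨⟨hv.2.1, by omega⟩, rfl, rfl⟩
    · have h3 := hold t h1 h2 htp
      rw [hnx t h3, hpv t h3]
      -- The two edges at `p` leave the chain, and the triangles below them become the children of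
      -- the triangle `p`.
      rcases h.up t h1 h3 with ⟨u1, u2, u3⟩ | ⟨f, f1, f2, f3⟩
      · by_cases hua : pv t = pv p
        · refine .inr ⟨p, hpH, fun hh => hh.2 rfl, .inl ?_⟩
          rw [Function.update_self, ← hua, u3]
        · by_cases hup : pv t = p
          · refine .inr ⟨p, hpH, fun hh => hh.2 rfl, .inr ?_⟩
            rw [hchp, ← hup, u3]
          · exact .inl ⟨⟨u1, hup⟩, by rw [Function.update_of_ne hua]; exact u2,
              by rw [Function.update_of_ne hua]; exact u3⟩
      · refine .inr ⟨f, f1, fun hh => f2 hh.1, ?_⟩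
        have hfp : f ≠ p := fun e => f2 (e ▸ hp)
        rw [Function.update_of_ne hfp, hch f f2]
        exact f3

end Forest
end CircleSep

namespace CircleSep

/-! ### The minimum circle for two points and a query -/

section Solver
variable {s k E : ℝ}

/-- the hyperbola `√(1/4 + z²)` -/
noncomputable def hyp (z : ℝ) : ℝ := √(1 / 4 + z ^ 2)

theorem hyp_sq (z : ℝ) : hyp z ^ 2 = 1 / 4 + z ^ 2 := Real.sq_sqrt (by positivity)
theorem hyp_pos (z : ℝ) : 0 < hyp z := Real.sqrt_pos.2 (by positivity)
theorem hyp_neg (z : ℝ) : hyp (-z) = hyp z := by simp [hyp]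
theorem hyp_abs (z : ℝ) : hyp |z| = hyp z := by simp [hyp]
theorem hyp_le_hyp {y z : ℝ} : hyp y ≤ hyp z ↔ |y| ≤ |z| := by
  rw [hyp, hyp, Real.sqrt_le_sqrt_iff (by positivity), add_le_add_iff_left, sq_le_sq]
theorem hyp_eq {z w : ℝ} (hw : 0 ≤ w) (h : w ^ 2 = 1 / 4 + z ^ 2) : hyp z = w := by
  rw [hyp, ← h, Real.sqrt_sq hw]

/-- Cauchy–Schwarz for `(1/2, y)` and `(1/2, z)`. Divided by `hyp z`, this is the tangent inequality
of the hyperbola at `z`. -/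
theorem hyp_mul (y z : ℝ) : 1 / 4 + y * z ≤ hyp y * hyp z := by
  refine le_of_sq_le_sq ?_ (by have := hyp_pos y; have := hyp_pos z; positivity)
  rw [mul_pow, hyp_sq, hyp_sq]
  nlinarith [sq_nonneg (y - z)]

theorem hyp_mul_lt {y z : ℝ} (h : y ≠ z) : 1 / 4 + y * z < hyp y * hyp z := by
  have h1 := hyp_pos y
  have h2 := hyp_pos z
  refine lt_of_pow_lt_pow_left₀ 2 (by positivity) ?_
  rw [mul_pow, hyp_sq, hyp_sq]
  have : 0 < (y - z) ^ 2 := by have := sub_ne_zero.2 h; positivity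
  nlinarith

/-- The constraint of the query on the bisector of two points. -/
def Ok (s k e z : ℝ) : Prop := 2 * s * hyp z ≤ k + 2 * e * z

/-- For nonnegative `s` the constraint bounds a convex function by an affine one, so its solutions
form an interval. -/
theorem Ok.convex {s k e z₁ z z₂ : ℝ} (hs : 0 ≤ s) (h₁ : Ok s k e z₁) (h₂ : Ok s k e z₂)
    (h : z₁ ≤ z) (h' : z ≤ z₂) : Ok s k e z := by
  rcases (h.trans h').eq_or_lt with e1 | hlt
  · rwa [le_antisymm (h'.trans e1.ge) h]
  unfold Ok at *
  have hp := hyp_pos z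
  -- The chord inequality for `hyp`: after multiplication by `hyp z` it is the tangent inequality at
  -- `z`, used at both ends.
  have key : hyp z * (z₂ - z₁) ≤ (z₂ - z) * hyp z₁ + (z - z₁) * hyp z₂ := by
    refine le_of_mul_le_mul_right ?_ hp
    have e1 : hyp z * (z₂ - z₁) * hyp z = (z₂ - z) * (1 / 4 + z₁ * z) +
        (z - z₁) * (1 / 4 + z₂ * z) := by
      have := hyp_sq z
      linear_combination (z₂ - z₁) * this
    rw [e1]
    have a1 := mul_le_mul_of_nonneg_left (hyp_mul z₁ z) (sub_nonneg.2 h')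
    have a2 := mul_le_mul_of_nonneg_left (hyp_mul z₂ z) (sub_nonneg.2 h)
    linarith
  refine le_of_mul_le_mul_right ?_ (sub_pos.2 hlt)
  have b1 := mul_le_mul_of_nonneg_left h₁ (sub_nonneg.2 h')
  have b2 := mul_le_mul_of_nonneg_left h₂ (sub_nonneg.2 h)
  have b3 := mul_le_mul_of_nonneg_left key (by positivity : 0 ≤ 2 * s)
  linarith

/-- A point where the constraint is tight is the first one if the slope there is not negative. -/
theorem Ok.first {y₀ y : ℝ} (h0 : 2 * s * hyp y₀ = k + 2 * E * y₀)
    (hsl : 0 ≤ E * hyp y₀ - s * y₀) (hs : 0 ≤ s)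
    (h : 0 < s ∨ 0 < E * hyp y₀ - s * y₀) (hy : Ok s k E y) : y₀ ≤ y := by
  by_contra hc
  push Not at hc
  unfold Ok at hy
  have hp := hyp_pos y₀
  have hsq := hyp_sq y₀
  -- The slack at `y`, times `hyp y₀`, splits into the tangent term and the convexity defect; to the
  -- left of `y₀` neither can help.
  have e1 : (k + 2 * E * y - 2 * s * hyp y) * hyp y₀ =
      -(2 * (E * hyp y₀ - s * y₀) * (y₀ - y) +
        2 * s * (hyp y * hyp y₀ - (1 / 4 + y * y₀))) := by
    linear_combination (-hyp y₀) * h0 + 2 * s * hsq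
  have e2 : 0 ≤ (k + 2 * E * y - 2 * s * hyp y) * hyp y₀ := mul_nonneg (by linarith) hp.le
  have e3 : 0 ≤ (E * hyp y₀ - s * y₀) * (y₀ - y) := mul_nonneg hsl (by linarith)
  have hlt := sub_pos.2 (hyp_mul_lt hc.ne)
  rcases h with h | h
  · have := mul_pos h hlt
    linarith
  · have h4 := mul_pos h (sub_pos.2 hc)
    have := mul_nonneg hs hlt.le
    linarith

theorem Ok.solve_zero (h : s ≤ k) : Ok s k E 0 := by
  have : hyp 0 = 1 / 2 := hyp_eq (by norm_num) (by norm_num)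
  rw [Ok, this]; linarith

/-- Squaring the tight constraint gives a quadratic equation with leading coefficient proportional
to `E * E - s * s`. The value `y` is its larger root, where `E * hyp y - s * y` is half the root of
the discriminant, so `Ok.first` applies. -/
theorem Ok.solve_large (hs : 0 ≤ s) (h : k < s) (hE : s < E) :
    let y := (s * √(E * E + k * k - s * s) - E * k) / (2 * (E * E - s * s))
    0 ≤ y ∧ Ok s k E y ∧ ∀ y', Ok s k E y' → y ≤ y' := by
  intro y
  have hM : 0 < E * E - s * s := by nlinarith
  set R := √(E * E + k * k - s * s) with hR
  have hR2 : R * R = E * E + k * k - s * s := Real.mul_self_sqrt (by nlinarith [mul_self_nonneg k])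
  have hR0 : 0 < R := Real.sqrt_pos.2 (by nlinarith [mul_self_nonneg k])
  have hy : y = (s * R - E * k) / (2 * (E * E - s * s)) := rfl
  obtain ⟨M, hMd⟩ : ∃ M, M = E * E - s * s := ⟨_, rfl⟩
  rw [← hMd] at hM hy
  have hERks : 0 ≤ E * R - k * s := by
    refine sub_nonneg.2 (le_of_sq_le_sq ?_ (mul_nonneg (by linarith) hR0.le))
    have : 0 ≤ M * (E * E + k * k) :=
      mul_nonneg hM.le (add_nonneg (mul_self_nonneg E) (mul_self_nonneg k))
    have e : (E * R) ^ 2 = E * E * (E * E + k * k - s * s) := by rw [← hR2]; ring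
    rw [e]
    rw [hMd] at this
    linarith
  have hh : hyp y = (E * R - k * s) / (2 * M) := by
    refine hyp_eq (div_nonneg hERks (by positivity)) ?_
    rw [hy, div_pow, div_pow, mul_pow, ← sub_eq_iff_eq_add, ← sub_div, div_eq_iff (by positivity)]
    rw [hMd]
    linear_combination (E * E - s * s) * hR2
  have h0 : 2 * s * hyp y = k + 2 * E * y := by
    rw [hh, hy]; field_simp; rw [hMd]; ring
  have hsl : E * hyp y - s * y = R / 2 := by
    rw [hh, hy]; field_simp; rw [hMd]; ring
  refine ⟨?_, h0.le, fun y' hy' => Ok.first h0 (by rw [hsl]; positivity) hs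
    (.inr (by rw [hsl]; positivity)) hy'⟩
  rw [hy]
  refine div_nonneg (sub_nonneg.2 ?_) (by positivity)
  rcases le_total k 0 with hk | hk
  · have : E * k ≤ 0 := mul_nonpos_of_nonneg_of_nonpos (by linarith) hk
    have : 0 ≤ s * R := by positivity
    linarith
  · refine le_of_sq_le_sq ?_ (by positivity)
    have : 0 ≤ (E * E - s * s) * (s * s - k * k) := mul_nonneg (hMd ▸ hM.le) (by nlinarith)
    have e : (s * R) ^ 2 = s * s * (E * E + k * k - s * s) := by rw [← hR2]; ring
    rw [e]
    nlinarith

/-- The same root as in `Ok.solve_large` with the numerator rationalised, so that the denominator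
does not vanish at `E = s`. Positive `k` keeps it positive. -/
theorem Ok.solve_small (h : k < s) (hE0 : 0 ≤ E) (hk : 0 < k)
    (hD : 0 ≤ E * E + k * k - s * s) :
    let y := (s * s - k * k) / (2 * (E * k + s * √(E * E + k * k - s * s)))
    0 ≤ y ∧ Ok s k E y ∧ ∀ y', Ok s k E y' → y ≤ y' := by
  intro y
  have hs : 0 < s := hk.trans h
  have hE : 0 < E := by
    rcases hE0.eq_or_lt with e | e
    · subst e; nlinarith
    · exact e
  set R := √(E * E + k * k - s * s) with hR
  have hR2 : R * R = E * E + k * k - s * s := Real.mul_self_sqrt hD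
  have hR0 : 0 ≤ R := Real.sqrt_nonneg _
  have hN : 0 < E * k + s * R := by positivity
  have hy : y = (s * s - k * k) / (2 * (E * k + s * R)) := rfl
  obtain ⟨N, hNd⟩ : ∃ N, N = E * k + s * R := ⟨_, rfl⟩
  rw [← hNd] at hN hy
  have hh : hyp y = (k * R + E * s) / (2 * N) := by
    refine hyp_eq (by positivity) ?_
    rw [hy, div_pow, div_pow, mul_pow, ← sub_eq_iff_eq_add, ← sub_div, div_eq_iff (by positivity)]
    rw [hNd]
    linear_combination (k * k - s * s) * hR2
  have h0 : 2 * s * hyp y = k + 2 * E * y := by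
    rw [hh, hy]; field_simp; rw [hNd]; ring
  have hsl : E * hyp y - s * y = R / 2 := by
    rw [hh, hy]; field_simp; rw [hNd]
    linear_combination (-s) * hR2
  exact ⟨div_nonneg (by nlinarith) (by positivity), h0.le, fun y' hy' =>
    Ok.first h0 (by rw [hsl]; positivity) hs.le (.inl hs) hy'⟩

/-- A solution forces `k` to be positive because `y < hyp y` and `E ≤ s`. Then the discriminant must
be negative, and Cauchy–Schwarz for `(k, E)` and `(1, 2 * y)` contradicts the squared constraint. -/
theorem Ok.solve_none (hs : 0 ≤ s) (h : k < s) (hE0 : 0 ≤ E) (hE : E ≤ s)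
    (hD : ¬ (0 < k ∧ 0 ≤ E * E + k * k - s * s)) {y : ℝ} (hy0 : 0 ≤ y) : ¬ Ok s k E y := by
  intro hy
  unfold Ok at hy
  have hp := hyp_pos y
  have hsq := hyp_sq y
  have hlt : y < hyp y := lt_of_pow_lt_pow_left₀ 2 hp.le (by rw [hsq]; linarith)
  have h1 : E * y ≤ s * y := mul_le_mul_of_nonneg_right hE hy0
  rcases hs.eq_or_lt with e | hs'
  · subst e
    have : E = 0 := le_antisymm hE hE0
    subst this
    linarith
  have h2 : s * y < s * hyp y := mul_lt_mul_of_pos_left hlt hs'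
  have hk : 0 < k := by linarith
  have hD' : E * E + k * k - s * s < 0 := by
    by_contra hc
    exact hD ⟨hk, by linarith⟩
  have h3 : (2 * s * hyp y) ^ 2 ≤ (k + 2 * E * y) ^ 2 := pow_le_pow_left₀ (by positivity) hy 2
  have h4 : (2 * s * hyp y) ^ 2 = s * s * (1 + 4 * y ^ 2) := by rw [mul_pow, hsq]; ring
  have h5 : (k + 2 * E * y) ^ 2 ≤ (E * E + k * k) * (1 + 4 * y ^ 2) := by
    nlinarith [sq_nonneg (E - 2 * k * y)]
  have h6 : (E * E + k * k) * (1 + 4 * y ^ 2) < s * s * (1 + 4 * y ^ 2) :=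
    mul_lt_mul_of_pos_right (by linarith) (by positivity)
  linarith

/-- Reduction of the constraint to nonnegative slopes. -/
theorem Ok.abs {e z : ℝ} (h : Ok s k e z) : Ok s k |e| |z| := by
  unfold Ok at *
  rw [hyp_abs]
  have : e * z ≤ |e| * |z| := by rw [← abs_mul]; exact le_abs_self _
  linarith

theorem Ok.of_abs {e y : ℝ} (h : Ok s k |e| y) : Ok s k e (if e < 0 then 0 - y else y) := by
  unfold Ok at *
  split_ifs with he
  · rw [zero_sub, hyp_neg]; rw [abs_of_neg he] at h; linarith
  · rw [abs_of_nonneg (not_lt.1 he)] at h; exact h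

/-- The first solution is unique. -/
theorem Ok.unique {e z z' : ℝ} (hs : 0 ≤ s) (h : Ok s k e z) (hm : ∀ w, Ok s k e w → |z| ≤ |w|)
    (h' : Ok s k e z') (hm' : ∀ w, Ok s k e w → |z'| ≤ |w|) : z = z' := by
  rcases abs_eq_abs.1 (le_antisymm (hm _ h') (hm' _ h)) with e1 | e1
  · exact e1
  · have h0 : Ok s k e 0 := by
      rcases le_total z 0 with hz | hz
      · exact Ok.convex hs h h' hz (by linarith)
      · exact Ok.convex hs h' h (by linarith) hz
    have := hm 0 h0
    have : z = 0 := by simpa using this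
    rw [this] at e1 ⊢
    linarith

/-- A point between the first solution and another one. -/
theorem Ok.between {e z₁ z z₂ : ℝ} (hs : 0 ≤ s) (h₁ : Ok s k e z₁)
    (hm : ∀ w, Ok s k e w → |z₁| ≤ |w|) (h₂ : Ok s k e z₂)
    (h : z₁ < z ∧ z ≤ z₂ ∨ z₂ ≤ z ∧ z < z₁) : Ok s k e z ∧ |z| ≤ |z₂| := by
  have hz : Ok s k e z := by
    rcases h with h | h
    · exact Ok.convex hs h₁ h₂ h.1.le h.2
    · exact Ok.convex hs h₂ h₁ h.1 h.2.le
  refine ⟨hz, ?_⟩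
  have hm1 := hm z hz
  rcases h with h | h
  · have : 0 ≤ z := by
      by_contra hc
      push Not at hc
      rw [abs_of_neg hc, abs_of_neg (by linarith)] at hm1
      linarith
    rw [abs_of_nonneg this, abs_of_nonneg (this.trans h.2)]
    exact h.2
  · have : z ≤ 0 := by
      by_contra hc
      push Not at hc
      rw [abs_of_pos hc, abs_of_pos (by linarith)] at hm1
      linarith
    rw [abs_of_nonpos this, abs_of_nonpos (h.1.trans this)]
    linarith [h.1]

end Solver

/-! ### Circles through two points, parametrised by the perpendicular bisector -/

section Bisector

/-- The point at height `z` on the bisector of `u` and `v`. -/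
noncomputable def bis (u v : ℂ) (z : ℝ) : ℂ :=
  ⟨(u.re + v.re) / 2 - z * (v.im - u.im), (u.im + v.im) / 2 + z * (v.re - u.re)⟩

/-- squared length of the segment -/
def len2 (u v : ℂ) : ℝ := (v.re - u.re) ^ 2 + (v.im - u.im) ^ 2

theorem len2_pos {u v : ℂ} (h : u ≠ v) : 0 < len2 u v := by
  have h1 : 0 ≤ len2 u v := by unfold len2; positivity
  refine h1.lt_of_ne fun e => h ?_
  unfold len2 at e
  have h2 : (v.re - u.re) ^ 2 = 0 := by nlinarith [sq_nonneg (v.re - u.re), sq_nonneg (v.im - u.im)]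
  have h3 : (v.im - u.im) ^ 2 = 0 := by nlinarith [sq_nonneg (v.re - u.re), sq_nonneg (v.im - u.im)]
  have h2 := pow_eq_zero_iff (two_ne_zero) |>.1 h2
  have h3 := pow_eq_zero_iff (two_ne_zero) |>.1 h3
  exact Complex.ext (by linarith) (by linarith)

theorem dist_sq (a b : ℂ) : dist a b ^ 2 = (a.re - b.re) ^ 2 + (a.im - b.im) ^ 2 := by
  rw [Complex.dist_eq_re_im, Real.sq_sqrt (by positivity)]

theorem dist_bis (u v : ℂ) (z : ℝ) : dist (bis u v z) u = √(len2 u v) * hyp z := by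
  rw [← sq_eq_sq₀ dist_nonneg (mul_nonneg (Real.sqrt_nonneg _) (hyp_pos z).le), dist_sq, mul_pow,
    Real.sq_sqrt (by unfold len2; positivity), hyp_sq]
  simp only [bis, len2]; ring

theorem dist_bis' (u v : ℂ) (z : ℝ) : dist (bis u v z) v = dist (bis u v z) u := by
  rw [← sq_eq_sq₀ dist_nonneg dist_nonneg, dist_sq, dist_sq]
  simp only [bis]; ring

theorem exists_bis {u v c : ℂ} (huv : u ≠ v) (h : dist c u = dist c v) : ∃ z, c = bis u v z := by
  have hl := len2_pos huv
  rw [← sq_eq_sq₀ dist_nonneg dist_nonneg, dist_sq, dist_sq] at h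
  refine ⟨((c.im - (u.im + v.im) / 2) * (v.re - u.re) -
    (c.re - (u.re + v.re) / 2) * (v.im - u.im)) / len2 u v, Complex.ext ?_ ?_⟩
  · simp only [bis]
    field_simp
    simp only [len2]
    linear_combination (v.re - u.re) * h
  · simp only [bis]
    field_simp
    simp only [len2]
    linear_combination (v.im - u.im) * h

variable (u v q : ℂ) (ρ : ℝ)
/-- first coefficient of the constraint on the bisector -/
noncomputable def kk : ℝ := ((u.re + v.re) / 2 - q.re) ^ 2 + ((u.im + v.im) / 2 - q.im) ^ 2 -
  len2 u v / 4 - ρ ^ 2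
/-- second coefficient of the constraint on the bisector -/
noncomputable def ee : ℝ := ((u.im + v.im) / 2 - q.im) * (v.re - u.re) -
  ((u.re + v.re) / 2 - q.re) * (v.im - u.im)
variable {u v q ρ}

/-- After squaring, the terms quadratic in `z` cancel. What remains is affine in `z` except for the
product of the radii, which contributes `hyp z`. -/
theorem ok_iff (hρ : 0 ≤ ρ) (z : ℝ) : dist (bis u v z) u + ρ ≤ dist (bis u v z) q ↔
    Ok (ρ * √(len2 u v)) (kk u v q ρ) (ee u v q) z := by
  have h1 : dist (bis u v z) q ^ 2 - (dist (bis u v z) u + ρ) ^ 2 =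
      kk u v q ρ + 2 * ee u v q * z - 2 * (ρ * √(len2 u v)) * hyp z := by
    have e : (dist (bis u v z) u + ρ) ^ 2 = dist (bis u v z) u ^ 2 +
        2 * ρ * dist (bis u v z) u + ρ ^ 2 := by ring
    rw [e, dist_sq, dist_sq, dist_bis]
    simp only [bis, kk, ee, len2]; ring
  rw [← sq_le_sq₀ (by positivity) dist_nonneg, Ok]
  constructor <;> intro h <;> linarith

/-- `c` is the centre of a minimum circle through `u` and `v` that avoids the disk around `q`. -/
structure PairOpt (u v q : ℂ) (ρ : ℝ) (c : ℂ) : Prop where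
  eq : dist c u = dist c v
  avoid : dist c u + ρ ≤ dist c q
  min : ∀ c' r, dist c' u ≤ r → dist c' v ≤ r → r + ρ ≤ dist c' q → dist c u ≤ r

/-- The centre can be moved towards a farthest point until another point is as far. -/
theorem exists_slide {a b p c : ℂ} (hb : dist c b ≤ dist c a)
    (hp : dist c p ≤ dist c a) : ∃ c', dist c c' + dist c' a = dist c a ∧
      max (dist c' b) (dist c' p) = dist c' a := by
  let g : ℝ → ℂ := fun t => AffineMap.lineMap c a t
  have hg : Continuous g := AffineMap.lineMap_continuous
  let f : ℝ → ℝ := fun t => max (dist (g t) b) (dist (g t) p) - dist (g t) a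
  have hf : Continuous f := by fun_prop
  have h0 : f 0 ≤ 0 := by simp [f, g, hb, hp]
  have h1 : 0 ≤ f 1 := by simp [f, g]
  -- At `t = 0` the point `a` is a farthest one; at `t = 1` the centre has arrived at `a`. In
  -- between the distances balance.
  obtain ⟨t, ht, hft⟩ := intermediate_value_Icc zero_le_one hf.continuousOn ⟨h0, h1⟩
  refine ⟨g t, ?_, by simpa [f, sub_eq_zero] using hft⟩
  rw [dist_left_lineMap, dist_lineMap_right, Real.norm_of_nonneg ht.1,
    Real.norm_of_nonneg (by linarith [ht.2])]
  ring

/-- The radius shrinks by exactly the distance that the centre travels, so the new disk stays inside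
the old one. -/
theorem slide_avoid {a c c' : ℂ} {r : ℝ} (h : dist c c' + dist c' a = dist c a)
    (hr : dist c a ≤ r) (hq : r + ρ ≤ dist c q) : dist c' a ≤ r ∧ dist c' a + ρ ≤ dist c' q := by
  have h1 := dist_triangle c c' q
  have h2 := dist_nonneg (x := c) (y := c')
  constructor <;> linarith

/-- It suffices to consider circles through both points. -/
theorem exists_bis_le (huv : u ≠ v) {c : ℂ} {r : ℝ} (hu : dist c u ≤ r) (hv : dist c v ≤ r)
    (hq : r + ρ ≤ dist c q) : ∃ z, dist (bis u v z) u ≤ r ∧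
      dist (bis u v z) u + ρ ≤ dist (bis u v z) q := by
  rcases le_total (dist c v) (dist c u) with h | h
  · obtain ⟨c', h1, h2⟩ := exists_slide h h
    rw [max_self] at h2
    obtain ⟨z, rfl⟩ := exists_bis huv h2.symm
    exact ⟨z, slide_avoid h1 hu hq⟩
  · obtain ⟨c', h1, h2⟩ := exists_slide h h
    rw [max_self] at h2
    obtain ⟨z, rfl⟩ := exists_bis huv h2
    have := slide_avoid h1 hv hq
    rw [dist_bis'] at this
    exact ⟨z, this⟩

theorem hyp_le_of_dist (huv : u ≠ v) {z w : ℝ} :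
    dist (bis u v z) u ≤ dist (bis u v w) u ↔ |z| ≤ |w| := by
  rw [dist_bis, dist_bis, mul_le_mul_iff_right₀ (Real.sqrt_pos.2 (len2_pos huv)), hyp_le_hyp]

/-- Sliding reduces the competition with all circles containing `u` and `v` to circles through both,
where the radius is monotone in the absolute height. This makes the problem one-dimensional. -/
theorem pairOpt_bis (huv : u ≠ v) (hρ : 0 ≤ ρ) (z : ℝ) : PairOpt u v q ρ (bis u v z) ↔
    Ok (ρ * √(len2 u v)) (kk u v q ρ) (ee u v q) z ∧
      ∀ w, Ok (ρ * √(len2 u v)) (kk u v q ρ) (ee u v q) w → |z| ≤ |w| := by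
  constructor
  · intro h
    refine ⟨(ok_iff hρ z).1 h.avoid, fun w hw => ?_⟩
    rw [← ok_iff hρ] at hw
    rw [← hyp_le_of_dist huv]
    exact h.min _ _ le_rfl (dist_bis' _ _ _).le hw
  · rintro ⟨h1, h2⟩
    refine ⟨(dist_bis' _ _ _).symm, (ok_iff hρ z).2 h1, fun c r hu hv hq => ?_⟩
    obtain ⟨w, hw1, hw2⟩ := exists_bis_le huv hu hv hq
    exact ((hyp_le_of_dist huv).2 (h2 w ((ok_iff hρ w).1 hw2))).trans hw1

/-- Uniqueness lets the search identify the circle computed for an edge of one triangle with the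
circle that `Down` quantifies over for the base of its child. -/
theorem PairOpt.unique (huv : u ≠ v) (hρ : 0 ≤ ρ) {c c' : ℂ} (h : PairOpt u v q ρ c)
    (h' : PairOpt u v q ρ c') : c = c' := by
  obtain ⟨z, rfl⟩ := exists_bis huv h.eq
  obtain ⟨z', rfl⟩ := exists_bis huv h'.eq
  rw [pairOpt_bis huv hρ] at h h'
  rw [Ok.unique (by positivity) h.1 h.2 h'.1 h'.2]

theorem PairOpt.symm {c : ℂ} (h : PairOpt u v q ρ c) : PairOpt v u q ρ c :=
  ⟨h.eq.symm, by rw [← h.eq]; exact h.avoid, fun c' r h1 h2 h3 => by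
    rw [← h.eq]; exact h.min c' r h2 h1 h3⟩

/-- If the minimum circle for two points misses a third one, then every circle through the two
points that contains the third one is at least as large as the circumcircle. -/
theorem PairOpt.circum_aux (huv : u ≠ v) (hρ : 0 ≤ ρ) {p c c' o : ℂ} {r : ℝ}
    (h : PairOpt u v q ρ c) (hp : dist c u < dist c p) (ho : dist o u = dist o v)
    (ho' : dist o u = dist o p) (hc : dist c' u = dist c' v) (hc' : dist c' p ≤ dist c' u)
    (hr : dist c' u ≤ r) (hq : dist c' u + ρ ≤ dist c' q) :
    dist o u ≤ r ∧ dist o u + ρ ≤ dist o q := by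
  obtain ⟨z₁, rfl⟩ := exists_bis huv h.eq
  obtain ⟨z₂, rfl⟩ := exists_bis huv hc
  obtain ⟨z, rfl⟩ := exists_bis huv ho
  rw [pairOpt_bis huv hρ] at h
  have hq' := (ok_iff hρ z₂).1 hq
  -- Along the bisector the power of `p` with respect to the circle through `u` and `v` is affine in
  -- the height. It is positive at the optimum and at most zero at the given circle, hence its zero,
  -- the circumcentre, lies between them.
  have key : ∃ α β : ℝ, ∀ w, dist (bis u v w) p ^ 2 - dist (bis u v w) u ^ 2 = α + β * w := by
    refine ⟨((u.re + v.re) / 2 - p.re) ^ 2 + ((u.im + v.im) / 2 - p.im) ^ 2 - len2 u v / 4,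
      2 * (((u.im + v.im) / 2 - p.im) * (v.re - u.re) -
        ((u.re + v.re) / 2 - p.re) * (v.im - u.im)), fun w => ?_⟩
    rw [dist_sq, dist_sq]
    simp only [bis, len2]; ring
  obtain ⟨α, β, hk⟩ := key
  have k1 : 0 < α + β * z₁ := by
    rw [← hk, sub_pos]; exact pow_lt_pow_left₀ hp dist_nonneg two_ne_zero
  have k2 : α + β * z₂ ≤ 0 := by
    rw [← hk, sub_nonpos]; exact pow_le_pow_left₀ dist_nonneg hc' 2
  have k0 : α + β * z = 0 := by rw [← hk, ho', sub_self]
  have hb := Ok.between (z := z) (by positivity) h.1 h.2 hq' (by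
    rcases lt_trichotomy β 0 with hβ | hβ | hβ
    · exact .inl ⟨by nlinarith, by nlinarith⟩
    · subst hβ; linarith
    · exact .inr ⟨by nlinarith, by nlinarith⟩)
  exact ⟨((hyp_le_of_dist huv).2 hb.2).trans hr, (ok_iff hρ z).2 hb.1⟩

/-- If the minimum circle for each pair of three points misses the third one, then the circumcircle
is the minimum circle for the three points, if there is any. -/
theorem circum_min {a b p o : ℂ} (hab : a ≠ b) (hap : a ≠ p) (hbp : b ≠ p) (hρ : 0 ≤ ρ)
    {c₁ c₂ c₃ : ℂ} (h₁ : PairOpt a b q ρ c₁) (h₂ : PairOpt a p q ρ c₂) (h₃ : PairOpt p b q ρ c₃)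
    (m₁ : dist c₁ a < dist c₁ p) (m₂ : dist c₂ a < dist c₂ b) (m₃ : dist c₃ p < dist c₃ a)
    (ho : dist o a = dist o b) (ho' : dist o a = dist o p) {c : ℂ} {r : ℝ}
    (ha : dist c a ≤ r) (hb : dist c b ≤ r) (hp : dist c p ≤ r) (hq : r + ρ ≤ dist c q) :
    dist o a ≤ r ∧ dist o a + ρ ≤ dist o q := by
  -- Slide the centre towards a farthest vertex until a second vertex is as far; the third one stays
  -- inside. `PairOpt.circum_aux` for these two finishes the proof, and the case distinction only
  -- determines which pair it is.
  rcases le_total (dist c b) (dist c a) with h1 | h1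
  · rcases le_total (dist c p) (dist c a) with h2 | h2
    · obtain ⟨c', h3, h4⟩ := exists_slide h1 h2
      obtain ⟨h5, h6⟩ := slide_avoid h3 ha hq
      rcases le_total (dist c' p) (dist c' b) with h7 | h7
      · rw [max_eq_left h7] at h4
        exact h₁.circum_aux hab hρ m₁ ho ho' h4.symm (h7.trans h4.le) h5 h6
      · rw [max_eq_right h7] at h4
        exact h₂.circum_aux hap hρ m₂ ho' ho h4.symm (h7.trans h4.le) h5 h6
    · obtain ⟨c', h3, h4⟩ := exists_slide h2 (h1.trans h2)
      obtain ⟨h5, h6⟩ := slide_avoid h3 hp hq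
      rcases le_total (dist c' b) (dist c' a) with h7 | h7
      · rw [max_eq_left h7] at h4
        rw [← h4] at h5 h6
        exact h₂.circum_aux hap hρ m₂ ho' ho h4 h7 h5 h6
      · rw [max_eq_right h7] at h4
        have := h₃.circum_aux hbp.symm hρ m₃ (ho'.symm.trans ho) ho'.symm h4.symm
          (h7.trans h4.le) h5 h6
        rwa [← ho'] at this
  · rcases le_total (dist c p) (dist c b) with h2 | h2
    · obtain ⟨c', h3, h4⟩ := exists_slide h1 h2
      obtain ⟨h5, h6⟩ := slide_avoid h3 hb hq
      rcases le_total (dist c' p) (dist c' a) with h7 | h7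
      · rw [max_eq_left h7] at h4
        rw [← h4] at h5 h6
        exact h₁.circum_aux hab hρ m₁ ho ho' h4 h7 h5 h6
      · rw [max_eq_right h7] at h4
        rw [← h4] at h5 h6
        have := h₃.circum_aux hbp.symm hρ m₃ (ho'.symm.trans ho) ho'.symm h4 h7 h5 h6
        rwa [← ho'] at this
    · obtain ⟨c', h3, h4⟩ := exists_slide h2 (h1.trans h2)
      obtain ⟨h5, h6⟩ := slide_avoid h3 hp hq
      rcases le_total (dist c' b) (dist c' a) with h7 | h7
      · rw [max_eq_right h7] at h4
        rw [← h4] at h5 h6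
        exact h₂.circum_aux hap hρ m₂ ho' ho h4 (h7) h5 h6
      · rw [max_eq_left h7] at h4
        have := h₃.circum_aux hbp.symm hρ m₃ (ho'.symm.trans ho) ho'.symm h4.symm
          (h7.trans h4.le) h5 h6
        rwa [← ho'] at this

end Bisector
end CircleSep

namespace CircleSep

/-! ### The search in the tree of triangles -/

section Search
variable {X Y : ℕ → ℝ} {m L x : ℕ} {Al H : ℕ → Prop} {nx pv ch lc op : ℕ → ℕ} {row : ℕ → ℕ → ℕ}

/-- The row of a triangle in the rank table: the triangles below that are visible, by rank. -/
def RowOk (L : ℕ) (lc ch : ℕ → ℕ) (row : ℕ → ℕ → ℕ) (t : ℕ) : Prop :=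
  ∃ r < L, row t r = t ∧ (∀ j < r, row t j = 0) ∧ row (lc t) r = 0 ∧ row (ch t) r = 0 ∧
    ∀ j, r < j → j < L → row t j = row (lc t) j + row (ch t) j ∧
      (row (lc t) j = 0 ∨ row (ch t) j = 0)

/-- the point at a position -/
def pt (X Y : ℕ → ℝ) (i : ℕ) : ℂ := ⟨X i, Y i⟩

/-- Circles through `u` and `v` that contain `o` and `o'` contain everything. -/
def EdgeOk (X Y : ℕ → ℝ) (m u v o o' : ℕ) : Prop :=
  ∀ c, dist c (pt X Y u) = dist c (pt X Y v) → dist c (pt X Y o) ≤ dist c (pt X Y u) →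
    dist c (pt X Y o') ≤ dist c (pt X Y u) → ∀ i ≤ m, dist c (pt X Y i) ≤ dist c (pt X Y u)

/-- What the query program relies on. -/
structure Tree (X Y : ℕ → ℝ) (m L x : ℕ) (N : ℕ → Prop) (nx pv ch lc op : ℕ → ℕ)
    (row : ℕ → ℕ → ℕ) : Prop where
  mem : ∀ t, N t → pv t < t ∧ t < nx t ∧ nx t ≤ m + 1
  left : ∀ t, N t → lc t ≠ 0 → N (lc t) ∧ pv (lc t) = pv t ∧ nx (lc t) = t
  right : ∀ t, N t → ch t ≠ 0 → N (ch t) ∧ pv (ch t) = t ∧ nx (ch t) = nx t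
  rootLeft : ch 0 ≠ 0 → N (ch 0) ∧ pv (ch 0) = 0 ∧ nx (ch 0) = x
  rootRight : ch x ≠ 0 → N (ch x) ∧ pv (ch x) = x ∧ nx (ch x) = m + 1
  last : pt X Y (m + 1) = pt X Y 0
  root_le : x ≤ m
  root_ne : pt X Y 0 ≠ pt X Y x
  tri_ne : ∀ t, N t → tri X Y (pv t) t (nx t) ≠ 0
  okLeft : ∀ t, N t → EdgeOk X Y m (pv t) t (nx t) (if lc t = 0 then pv t else lc t)
  okRight : ∀ t, N t → EdgeOk X Y m t (nx t) (pv t) (if ch t = 0 then t else ch t)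
  okUp : ∀ t, N t → EdgeOk X Y m (pv t) (nx t) t (op t)
  okRoot : EdgeOk X Y m 0 x (ch 0) (ch x)
  circ : ∀ t, N t → ∀ c, dist c (pt X Y (pv t)) = dist c (pt X Y t) →
    dist c (pt X Y (pv t)) = dist c (pt X Y (nx t)) →
    ∀ i ≤ m, dist c (pt X Y i) ≤ dist c (pt X Y (pv t))
  rowOk : ∀ t, N t → RowOk L lc ch row t
  rowZero : ∀ j < L, row 0 j = 0

/-- With these coefficients the excess is the power of the point with respect to the circle. This
links the algebraic triangulation to distances. -/
theorem exc_dist (c : ℂ) (r : ℝ) (i : ℕ) :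
    exc X Y (2 * c.re) (2 * c.im) (r ^ 2 - c.re ^ 2 - c.im ^ 2) i = dist c (pt X Y i) ^ 2 - r ^ 2 := by
  rw [dist_sq]; simp only [exc, nq, pt]; ring

theorem exc_le_iff {c : ℂ} {r : ℝ} (hr : 0 ≤ r) (i : ℕ) :
    exc X Y (2 * c.re) (2 * c.im) (r ^ 2 - c.re ^ 2 - c.im ^ 2) i ≤ 0 ↔ dist c (pt X Y i) ≤ r := by
  rw [exc_dist, sub_nonpos, sq_le_sq₀ dist_nonneg hr]

/-- A circle through `u` and `v` that contains the apex `o` of a triangle with base `u`, `v` contains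
all points on the same side. -/
theorem exc_side {A B C A' B' C' : ℝ} {u v o i : ℕ}
    (hu : exc X Y A B C u = 0) (hv : exc X Y A B C v = 0) (ho : exc X Y A B C o ≤ 0)
    (hu' : exc X Y A' B' C' u = 0) (hv' : exc X Y A' B' C' v = 0) (ho' : exc X Y A' B' C' o = 0)
    (hi : exc X Y A' B' C' i ≤ 0) (h : 0 < tri X Y u v o ∧ 0 < tri X Y u v i ∨
      tri X Y u v o < 0 ∧ tri X Y u v i < 0) : exc X Y A B C i ≤ 0 := by
  have e := tri_exc X Y A B C A' B' C' u v o i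
  rw [hu, hv, hu', hv', ho'] at e
  rcases h with ⟨h1, h2⟩ | ⟨h1, h2⟩
  · by_contra hc
    nlinarith [mul_pos h1 (by linarith : 0 < exc X Y A B C i - exc X Y A' B' C' i)]
  · by_contra hc
    nlinarith [mul_pos (neg_pos.2 h1) (by linarith : 0 < exc X Y A B C i - exc X Y A' B' C' i)]

/-- There is a circle through `u`, `v`, `o` that contains the hull. -/
def Guard (X Y : ℕ → ℝ) (H : ℕ → Prop) (u v o : ℕ) : Prop :=
  ∃ A B C, exc X Y A B C u = 0 ∧ exc X Y A B C v = 0 ∧ exc X Y A B C o = 0 ∧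
    ∀ i, i = 0 ∨ H i → exc X Y A B C i ≤ 0

/-- The given circle and the guard circle of a side agree at `u` and `v`, so the difference of their
excesses is affine with zero line `u v`. Its sign at the apex is its sign on the whole side, and the
guard circle contains all hull vertices. A side without triangle has no hull vertices beyond the
edge. -/
theorem edgeOk_of_guard (hs : Sorted X Y m) (hH : HullConvex X Y m H)
    (hr : ∀ i, H i → 0 < i ∧ i < m + 1) (hull : Hull X Y m H) {u v o o' : ℕ} (huv : u < v)
    (hu : u = 0 ∨ H u) (hv : v = m + 1 ∨ H v) (hne : ¬ (u = 0 ∧ v = m + 1))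
    (h1 : (∀ i, H i → u < i → i < v → False) ∨ u < o ∧ o < v ∧ H o ∧ Guard X Y H u v o)
    (h2 : (∀ i, H i → ¬ (i < u ∨ v < i)) ∧ (u = 0 ∨ v = m + 1) ∨
      0 < tri X Y u v o' ∧ Guard X Y H u v o') : EdgeOk X Y m u v o o' := by
  intro c hc ho ho'
  have hr0 : 0 ≤ dist c (pt X Y u) := dist_nonneg
  have eu := exc_dist (X := X) (Y := Y) c (dist c (pt X Y u)) u
  have ev := exc_dist (X := X) (Y := Y) c (dist c (pt X Y u)) v
  rw [sub_self] at eu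
  rw [← hc, sub_self] at ev
  rw [← exc_le_iff hr0] at ho ho'
  have key : ∀ i, i = 0 ∨ H i → exc X Y (2 * c.re) (2 * c.im)
      (dist c (pt X Y u) ^ 2 - c.re ^ 2 - c.im ^ 2) i ≤ 0 := by
    intro i hi
    have hile : i ≤ m := by
      rcases hi with e | e
      · omega
      · have := hr i e; omega
    have hout : i < u ∨ v < i → 0 < tri X Y u v i ∨ (i = 0 ∧ v = m + 1) := by
      rintro (h | h)
      · rw [tri_rot X Y i u v]
        by_cases hb : i = 0 ∧ v = m + 1
        · exact .inr hb
        · exact .inl (hH i u v hi (hu.resolve_left (by omega)) hv h huv hb)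
      · exact .inl (hH u v i hu (hv.resolve_left (by omega)) (.inr (hi.resolve_left (by omega)))
          huv h (by omega))
    -- Position `0` counts as lying before the edge, but it carries the same point as the endpoint
    -- `m + 1`.
    have hend : i = 0 ∧ v = m + 1 → exc X Y (2 * c.re) (2 * c.im)
        (dist c (pt X Y u) ^ 2 - c.re ^ 2 - c.im ^ 2) i ≤ 0 := by
      rintro ⟨e1, e2⟩
      rw [e1, ← hs.exc_last, ← e2, ev]
    rcases lt_trichotomy i u with h | h | h
    · rcases h2 with ⟨g1, g2⟩ | ⟨g1, A', B', C', g2, g3, g4, g5⟩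
      · rcases hi with e | e
        · exact hend ⟨e, by omega⟩
        · exact (g1 i e (.inl h)).elim
      · rcases hout (.inl h) with g | g
        · exact exc_side eu ev ho' g2 g3 g4 (g5 i hi) (.inl ⟨g1, g⟩)
        · exact hend g
    · rw [h, eu]
    · rcases lt_trichotomy i v with h' | h' | h'
      · have hiH := hi.resolve_left (by omega)
        have sg : ∀ k, H k → u < k → k < v → tri X Y u v k < 0 := fun k hk k1 k2 => by
          have e : tri X Y u v k = -tri X Y u k v := by simp only [tri, cr]; ring
          rw [e, neg_lt_zero]
          exact hH u k v hu hk hv k1 k2 hne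
        rcases h1 with g1 | ⟨g1, g2, g3, A', B', C', g4, g5, g6, g7⟩
        · exact (g1 i hiH h h').elim
        · exact exc_side eu ev ho g4 g5 g6 (g7 i hi) (.inr ⟨sg o g3 g1 g2, sg i hiH h h'⟩)
      · rw [h', ev]
      · rcases h2 with ⟨g1, g2⟩ | ⟨g1, A', B', C', g2, g3, g4, g5⟩
        · exact (g1 i (hi.resolve_left (by omega)) (.inr h')).elim
        · rcases hout (.inr h') with g | g
          · exact exc_side eu ev ho' g2 g3 g4 (g5 i hi) (.inl ⟨g1, g⟩)
          · exact hend g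
  intro i hi
  rw [← exc_le_iff hr0]
  rcases Nat.eq_zero_or_pos i with e | e
  · exact key i (.inl e)
  · refine hull _ _ _ ?_ (fun j hj => key j (.inr hj)) i e (by omega)
    simpa [exc, nq, hs.X0, hs.Y0] using key 0 (.inl rfl)

theorem EdgeOk.symm_apex {u v o o' : ℕ} (h : EdgeOk X Y m u v o o') : EdgeOk X Y m u v o' o :=
  fun c h1 h2 h3 => h c h1 h3 h2

theorem Forest.guard (h : Forest X Y m Al H nx pv ch lc op) {t : ℕ} (h1 : H t) (h2 : ¬ Al t) :
    Guard X Y H (pv t) t (nx t) := h.circ t h1 h2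

theorem Guard.rotate {u v o : ℕ} : Guard X Y H u v o → Guard X Y H v o u :=
  fun ⟨A, B, C, h1, h2, h3, h4⟩ => ⟨A, B, C, h2, h3, h1, h4⟩
theorem Guard.flip {u v o : ℕ} : Guard X Y H u v o → Guard X Y H u o v :=
  fun ⟨A, B, C, h1, h2, h3, h4⟩ => ⟨A, B, C, h1, h3, h2, h4⟩
theorem Guard.last_to_zero (hs : Sorted X Y m) {u o : ℕ} :
    Guard X Y H u (m + 1) o → Guard X Y H u 0 o :=
  fun ⟨A, B, C, h1, h2, h3, h4⟩ => ⟨A, B, C, h1, by rwa [← hs.exc_last], h3, h4⟩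
theorem Guard.zero_to_last (hs : Sorted X Y m) {u o : ℕ} :
    Guard X Y H u 0 o → Guard X Y H u (m + 1) o :=
  fun ⟨A, B, C, h1, h2, h3, h4⟩ => ⟨A, B, C, h1, by rwa [hs.exc_last], h3, h4⟩

/-- When only the vertex `x` is left, the triangles form a search tree. -/
theorem Forest.tree (hs : Sorted X Y m) (h : Forest X Y m Al H nx pv ch lc op)
    (hx0 : 0 < x) (hxm : x < m + 1) (hal : ∀ i, Al i ↔ i = 0 ∨ i = x ∨ i = m + 1)
    (hxne : pt X Y 0 ≠ pt X Y x)
    (hrow : ∀ t, H t → ¬ Al t → RowOk L lc ch row t) (hz : ∀ j < L, row 0 j = 0) :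
    Tree X Y m L x (fun t => H t ∧ ¬ Al t) nx pv ch lc
      (Function.update (Function.update op (ch 0) (ch x)) (ch x) (ch 0)) row := by
  have a0 : Al 0 := h.chain.zero
  have ax : Al x := (hal x).2 (.inr (.inl rfl))
  have hn0 := h.chain.next 0 a0 (by omega)
  have hnx := h.chain.next x ax hxm
  have e0 : nx 0 = x := by
    have := h.chain.next_le a0 ax hx0
    rcases (hal _).1 hn0.2.1 with e | e | e <;> omega
  have ex : nx x = m + 1 := by
    rcases (hal _).1 hnx.2.1 with e | e | e <;> omega
  have hxH := h.sub x ax hx0 hxm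
  have E0 := h.edge 0 a0 (by omega)
  have Ex := h.edge x ax hxm
  rw [e0] at E0
  rw [ex] at Ex
  have hbne : ∀ {u v c}, Below Al H nx pv u v c → c ≠ 0 → H c ∧ ¬ Al c ∧ pv c = u ∧ nx c = v :=
    fun hB hc0 => hB.resolve_left fun hh => hc0 hh.1
  have hpos : ∀ c, H c → c ≠ 0 := fun c hc => by have := h.range c hc; omega
  -- A chain with the single inner vertex `x` is convex by default, as its successor is `m + 1`.
  have hH := h.convex hs (fun i hi h1 h2 => .inr (by
    rcases (hal i).1 hi with e | e | e
    · omega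
    · rw [e, ex]
    · omega))
  have hno : ∀ {u v c}, Below Al H nx pv u v c → c = 0 → ∀ i, H i → u < i → i < v → False :=
    fun hB hc0 => (hB.resolve_right fun hh => hpos _ hh.1 hc0).2
  have hm1 : ¬ H (m + 1) := fun hh => by have := h.range _ hh; omega
  have h0 : ¬ H 0 := fun hh => by have := h.range _ hh; omega
  have hmem : ∀ t, H t → ¬ Al t → (pv t = 0 ∨ H (pv t)) ∧ (nx t = m + 1 ∨ H (nx t)) ∧ pv t < t ∧
    t < nx t ∧ ¬ (pv t = 0 ∧ nx t = m + 1) := h.node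
  have hnm : ∀ t, H t → ¬ Al t → nx t ≤ m + 1 := fun t h1 h2 => by
    rcases (h.node t h1 h2).2.1 with e | e
    · omega
    · have := h.range _ e; omega
  have htri : ∀ t, H t → ¬ Al t → 0 < tri X Y (pv t) t (nx t) := fun t h1 h2 => by
    obtain ⟨k1, k2, k3, k4, k5⟩ := hmem t h1 h2
    exact hH _ _ _ k1 h1 k2 k3 k4 k5
  have hop : ∀ t, H t → ¬ Al t → t ≠ ch 0 → t ≠ ch x → ∃ f, H f ∧ ¬ Al f ∧
      (lc f = t ∧ op t = nx f ∨ ch f = t ∧ op t = pv f) := fun t h1 h2 h3 h4 => by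
    rcases h.up t h1 h2 with ⟨u1, u2, u3⟩ | ⟨f, f1, f2, f3⟩
    · rcases (hal _).1 u1 with e | e | e
      · rw [e] at u3; exact (h3 u3.symm).elim
      · rw [e] at u3; exact (h4 u3.symm).elim
      · have := (hmem t h1 h2).2.2; have := h.range t h1; omega
    · refine ⟨f, f1, f2, f3.imp (fun e => ⟨e, ?_⟩) (fun e => ⟨e, ?_⟩)⟩
      · rw [← e]; exact h.opLeft f f1 f2 (by rw [e]; exact hpos t h1)
      · rw [← e]; exact h.opRight f f1 f2 (by rw [e]; exact hpos t h1)
  refine ⟨fun t ht => ⟨(hmem t ht.1 ht.2).2.2.1, (hmem t ht.1 ht.2).2.2.2.1, hnm t ht.1 ht.2⟩,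
    fun t ht hc => ?_, fun t ht hc => ?_, fun hc => ?_, fun hc => ?_, ?_, by omega, hxne,
    fun t ht => (htri t ht.1 ht.2).ne', ?_, ?_, ?_, ?_, ?_, fun t ht => hrow t ht.1 ht.2, hz⟩
  · have := hbne (h.left t ht.1 ht.2) hc
    exact ⟨⟨this.1, this.2.1⟩, this.2.2⟩
  · have := hbne (h.right t ht.1 ht.2) hc
    exact ⟨⟨this.1, this.2.1⟩, this.2.2⟩
  · have := hbne E0 hc
    exact ⟨⟨this.1, this.2.1⟩, this.2.2⟩
  · have := hbne Ex hc
    exact ⟨⟨this.1, this.2.1⟩, this.2.2⟩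
  · simp [pt, hs.X0, hs.Y0, hs.Xm, hs.Ym]
  · rintro t ⟨h1, h2⟩
    obtain ⟨k1, k2, k3, k4, k5⟩ := hmem t h1 h2
    refine EdgeOk.symm_apex (edgeOk_of_guard hs hH h.range h.hull k3 k1 (.inr h1)
      (fun hh => hm1 (hh.2 ▸ h1)) ?_ (.inr ⟨htri t h1 h2, h.guard h1 h2⟩))
    split_ifs with hc
    · exact .inl (hno (h.left t h1 h2) hc)
    · obtain ⟨l1, l2, l3, l4⟩ := hbne (h.left t h1 h2) hc
      have hl := hmem _ l1 l2
      have hg := h.guard l1 l2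
      rw [l3, l4] at hl hg
      exact .inr ⟨hl.2.2.1, hl.2.2.2.1, l1, hg.flip⟩
  · rintro t ⟨h1, h2⟩
    obtain ⟨k1, k2, k3, k4, k5⟩ := hmem t h1 h2
    refine EdgeOk.symm_apex (edgeOk_of_guard hs hH h.range h.hull k4 (.inr h1) k2
      (fun hh => h0 (hh.1 ▸ h1)) ?_ (.inr ⟨?_, (h.guard h1 h2).rotate⟩))
    · split_ifs with hc
      · exact .inl (hno (h.right t h1 h2) hc)
      · obtain ⟨l1, l2, l3, l4⟩ := hbne (h.right t h1 h2) hc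
        have hl := hmem _ l1 l2
        have hg := h.guard l1 l2
        rw [l3, l4] at hl hg
        exact .inr ⟨hl.2.2.1, hl.2.2.2.1, l1, hg.flip⟩
    · rw [tri_rot]; exact htri t h1 h2
  · rintro t ⟨h1, h2⟩
    obtain ⟨k1, k2, k3, k4, k5⟩ := hmem t h1 h2
    refine edgeOk_of_guard hs hH h.range h.hull (k3.trans k4) k1 k2 k5
      (.inr ⟨k3, k4, h1, (h.guard h1 h2).flip⟩) ?_
    -- The edges `0, x` and `x, m + 1` are the same segment, so the root triangles `ch 0` and `ch x`
    -- face each other. Any other triangle faces the third vertex of its parent.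
    by_cases hx1 : t = ch x
    · have b := hbne Ex (hx1 ▸ hpos t h1)
      rw [← hx1] at b
      rw [hx1, Function.update_self, ← hx1, b.2.2.1, b.2.2.2]
      by_cases hc : ch 0 = 0
      · exact .inl ⟨fun i hi hh => hno E0 hc i hi (h.range i hi).1 (by have := h.range i hi; omega),
          .inr rfl⟩
      · obtain ⟨l1, l2, l3, l4⟩ := hbne E0 hc
        have hl := hmem _ l1 l2
        have hg := h.guard l1 l2
        rw [l3, l4] at hl hg
        refine .inr ⟨?_, hg.rotate.rotate.zero_to_last hs⟩
        rw [tri_rot]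
        exact hH _ _ _ (.inr l1) hxH (.inl rfl) hl.2.2.2.1 hxm (by omega)
    · rw [Function.update_of_ne hx1]
      by_cases hx2 : t = ch 0
      · have b := hbne E0 (hx2 ▸ hpos t h1)
        rw [← hx2] at b
        rw [hx2, Function.update_self, ← hx2, b.2.2.1, b.2.2.2]
        by_cases hc : ch x = 0
        · exact .inl ⟨fun i hi hh => hno Ex hc i hi (by omega) (h.range i hi).2, .inl rfl⟩
        · obtain ⟨l1, l2, l3, l4⟩ := hbne Ex hc
          have hl := hmem _ l1 l2
          have hg := h.guard l1 l2
          rw [l3, l4] at hl hg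
          exact .inr ⟨hH _ _ _ (.inl rfl) hxH (.inr l1) hx0 hl.2.2.1 (by have := h.range _ l1; omega),
            (hg.flip.last_to_zero hs).rotate.flip⟩
      · rw [Function.update_of_ne hx2]
        obtain ⟨f, f1, f2, ⟨f3, f4⟩ | ⟨f3, f4⟩⟩ := hop t h1 h2 hx2 hx1
        · have b := hbne (h.left f f1 f2) (by rw [f3]; exact hpos t h1)
          rw [f3] at b
          rw [f4, b.2.2.1, b.2.2.2]
          exact .inr ⟨htri f f1 f2, h.guard f1 f2⟩
        · have b := hbne (h.right f f1 f2) (by rw [f3]; exact hpos t h1)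
          rw [f3] at b
          rw [f4, b.2.2.1, b.2.2.2]
          exact .inr ⟨by rw [tri_rot]; exact htri f f1 f2, (h.guard f1 f2).rotate⟩
  · refine edgeOk_of_guard hs hH h.range h.hull hx0 (.inl rfl) (.inr hxH) (by omega) ?_ ?_
    · by_cases hc : ch 0 = 0
      · exact .inl (hno E0 hc)
      · obtain ⟨l1, l2, l3, l4⟩ := hbne E0 hc
        have hl := hmem _ l1 l2
        have hg := h.guard l1 l2
        rw [l3, l4] at hl hg
        exact .inr ⟨hl.2.2.1, hl.2.2.2.1, l1, hg.flip⟩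
    · by_cases hc : ch x = 0
      · exact .inl ⟨fun i hi hh => hno Ex hc i hi (by omega) (h.range i hi).2, .inl rfl⟩
      · obtain ⟨l1, l2, l3, l4⟩ := hbne Ex hc
        have hl := hmem _ l1 l2
        have hg := h.guard l1 l2
        rw [l3, l4] at hl hg
        exact .inr ⟨hH _ _ _ (.inl rfl) hxH (.inr l1) hx0 hl.2.2.1 (by have := h.range _ l1; omega),
          (hg.flip.last_to_zero hs).rotate.flip⟩
  · rintro t ⟨h1, h2⟩ c d1 d2 i hi
    have hr0 : 0 ≤ dist c (pt X Y (pv t)) := dist_nonneg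
    have eu := exc_dist (X := X) (Y := Y) c (dist c (pt X Y (pv t))) (pv t)
    have ev := exc_dist (X := X) (Y := Y) c (dist c (pt X Y (pv t))) t
    have eo := exc_dist (X := X) (Y := Y) c (dist c (pt X Y (pv t))) (nx t)
    rw [sub_self] at eu
    rw [← d1, sub_self] at ev
    rw [← d2, sub_self] at eo
    obtain ⟨A', B', C', g1, g2, g3, g4⟩ := h.guard h1 h2
    have key : ∀ j, j = 0 ∨ H j → exc X Y (2 * c.re) (2 * c.im)
        (dist c (pt X Y (pv t)) ^ 2 - c.re ^ 2 - c.im ^ 2) j ≤ 0 := fun j hj => by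
      have e := tri_exc X Y (2 * c.re) (2 * c.im)
        (dist c (pt X Y (pv t)) ^ 2 - c.re ^ 2 - c.im ^ 2) A' B' C' (pv t) t (nx t) j
      rw [eu, ev, eo, g1, g2, g3] at e
      simp only [sub_self, mul_zero, add_zero, mul_eq_zero, (htri t h1 h2).ne', false_or] at e
      have := g4 j hj
      linarith
    rw [← exc_le_iff hr0]
    rcases Nat.eq_zero_or_pos i with e | e
    · exact key i (.inl e)
    · refine h.hull _ _ _ ?_ (fun j hj => key j (.inr hj)) i e (by omega)
      simpa [exc, nq, hs.X0, hs.Y0] using key 0 (.inl rfl)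

/-- What is visible in a row stays visible above. -/
theorem Tree.row_up {N : ℕ → Prop} (h : Tree X Y m L x N nx pv ch lc op row) {y j : ℕ} (hy : N y)
    (hj : j < L) (hu : row y j ≠ 0) : N (row y j) ∧ row (lc (row y j)) j = 0 ∧
      row (ch (row y j)) j = 0 ∧ ∀ j', j < j' → j' < L →
      (row (lc (row y j)) j' ≠ 0 → row y j' = row (lc (row y j)) j') ∧
      (row (ch (row y j)) j' ≠ 0 → row y j' = row (ch (row y j)) j') := by
  -- The base of a child spans fewer positions, so the span serves as the induction measure on the
  -- tree.
  induction hd : nx y - pv y using Nat.strong_induction_on generalizing y with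
  | _ d ih =>
  obtain ⟨r, r1, r2, r3, r4, r5, r6⟩ := h.rowOk y hy
  have hmy := h.mem y hy
  rcases lt_trichotomy j r with hjr | rfl | hjr
  · exact (hu (r3 j hjr)).elim
  · rw [r2]
    refine ⟨hy, r4, r5, fun j' h1 h2 => ?_⟩
    obtain ⟨e, e' | e'⟩ := r6 j' h1 h2
    · exact ⟨fun hh => (hh e').elim, fun _ => by omega⟩
    · exact ⟨fun _ => by omega, fun hh => (hh e').elim⟩
  · obtain ⟨e, e'⟩ := r6 j hjr hj
    by_cases hl : row (lc y) j = 0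
    · have e2 : row y j = row (ch y) j := by omega
      have hc0 : ch y ≠ 0 := fun hh => hu (by rw [e2, hh, h.rowZero j hj])
      obtain ⟨c1, c2, c3⟩ := h.right y hy hc0
      have hmc := h.mem _ c1
      obtain ⟨i1, i2, i3, i4⟩ := ih _ (by omega) c1 (by rw [← e2]; exact hu) rfl
      rw [← e2] at i1 i2 i3 i4
      refine ⟨i1, i2, i3, fun j' h1 h2 => ?_⟩
      obtain ⟨f, f'⟩ := r6 j' (by omega) h2
      exact ⟨fun hh => by have := (i4 j' h1 h2).1 hh; omega,
        fun hh => by have := (i4 j' h1 h2).2 hh; omega⟩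
    · have e2 : row y j = row (lc y) j := by omega
      have hc0 : lc y ≠ 0 := fun hh => hu (by rw [e2, hh, h.rowZero j hj])
      obtain ⟨c1, c2, c3⟩ := h.left y hy hc0
      have hmc := h.mem _ c1
      obtain ⟨i1, i2, i3, i4⟩ := ih _ (by omega) c1 (by rw [← e2]; exact hu) rfl
      rw [← e2] at i1 i2 i3 i4
      refine ⟨i1, i2, i3, fun j' h1 h2 => ?_⟩
      obtain ⟨f, f'⟩ := r6 j' (by omega) h2
      exact ⟨fun hh => by have := (i4 j' h1 h2).1 hh; omega,
        fun hh => by have := (i4 j' h1 h2).2 hh; omega⟩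

/-- The base of the triangle `t` directs downward: its minimum circle misses `t`. -/
def Down (X Y : ℕ → ℝ) (nx pv : ℕ → ℕ) (q : ℂ) (ρ : ℝ) (t : ℕ) : Prop :=
  ∀ c, PairOpt (pt X Y (pv t)) (pt X Y (nx t)) q ρ c →
    dist c (pt X Y (pv t)) < dist c (pt X Y t)

/-- The state of the search: the sought triangle is below `y`, but not below the triangles that are
visible from `y` and have a rank of at least `j`. -/
structure SearchInv (X Y : ℕ → ℝ) (L : ℕ) (N : ℕ → Prop) (nx pv : ℕ → ℕ) (row : ℕ → ℕ → ℕ)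
    (q : ℂ) (ρ : ℝ) (y j : ℕ) : Prop where
  mem : N y
  down : Down X Y nx pv q ρ y
  up : ∀ j', j ≤ j' → j' < L → row y j' ≠ 0 → ¬ Down X Y nx pv q ρ (row y j')

variable {N : ℕ → Prop} {q : ℂ} {ρ : ℝ}

/-- At its own rank a triangle sees itself, so with all columns excluded the invariant would deny
that the base of `y` points into `y`. This is why the search cannot fail. -/
theorem SearchInv.pos (h : Tree X Y m L x N nx pv ch lc op row) {y j : ℕ}
    (hi : SearchInv X Y L N nx pv row q ρ y j) : 0 < j := by
  by_contra hc
  obtain ⟨r, r1, r2, -⟩ := h.rowOk y hi.mem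
  have hm := h.mem y hi.mem
  have := hi.up r (by omega) r1 (by omega)
  rw [r2] at this
  exact this hi.down

theorem SearchInv.skip {y j : ℕ} (hi : SearchInv X Y L N nx pv row q ρ y (j + 1))
    (h0 : row y j = 0 ∨ ¬ Down X Y nx pv q ρ (row y j)) :
    SearchInv X Y L N nx pv row q ρ y j := by
  refine ⟨hi.mem, hi.down, fun j' h1 h2 h3 => ?_⟩
  rcases h1.eq_or_lt with e | e
  · subst e; exact h0.resolve_left h3
  · exact hi.up j' e h2 h3

/-- By `Tree.row_up`, what the child sees beyond column `j` is seen by `y` as well and has been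
excluded already, while column `j` of the child is empty because the visited triangle occupies that
rank. -/
theorem SearchInv.goLeft (h : Tree X Y m L x N nx pv ch lc op row) {y j : ℕ}
    (hi : SearchInv X Y L N nx pv row q ρ y (j + 1)) (hj : j < L) (hu : row y j ≠ 0)
    (hc : lc (row y j) ≠ 0) (hd : Down X Y nx pv q ρ (lc (row y j))) :
    SearchInv X Y L N nx pv row q ρ (lc (row y j)) j := by
  obtain ⟨i1, i2, i3, i4⟩ := h.row_up hi.mem hj hu
  refine ⟨(h.left _ i1 hc).1, hd, fun j' h1 h2 h3 => ?_⟩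
  rcases h1.eq_or_lt with e | e
  · subst e; exact (h3 i2).elim
  · have := (i4 j' e h2).1 h3
    rw [← this] at h3 ⊢
    exact hi.up j' e h2 h3

theorem SearchInv.goRight (h : Tree X Y m L x N nx pv ch lc op row) {y j : ℕ}
    (hi : SearchInv X Y L N nx pv row q ρ y (j + 1)) (hj : j < L) (hu : row y j ≠ 0)
    (hc : ch (row y j) ≠ 0) (hd : Down X Y nx pv q ρ (ch (row y j))) :
    SearchInv X Y L N nx pv row q ρ (ch (row y j)) j := by
  obtain ⟨i1, i2, i3, i4⟩ := h.row_up hi.mem hj hu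
  refine ⟨(h.right _ i1 hc).1, hd, fun j' h1 h2 h3 => ?_⟩
  rcases h1.eq_or_lt with e | e
  · subst e; exact (h3 i3).elim
  · have := (i4 j' e h2).2 h3
    rw [← this] at h3 ⊢
    exact hi.up j' e h2 h3

end Search
end CircleSep

namespace CircleSep

/-! ### The tournament -/

/-- The key of an item. -/
noncomputable def State.key (s : State) (i : ℕ) : ℕ ×ₗ (ℝ ×ₗ ℝ) :=
  toLex (s.wordArr 1 i, toLex (s.realArr 4 i, s.realArr 5 i))

theorem better_holds (s : State) (i j : WExp) :
    (better i j).holds s ↔ s.key (j.eval s) < s.key (i.eval s) := by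
  simp [better, State.key, Prod.Lex.lt_iff]

/-- The match at the node `v` has been played correctly. -/
def NodeOk (s : State) (v : ℕ) : Prop :=
  (s.wordArr 0 v = s.wordArr 0 (2 * v) ∨ s.wordArr 0 v = s.wordArr 0 (2 * v + 1)) ∧
    s.key (s.wordArr 0 (2 * v)) ≤ s.key (s.wordArr 0 v) ∧
    s.key (s.wordArr 0 (2 * v + 1)) ≤ s.key (s.wordArr 0 v)

/-- A tournament with `M` items, in which the matches at the nodes `P` have been played. -/
structure Tour (M : ℕ) (P : ℕ → Prop) (s : State) : Prop where
  size : s.word 5 = M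
  leaf : ∀ i < M, s.wordArr 0 (M + i) = i
  lt : ∀ v, 1 ≤ v → v < 2 * M → P v → s.wordArr 0 v < M
  ok : ∀ v, 1 ≤ v → v < M → P v → NodeOk s v

variable {M W : ℕ} {P P' : ℕ → Prop} {s s' : State}

theorem Tour.top_lt (h : Tour M (fun _ => True) s) (hM : 1 ≤ M) : s.wordArr 0 1 < M :=
  h.lt 1 le_rfl (by omega) trivial

theorem Tour.le_top (h : Tour M (fun _ => True) s) {i : ℕ} (hi : i < M) :
    s.key i ≤ s.key (s.wordArr 0 1) := by
  have key : ∀ v, 1 ≤ v → v < 2 * M → s.key (s.wordArr 0 v) ≤ s.key (s.wordArr 0 1) := by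
    intro v
    induction v using Nat.strong_induction_on with
    | _ v ih =>
    intro h1 h2
    rcases h1.eq_or_lt with e | e
    · rw [← e]
    · have h3 := ih (v / 2) (by omega) (by omega) (by omega)
      have h4 := h.ok (v / 2) (by omega) (by omega) trivial
      rcases Nat.mod_two_eq_zero_or_one v with e | e
      · have : v = 2 * (v / 2) := by omega
        rw [this]; exact h4.2.1.trans h3
      · have : v = 2 * (v / 2) + 1 := by omega
        rw [this]; exact h4.2.2.trans h3
  have := key (M + i) (by omega) (by omega)
  rwa [h.leaf i hi] at this

/-- The winner at a node is copied from a child, hence it comes from a leaf below. As halving leads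
to the parent, an item can win only at nodes above its leaf. -/
theorem Tour.ancestor (h : Tour M (fun _ => True) s) {v : ℕ} (h1 : 1 ≤ v) (h2 : v < 2 * M) :
    ∃ k, (M + s.wordArr 0 v) / 2 ^ k = v := by
  induction hd : 2 * M - v using Nat.strong_induction_on generalizing v with
  | _ d ih =>
  by_cases hv : v < M
  · have hstep : ∀ w, w = 2 * v ∨ w = 2 * v + 1 → s.wordArr 0 v = s.wordArr 0 w →
        ∃ k, (M + s.wordArr 0 v) / 2 ^ k = v := fun w hw e => by
      obtain ⟨k, hk⟩ := ih (2 * M - w) (by omega) (v := w) (by omega) (by omega) rfl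
      refine ⟨k + 1, ?_⟩
      rw [e, pow_succ, ← Nat.div_div_eq_div_mul, hk]
      omega
    rcases (h.ok v h1 hv trivial).1 with e | e
    · exact hstep _ (.inl rfl) e
    · exact hstep _ (.inr rfl) e
  · refine ⟨0, ?_⟩
    have := h.leaf (v - M) (by omega)
    rw [show M + (v - M) = v by omega] at this
    rw [this]; simp; omega

/-- Changing the key of an item only invalidates the matches above its leaf. -/
theorem Tour.change (h : Tour M (fun _ => True) s) {i : ℕ} (h5 : s'.word 5 = s.word 5)
    (hw : s'.wordArr 0 = s.wordArr 0) (hk : ∀ j, j ≠ i → s'.key j = s.key j) :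
    Tour M (fun v => ∀ k, 1 ≤ k → (M + i) / 2 ^ k ≠ v) s' := by
  refine ⟨by rw [h5, h.size], by rw [hw]; exact h.leaf, fun v h1 h2 _ => ?_, fun v h1 h2 h3 => ?_⟩
  · rw [hw]; exact h.lt v h1 h2 trivial
  · have hne : ∀ w, w = v ∨ w = 2 * v ∨ w = 2 * v + 1 → s.wordArr 0 w ≠ i := by
      rintro w hw rfl
      obtain ⟨k, hk⟩ := h.ancestor (v := w) (by omega) (by omega)
      rcases hw with e | e
      · rcases Nat.eq_zero_or_pos k with e' | e'
        · subst e'; simp at hk; omega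
        · exact h3 k e' (hk.trans e)
      · refine h3 (k + 1) (by omega) ?_
        rw [pow_succ, ← Nat.div_div_eq_div_mul, hk]
        omega
    have := h.ok v h1 h2 trivial
    unfold NodeOk at this ⊢
    rw [hw, hk _ (hne _ (.inl rfl)), hk _ (hne _ (.inr (.inl rfl))),
      hk _ (hne _ (.inr (.inr rfl)))]
    exact this

theorem Tour.mono (h : Tour M P s) (hP : ∀ v, 1 ≤ v → P' v → P v) : Tour M P' s :=
  ⟨h.size, h.leaf, fun v h1 h2 h3 => h.lt v h1 h2 (hP v h1 h3),
    fun v h1 h2 h3 => h.ok v h1 h2 (hP v h1 h3)⟩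

/-- `s` and `s'` agree but for the winners and word register `7`. -/
def SameKeys (s s' : State) : Prop := Agree [(2, 0), (0, 7)] s s'

theorem SameKeys.key (h : SameKeys s s') : s'.key = s.key := by
  funext i
  rw [State.key, State.key, h.wordArr 1 (by decide), h.realArr 4 (by decide),
    h.realArr 5 (by decide)]

/-- Playing a match. -/
theorem run_pull {v : ℕ} (hv : s.word 7 = v) (h1 : 1 ≤ v) (hvM : v < M) (hMW : 2 * M ≤ W)
    (h : Tour M P s) (hl : P (2 * v)) (hr : P (2 * v + 1)) (hPv : ∀ w, P' w → w = v ∨ P w)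
    (hanc : ∀ w, P w → w < M → P' w → w ≠ v → 2 * w ≠ v ∧ 2 * w + 1 ≠ v) :
    Run W pull s 2 fun s' => Tour M P' s' ∧ s'.word = s.word ∧ SameKeys s s' := by
  have hlt1 := h.lt (2 * v) (by omega) (by omega) hl
  have hlt2 := h.lt (2 * v + 1) (by omega) (by omega) hr
  have key : ∀ b, (b = s.wordArr 0 (2 * v) ∨ b = s.wordArr 0 (2 * v + 1)) →
      s.key (s.wordArr 0 (2 * v)) ≤ s.key b → s.key (s.wordArr 0 (2 * v + 1)) ≤ s.key b →
      Tour M P' (s.putWord 0 v b) := by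
    intro b hb k1 k2
    have hkey : (s.putWord 0 v b).key = s.key := by
      funext i; simp [State.key]
    refine ⟨by simpa using h.size, fun i hi => ?_, fun w w1 w2 w3 => ?_, fun w w1 w2 w3 => ?_⟩
    · simp only [State.putWord_wordArr, if_true]
      rw [Function.update_of_ne (by omega)]
      exact h.leaf i hi
    · simp only [State.putWord_wordArr, if_true]
      by_cases hwv : w = v
      · subst hwv
        rw [Function.update_self]
        rcases hb with e | e <;> rw [e] <;> assumption
      · rw [Function.update_of_ne hwv]
        exact h.lt w w1 w2 ((hPv w w3).resolve_left hwv)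
    · unfold NodeOk
      simp only [State.putWord_wordArr, if_true, hkey]
      by_cases hwv : w = v
      · subst hwv
        rw [Function.update_self, Function.update_of_ne (by omega), Function.update_of_ne (by omega)]
        exact ⟨hb, k1, k2⟩
      · have hw := (hPv w w3).resolve_left hwv
        obtain ⟨e1, e2⟩ := hanc w hw w2 w3 hwv
        rw [Function.update_of_ne hwv, Function.update_of_ne e1, Function.update_of_ne e2]
        exact h.ok w w1 w2 hw
  have fr : ∀ b, SameKeys s (s.putWord 0 v b) := fun b =>
    ⟨fun _ _ => rfl, fun _ _ => rfl, fun x hx => by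
      have : x ≠ 0 := by rintro rfl; exact hx (by decide)
      simp [this], fun _ _ => rfl⟩
  refine (Run.of_wp (c := pull) (Q := _) ?_).mono (by decide) fun _ h => h
  simp only [pull, wp, better_holds, WExp.eval_get, WExp.eval_add, WExp.eval_mul, WExp.eval_ofNat,
    WExp.eval_reg, hv]
  refine ⟨fun hb => ⟨by omega, by omega, key _ (.inr rfl) hb.le le_rfl, rfl, fr _⟩,
    fun hb => ⟨by omega, by omega, key _ (.inl rfl) le_rfl (not_lt.1 hb), rfl, fr _⟩⟩

/-- Replaying the matches of an item. -/
theorem run_climb {i N : ℕ} (hi : s.word 6 = i) (hiM : i < M) (hMW : 2 * M ≤ W)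
    (hN : 2 * M ≤ 2 ^ N) (h : Tour M (fun v => ∀ k, 1 ≤ k → (M + i) / 2 ^ k ≠ v) s) :
    Run W climb s (4 * N + 2) fun s' => Tour M (fun _ => True) s' ∧ SameKeys s s' := by
  have fr : ∀ v, SameKeys s (s.setWord 7 v) := fun v =>
    ⟨fun x hx => by
      have : x ≠ 7 := by rintro rfl; exact hx (by decide)
      simp [this], fun _ _ => rfl, fun _ _ => rfl, fun _ _ => rfl⟩
  -- After `t` matches only the ancestors at least `t + 1` levels above the leaf are still unplayed;
  -- when the node index reaches `0`, none is left.
  let I : ℕ → State → Prop := fun t s' => s'.word 7 = (M + i) / 2 ^ (t + 1) ∧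
    Tour M (fun v => ∀ k, t + 1 ≤ k → (M + i) / 2 ^ k ≠ v) s' ∧ SameKeys s s'
  have htour : ∀ {P} {s' : State} (v : ℕ), Tour M P s' → Tour M P (s'.setWord 7 v) := fun v ht =>
    ⟨by simpa using ht.size, ht.leaf, ht.lt, ht.ok⟩
  have hle : ∀ t k, t ≤ k → (M + i) / 2 ^ k ≤ (M + i) / 2 ^ t := fun t k htk =>
    Nat.div_le_div_left (Nat.pow_le_pow_right (by norm_num) htk) (by positivity)
  have step : ∀ t s', I t s' → (Test.wordLt 0 (wr 7)).holds s' → t < N ∧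
      Run W (pull ;; .setWord 7 (wr 7 / 2)) s' 3 (I (t + 1)) := by
    rintro t s' ⟨h7, ht, hf⟩ hb
    simp only [Test.holds, WExp.eval_ofNat, WExp.eval_reg, h7] at hb
    have hlt : (M + i) / 2 ^ (t + 1) < M := by
      have h1 := hle 1 (t + 1) (by omega)
      have h2 : (M + i) / 2 ^ 1 = (M + i) / 2 := by norm_num
      omega
    refine ⟨?_, (run_pull (P' := fun v => ∀ k, t + 2 ≤ k → (M + i) / 2 ^ k ≠ v) h7 hb hlt hMW ht
      ?_ ?_ ?_ ?_).seq (T₂ := 1) ?_⟩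
    · by_contra hc
      have : (M + i) / 2 ^ (t + 1) = 0 := Nat.div_eq_of_lt (by
        have : 2 ^ N ≤ 2 ^ (t + 1) := Nat.pow_le_pow_right (by norm_num) (by omega)
        omega)
      omega
    · intro k hk; have := hle (t + 1) k hk; omega
    · intro k hk; have := hle (t + 1) k hk; omega
    · intro w hw
      by_cases e : w = (M + i) / 2 ^ (t + 1)
      · exact .inl e
      · refine .inr fun k hk => ?_
        rcases hk.eq_or_lt with e' | e'
        · rw [← e']; exact fun h => e h.symm
        · exact hw k e'
    · intro w hw _ hw' _
      have h1 : (M + i) / 2 ^ (t + 2) = (M + i) / 2 ^ (t + 1) / 2 := by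
        rw [pow_succ 2 (t + 1), Nat.div_div_eq_div_mul]
      have h2 := hw' (t + 2) le_rfl
      omega
    · rintro s'' ⟨k1, k2, k3⟩
      refine Run.of_wp (c := .setWord 7 (wr 7 / 2)) ?_
      simp only [wp, WExp.eval_div, WExp.eval_reg, WExp.eval_ofNat, k2, h7]
      refine ⟨(Nat.div_le_self _ _).trans (by omega), ?_, htour _ k1, (hf.trans k3).trans ?_⟩
      · simp only [State.setWord_word, if_true]
        rw [pow_succ 2 (t + 1), Nat.div_div_eq_div_mul]
      · exact ⟨fun x hx => by
          have : x ≠ 7 := by rintro rfl; exact hx (by decide)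
          simp [this], fun _ _ => rfl, fun _ _ => rfl, fun _ _ => rfl⟩
  have done : ∀ t s', I t s' → ¬ (Test.wordLt 0 (wr 7)).holds s' →
      Tour M (fun _ => True) s' ∧ SameKeys s s' := by
    rintro t s' ⟨h7, ht, hf⟩ hb
    simp only [Test.holds, WExp.eval_ofNat, WExp.eval_reg, h7] at hb
    exact ⟨ht.mono fun v hv _ k hk => by have := hle (t + 1) k hk; omega, hf⟩
  refine Run.mono (Run.seq (T₁ := 1) (R := I 0) (Run.of_wp (c := .setWord 7 _) ?_)
    fun s' h' => Run.loop N I step done h') (by omega) fun _ h => h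
  simp only [wp, WExp.eval_div, WExp.eval_add, WExp.eval_reg, WExp.eval_ofNat, h.size, hi]
  exact ⟨by omega, by simp, htour _ (by simpa using h), fr _⟩

/-- Building a tournament. -/
theorem run_build (hM : s.word 5 = M) (hMW : 2 * M ≤ W) :
    Run W build s (7 * M + 4) fun s' => Tour M (fun _ => True) s' ∧ SameKeys s s' := by
  have fr : ∀ {s' : State} v, SameKeys s' (s'.setWord 7 v) := fun v =>
    ⟨fun x hx => by
      have : x ≠ 7 := by rintro rfl; exact hx (by decide)
      simp [this], fun _ _ => rfl, fun _ _ => rfl, fun _ _ => rfl⟩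
  have fr' : ∀ {s' : State} v b, SameKeys s' (s'.putWord 0 v b) := fun v b =>
    ⟨fun _ _ => rfl, fun _ _ => rfl, fun x hx => by
      have : x ≠ 0 := by rintro rfl; exact hx (by decide)
      simp [this], fun _ _ => rfl⟩
  have htour : ∀ {P} {s' : State} (v : ℕ), Tour M P s' → Tour M P (s'.setWord 7 v) := fun v ht =>
    ⟨by simpa using ht.size, ht.leaf, ht.lt, ht.ok⟩
  -- the leaves
  have h1 : Run W leaves s (3 * M + 2) fun s' => Tour M (fun v => M ≤ v) s' ∧ SameKeys s s' := by
    let I : ℕ → State → Prop := fun t s' => s'.word 7 = t ∧ t ≤ M ∧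
      (∀ i < t, s'.wordArr 0 (M + i) = i) ∧ SameKeys s s'
    refine Run.mono (Run.seq (T₁ := 1) (R := I 0) (Run.of_wp (c := .setWord 7 0) ?_)
      fun s' h' => Run.loop (T := 2) M I ?_ ?_ h') (by omega) fun _ h => h
    · simp only [wp, WExp.eval_ofNat]
      exact ⟨by omega, by simp [I, fr]⟩
    · rintro t s' ⟨k1, k2, k3, k4⟩ hb
      have k5 : s'.word 5 = M := by rw [k4.word 5 (by decide), hM]
      simp only [Test.holds, WExp.eval_reg, k1, k5] at hb
      refine ⟨hb, Run.of_wp (c := .putWord 0 _ _ ;; .setWord 7 _) ?_⟩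
      simp only [wp, WExp.eval_add, WExp.eval_reg, k1, k5, State.putWord_word, WExp.eval_ofNat]
      refine ⟨by omega, by omega, by omega, by simp, hb, fun i hi => ?_,
        (k4.trans (fr' _ _)).trans (fr _)⟩
      simp only [State.setWord_wordArr, State.putWord_wordArr, if_true]
      by_cases e : i = t
      · rw [e, Function.update_self]
      · rw [Function.update_of_ne (by omega)]
        exact k3 i (by omega)
    · rintro t s' ⟨k1, k2, k3, k4⟩ hb
      have k5 : s'.word 5 = M := by rw [k4.word 5 (by decide), hM]
      simp only [Test.holds, WExp.eval_reg, k1, k5] at hb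
      refine ⟨⟨k5, fun i hi => k3 i (by omega), fun v _ h2 h3 => ?_, fun v _ h2 h3 => by omega⟩, k4⟩
      have := k3 (v - M) (by omega)
      rw [show M + (v - M) = v by omega] at this
      omega
  -- the matches
  have h2 : ∀ s₁, Tour M (fun v => M ≤ v) s₁ ∧ SameKeys s s₁ →
      Run W matches_ s₁ (4 * M + 2) fun s' => Tour M (fun _ => True) s' ∧ SameKeys s s' := by
    rintro s₁ ⟨ht, hf⟩
    let I : ℕ → State → Prop := fun t s' => s'.word 7 = M - 1 - t ∧
      Tour M (fun v => M - t ≤ v) s' ∧ SameKeys s s'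
    refine Run.mono (Run.seq (T₁ := 1) (R := I 0) (Run.of_wp (c := .setWord 7 _) ?_)
      fun s' h' => Run.loop (T := 3) M I ?_ ?_ h') (by omega) fun _ h => h
    · simp only [wp, WExp.eval_sub, WExp.eval_reg, WExp.eval_ofNat, ht.size]
      exact ⟨by omega, by simp, htour _ ht, hf.trans (fr _)⟩
    · rintro t s' ⟨k1, k2, k3⟩ hb
      simp only [Test.holds, WExp.eval_reg, WExp.eval_ofNat, k1] at hb
      refine ⟨by omega, (run_pull (P' := fun v => M - (t + 1) ≤ v) k1 hb (by omega) hMW k2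
        (by omega) (by omega) (fun w hw => by omega) (fun w h1 h2 h3 h4 => by omega)).seq
        (T₂ := 1) ?_⟩
      rintro s'' ⟨l1, l2, l3⟩
      refine Run.of_wp (c := .setWord 7 _) ?_
      simp only [wp, WExp.eval_sub, WExp.eval_reg, WExp.eval_ofNat, l2, k1]
      exact ⟨by omega, by simp; omega, htour _ l1, (k3.trans l3).trans (fr _)⟩
    · rintro t s' ⟨k1, k2, k3⟩ hb
      simp only [Test.holds, WExp.eval_reg, WExp.eval_ofNat, k1] at hb
      exact ⟨k2.mono fun v _ _ => by omega, k3⟩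
  exact (Run.seq h1 h2).mono (by omega) fun _ h => h

end CircleSep

namespace CircleSep

/-! ### Sorting the points -/

theorem Run.wp_seq {W : ℕ} {c d : Prog} {s : State} {T : ℕ} {Q R : State → Prop}
    (h : wp W c R s) (h' : ∀ s', R s' → Run W d s' T Q) : Run W (c ;; d) s (c.cost + T) Q :=
  Run.seq (Run.of_wp h) h'

theorem Agree.setWord {l : List (Fin 4 × ℕ)} {s s' : State} {x v : ℕ} (h : Agree l s s')
    (hx : (0, x) ∈ l) : Agree l s (s'.setWord x v) :=
  h.trans ⟨fun y hy => by
    have : y ≠ x := by rintro rfl; exact hy hx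
    simp [this], fun _ _ => rfl, fun _ _ => rfl, fun _ _ => rfl⟩

theorem Agree.setReal {l : List (Fin 4 × ℕ)} {s s' : State} {x : ℕ} {v : ℝ} (h : Agree l s s')
    (hx : (1, x) ∈ l) : Agree l s (s'.setReal x v) :=
  h.trans ⟨fun _ _ => rfl, fun y hy => by
    have : y ≠ x := by rintro rfl; exact hy hx
    simp [this], fun _ _ => rfl, fun _ _ => rfl⟩

variable {n W : ℕ} {s : State}

/-- With the lexicographically first point as origin all other points lie in the half plane
`LexPos`, so their angles can be compared by slopes. -/
theorem run_findBase (hn : s.word 0 = n) (h1 : 1 ≤ n) (hW : n ≤ W) :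
    Run W findBase s (4 * n + 6) fun s' => s'.word 9 < n ∧
      s'.real 3 = s.realArr 0 (s'.word 9) ∧ s'.real 4 = s.realArr 1 (s'.word 9) ∧
      s'.word 2 = n - 1 ∧ ∀ i < n, s.realArr 0 (s'.word 9) < s.realArr 0 i ∨
        s.realArr 0 (s'.word 9) = s.realArr 0 i ∧ s.realArr 1 (s'.word 9) ≤ s.realArr 1 i := by
  let I : ℕ → State → Prop := fun t s' => s'.word 8 = t ∧ 1 ≤ t ∧ t ≤ n ∧ s'.word 9 < t ∧
    Agree [(0, 8), (0, 9)] s s' ∧ ∀ i < t, s.realArr 0 (s'.word 9) < s.realArr 0 i ∨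
        s.realArr 0 (s'.word 9) = s.realArr 0 i ∧ s.realArr 1 (s'.word 9) ≤ s.realArr 1 i
  refine Run.mono (Run.wp_seq (R := fun s' => s' = s.setWord 9 0) ?_ fun s₁ h₁ =>
    Run.wp_seq (R := I 1) ?_ fun s₂ h₂ => Run.seq (T₂ := 3) (R := I n)
      (Run.loop (T := 3) n I ?_ ?_ h₂) fun s₃ h₃ => ?_)
    (by simp [Prog.cost]; omega) fun _ h => h
  · simp [wp]
  · subst h₁
    simp only [wp, WExp.eval_ofNat]
    refine ⟨by omega, by simp, le_rfl, h1, by simp, ?_, ?_⟩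
    · exact ((Agree.refl _ _).setWord (by decide)).setWord (by decide)
    · intro i hi
      obtain rfl : i = 0 := by omega
      simp
  · rintro t s' ⟨k1, k2, k3, k4, k5, k6⟩ hb
    have e0 : s'.word 0 = n := by rw [k5.word 0 (by decide), hn]
    simp only [Test.holds, WExp.eval_reg, k1, e0] at hb
    refine ⟨hb, Run.of_wp (c := _ ;; _) ?_⟩
    have a0 : s'.realArr 0 = s.realArr 0 := k5.realArr 0 (by decide)
    have a1 : s'.realArr 1 = s.realArr 1 := k5.realArr 1 (by decide)
    simp only [wp, Test.holds, RExp.eval_get, WExp.eval_reg, WExp.eval_add, WExp.eval_ofNat, k1, a0,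
      a1]
    refine ⟨fun hc => ⟨by omega, ?_⟩, fun hc => ?_⟩
    · simp only [State.setWord_word, k1]
      refine ⟨by simp; omega, by simp, by omega, by omega, by simp,
        (k5.setWord (by decide)).setWord (by decide), fun i hi => ?_⟩
      simp only [State.setWord_word]
      norm_num
      rcases Nat.lt_succ_iff_lt_or_eq.1 hi with h | h
      · rcases k6 i h with h6 | h6 <;> rcases hc with h7 | h7
        · exact .inl (h7.trans h6)
        · exact .inl (h7.1 ▸ h6)
        · exact .inl (h6.1 ▸ h7)
        · exact .inr ⟨h7.1.trans h6.1, h7.2.le.trans h6.2⟩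
      · subst h; exact .inr ⟨rfl, le_rfl⟩
    · refine ⟨by omega, by simp, by omega, by omega, by simp; omega,
        k5.setWord (by decide), fun i hi => ?_⟩
      simp only [State.setWord_word]
      norm_num
      rcases Nat.lt_succ_iff_lt_or_eq.1 hi with h | h
      · exact k6 i h
      · subst h
        push Not at hc
        rcases hc.1.eq_or_lt with h | h
        · exact .inr ⟨h, hc.2 h.symm⟩
        · exact .inl h
  · rintro t s' ⟨k1, k2, k3, k4, k5, k6⟩ hb
    have e0 : s'.word 0 = n := by rw [k5.word 0 (by decide), hn]
    simp only [Test.holds, WExp.eval_reg, k1, e0] at hb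
    obtain rfl : t = n := by omega
    exact ⟨k1, k2, k3, k4, k5, k6⟩
  · obtain ⟨k1, k2, k3, k4, k5, k6⟩ := h₃
    have e0 : s₃.word 0 = n := by rw [k5.word 0 (by decide), hn]
    refine Run.of_wp (c := _ ;; _ ;; _) ?_
    simp [wp, k5.realArr, e0, k4]
    exact ⟨by omega, k6⟩

theorem run_digits (hn : s.word 0 = n) (h1 : 1 ≤ n) (hW : n ≤ W) :
    Run W digits s (3 * (Nat.log 2 n + 1) + 3) fun s' => s'.word 3 = Nat.log 2 n + 1 := by
  have hlog : Nat.log 2 n + 1 ≤ n := Nat.log_lt_self 2 (by omega)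
  let I : ℕ → State → Prop := fun t s' => s'.word 8 = n / 2 ^ t ∧ s'.word 3 = t ∧
    t ≤ Nat.log 2 n + 1
  refine Run.mono (Run.wp_seq (R := fun s' => s' = s.setWord 3 0) ?_ fun s₁ h₁ =>
    Run.wp_seq (R := I 0) ?_ fun s₂ h₂ => (Run.loop (T := 2) (Nat.log 2 n + 1) I ?_ ?_ h₂))
    (by simp [Prog.cost]; omega) fun _ h => h
  · simp [wp]
  · subst h₁
    simp [wp, hn, I, hW]
  · rintro t s' ⟨k1, k2, k3⟩ hb
    simp only [Test.holds, WExp.eval_reg, WExp.eval_ofNat, k1] at hb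
    have : 2 ^ t ≤ n := by
      by_contra hc
      rw [Nat.div_eq_of_lt (by omega)] at hb
      omega
    have h2 : t ≤ Nat.log 2 n := Nat.le_log_of_pow_le (by norm_num) this
    refine ⟨by omega, Run.of_wp (c := _ ;; _) ?_⟩
    simp only [wp, WExp.eval_reg, WExp.eval_div, WExp.eval_add, WExp.eval_ofNat, k1,
      State.setWord_word, k2]
    refine ⟨(Nat.div_le_self _ _).trans ((Nat.div_le_self _ _).trans hW), by norm_num; omega, ?_⟩
    simp [I, Nat.div_div_eq_div_mul, pow_succ]
    omega
  · rintro t s' ⟨k1, k2, k3⟩ hb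
    simp only [Test.holds, WExp.eval_reg, WExp.eval_ofNat, k1] at hb
    have : n < 2 ^ t := by
      by_contra hc
      have := Nat.div_pos (not_lt.1 hc) (by positivity)
      omega
    have := Nat.log_lt_of_lt_pow (by omega) this
    omega

/-- The sorting key of a vector. -/
noncomputable def angleKey (x y : ℝ) : ℕ ×ₗ (ℝ ×ₗ ℝ) :=
  if 0 < x then toLex (2, toLex (0 - y / x, 0 - (x * x + y * y)))
  else toLex (1, toLex (0, 0 - (x * x + y * y)))

/-- The vectors in the half plane that contains all points, seen from the base point. -/
def LexPos (x y : ℝ) : Prop := 0 < x ∨ x = 0 ∧ 0 < y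

/-- `(x', y')` comes after `(x, y)`. -/
def AfterV (x y x' y' : ℝ) : Prop :=
  0 < x * y' - y * x' ∨ ∃ s : ℝ, 1 ≤ s ∧ x' = s * x ∧ y' = s * y

/-- The vertical direction has the smaller class and comes last. Otherwise a greater key means a
smaller slope, and at equal slopes the vectors are on one ray, where the third component orders them
by length. -/
theorem afterV_of_key {x y x' y' : ℝ} (h : LexPos x y) (h' : LexPos x' y')
    (hk : angleKey x' y' ≤ angleKey x y) : AfterV x y x' y' := by
  rcases h with h | ⟨h0, h⟩
  · rcases h' with h' | ⟨h0', h'⟩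
    · simp only [angleKey, h, h', if_true, Prod.Lex.le_iff, ofLex_toLex, lt_irrefl, true_and,
        false_or, sub_lt_sub_iff_left, sub_right_inj, sub_le_sub_iff_left] at hk
      rcases hk with hk | ⟨hk1, hk2⟩
      · rw [div_lt_div_iff₀ h h'] at hk
        exact .inl (by linarith)
      · rw [div_eq_div_iff h'.ne' h.ne'] at hk1
        refine .inr ⟨x' / x, ?_, by field_simp, by field_simp; linarith⟩
        rw [one_le_div h]
        by_contra hc
        push Not at hc
        have e : y' = y * x' / x := by field_simp; linarith
        have h3 : x' * x' + y' * y' = (x * x + y * y) * (x' / x) ^ 2 := by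
          rw [e]; field_simp
        have h4 : (x' / x) ^ 2 < 1 := by
          have : x' / x < 1 := (div_lt_one h).2 hc
          have : 0 < x' / x := by positivity
          nlinarith
        have h5 : 0 < x * x + y * y := by nlinarith [mul_self_nonneg y, mul_pos h h]
        nlinarith
    · subst h0'
      exact .inl (by nlinarith)
  · subst h0
    rcases h' with h' | ⟨h0', h'⟩
    · simp [angleKey, h', Prod.Lex.le_iff] at hk
    · subst h0'
      simp only [angleKey, lt_irrefl, if_false, Prod.Lex.le_iff, ofLex_toLex, true_and,
        false_or] at hk
      refine .inr ⟨y' / y, ?_, by simp, by field_simp⟩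
      rw [one_le_div h]
      nlinarith

/-- A loop rule with the frame built in. -/
theorem Run.loop_agree {b : Test} {c : Prog} {T : ℕ} {Q : State → Prop} (N : ℕ)
    (I : ℕ → State → Prop)
    (step : ∀ i s', Agree c.mods s s' → I i s' → b.holds s' → i < N ∧ Run W c s' T (I (i + 1)))
    (done : ∀ i s', Agree c.mods s s' → I i s' → ¬ b.holds s' → Q s') {i : ℕ} (h : I i s) :
    Run W (.loop b c) s ((N - i) * (T + 1) + 1) Q := by
  refine Run.loop N (fun i s' => Agree c.mods s s' ∧ I i s') (fun i s' h hb => ?_)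
    (fun i s' h hb => done i s' h.1 h.2 hb) ⟨.refl _ _, h⟩
  obtain ⟨h1, h2⟩ := step i s' h.1 h.2 hb
  exact ⟨h1, h2.agree.mono le_rfl fun s'' h'' => ⟨h.1.trans h''.2, h''.1⟩⟩

theorem run_angleKeys {p : ℕ} (hn : s.word 0 = n) (hp : s.word 9 = p) (hW : n ≤ W) (hW2 : 2 ≤ W)
    (h1 : ∀ i, s.wordArr 1 i = 0) (h4 : ∀ i, s.realArr 4 i = 0) :
    Run W angleKeys s (9 * n + 2) fun s' => (∀ i, i < n ∧ i ≠ p ∨ s'.wordArr 1 i = 0) ∧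
      ∀ i < n, i ≠ p → s'.wordArr 1 i ≠ 0 ∧
        s'.key i = angleKey (s.realArr 0 i - s.real 3) (s.realArr 1 i - s.real 4) := by
  let I : ℕ → State → Prop := fun t s' => s'.word 8 = t ∧ t ≤ n ∧
    (∀ i, t ≤ i → s'.realArr 4 i = 0) ∧ (∀ i, i < t ∧ i ≠ p ∨ s'.wordArr 1 i = 0) ∧
    ∀ i < t, i ≠ p → s'.wordArr 1 i ≠ 0 ∧
      s'.key i = angleKey (s.realArr 0 i - s.real 3) (s.realArr 1 i - s.real 4)
  refine Run.mono (Run.wp_seq (R := fun s' => s' = s.setWord 8 0) ?_ fun s₁ h₁ =>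
    Run.loop_agree (T := 8) n I ?_ ?_ (i := 0) ?_) (by simp [Prog.cost]; omega) fun _ h => h
  · simp [wp]
  · subst h₁
    rintro t s' ha ⟨k1, k2, k3, k4, k5⟩ hb
    have e0 : s'.word 0 = n := by rw [ha.word 0 (by decide)]; simpa using hn
    have e9 : s'.word 9 = p := by rw [ha.word 9 (by decide)]; simpa using hp
    have r3 : s'.real 3 = s.real 3 := ha.real 3 (by decide)
    have r4 : s'.real 4 = s.real 4 := ha.real 4 (by decide)
    have a0 : s'.realArr 0 = s.realArr 0 := ha.realArr 0 (by decide)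
    have a1 : s'.realArr 1 = s.realArr 1 := ha.realArr 1 (by decide)
    simp only [Test.holds, WExp.eval_reg, k1, e0] at hb
    refine ⟨hb, Run.of_wp (c := _ ;; _) ?_⟩
    have keyne : ∀ (u : State) (i : ℕ), i ≠ t → (∀ j, j ≠ t → u.wordArr 1 j = s'.wordArr 1 j) →
        (∀ j, j ≠ t → u.realArr 4 j = s'.realArr 4 j) →
        (∀ j, j ≠ t → u.realArr 5 j = s'.realArr 5 j) → u.key i = s'.key i := by
      intro u i hi g1 g2 g3
      rw [State.key, g1 i hi, g2 i hi, g3 i hi, State.key]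
    have fin : ∀ u : State, u.word 8 = t + 1 → (∀ j, j ≠ t → u.wordArr 1 j = s'.wordArr 1 j) →
        (∀ j, j ≠ t → u.realArr 4 j = s'.realArr 4 j) →
        (∀ j, j ≠ t → u.realArr 5 j = s'.realArr 5 j) →
        (t = p → u.wordArr 1 t = 0) → (t ≠ p → u.wordArr 1 t ≠ 0 ∧
          u.key t = angleKey (s.realArr 0 t - s.real 3) (s.realArr 1 t - s.real 4)) →
        I (t + 1) u := by
      intro u g0 g1 g2 g3 g4 g5
      refine ⟨g0, hb, fun i hi => ?_, fun i => ?_, fun i hi hip => ?_⟩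
      · rw [g2 i (by omega)]; exact k3 i (by omega)
      · by_cases e : i = t
        · by_cases e' : t = p
          · right; rw [e]; exact g4 e'
          · left; omega
        · rw [g1 i e]
          rcases k4 i with h | h
          · left; omega
          · exact .inr h
      · by_cases e : i = t
        · subst e; exact g5 hip
        · rw [g1 i e, keyne u i e g1 g2 g3]; exact k5 i (by omega) hip
    simp only [wp, Test.holds, RExp.eval_get, WExp.eval_reg, WExp.eval_add, WExp.eval_ofNat, k1, e9,
      RExp.eval_sub, RExp.eval_reg, a0, a1, r3, r4, RExp.eval_ofNat, RExp.eval_div, RExp.eval_add,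
      RExp.eval_mul, State.setReal_real, State.setReal_realArr, State.setReal_word,
      State.putWord_word, State.putReal_word, State.putWord_real,
      State.putReal_real]
    norm_num
    refine ⟨fun hc => ⟨by omega, ?_⟩, fun hc => ⟨fun hx => ⟨by omega, hW2, by omega, by omega, ?_⟩,
      fun hx => ⟨by omega, by omega, by omega, by omega, ?_⟩⟩⟩
    · refine fin _ (by simp) (by simp) (by simp) (by simp) (fun _ => ?_) (fun h => absurd hc h)
      simpa using (k4 t).resolve_left (by omega)
    · refine fin _ (by simp) (fun j hj => by simp [hj]) (fun j hj => by simp [hj])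
        (fun j hj => by simp [hj]) (fun h => absurd h hc) (fun _ => ?_)
      have hx' : 0 < s.realArr 0 t - s.real 3 := by linarith
      simp [State.key, angleKey, hx']
    · refine fin _ (by simp) (fun j hj => by simp [hj]) (fun j hj => by simp)
        (fun j hj => by simp [hj]) (fun h => absurd h hc) (fun _ => ?_)
      have hx' : ¬ 0 < s.realArr 0 t - s.real 3 := by linarith
      simp [State.key, angleKey, hx', k3 t le_rfl, -sub_pos]
  · subst h₁
    rintro t s' ha ⟨k1, k2, k3, k4, k5⟩ hb
    have e0 : s'.word 0 = n := by rw [ha.word 0 (by decide)]; simpa using hn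
    simp only [Test.holds, WExp.eval_reg, k1, e0] at hb
    obtain rfl : t = n := by omega
    exact ⟨k4, k5⟩
  · subst h₁
    simp [I, h1, h4]

end CircleSep

namespace CircleSep

/-! ### Sorting by repeated extraction from the tournament -/

variable {n W : ℕ} {s : State}

/-- The positions `1, …, t - 1` hold the vectors of the items that are marked as done, in order. -/
structure Extracted (n p : ℕ) (vx vy : ℕ → ℝ) (t : ℕ) (s : State) : Prop where
  card : ((Finset.range n).filter fun j => s.wordArr 1 j ≠ 0).card + t = n
  out : ∀ j, n ≤ j → s.wordArr 1 j = 0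
  key : ∀ j < n, s.wordArr 1 j ≠ 0 → j ≠ p ∧ s.key j = angleKey (vx j) (vy j)
  placed : ∀ j < n, j ≠ p → s.wordArr 1 j = 0 →
    ∃ k, 1 ≤ k ∧ k < t ∧ s.realArr 2 k = vx j ∧ s.realArr 3 k = vy j
  origin : ∀ k, 1 ≤ k → k < t → ∃ j < n, j ≠ p ∧ s.realArr 2 k = vx j ∧ s.realArr 3 k = vy j
  zero : ∀ k, k = 0 ∨ t ≤ k → s.realArr 2 k = 0 ∧ s.realArr 3 k = 0
  sorted : ∀ k l, 1 ≤ k → k < l → l < t → After (s.realArr 2) (s.realArr 3) k l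
  rest : ∀ k, 1 ≤ k → k < t → ∀ j < n, s.wordArr 1 j ≠ 0 →
    AfterV (s.realArr 2 k) (s.realArr 3 k) (vx j) (vy j)

/-- The item taken out has the greatest key, so by `afterV_of_key` all remaining items come after
it. This maintains `rest`, from which `sorted` follows for the item placed next. -/
theorem Extracted.step {p : ℕ} {vx vy : ℕ → ℝ} {t c : ℕ} {s s' : State}
    (h : Extracted n p vx vy t s) (h1 : 1 ≤ t) (hpos : ∀ j < n, j ≠ p → LexPos (vx j) (vy j))
    (hc : c < n) (hc0 : s.wordArr 1 c ≠ 0) (htop : ∀ j < n, s.key j ≤ s.key c)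
    (e1 : s'.wordArr 1 = Function.update (s.wordArr 1) c 0)
    (e2 : s'.realArr 2 = Function.update (s.realArr 2) t (vx c))
    (e3 : s'.realArr 3 = Function.update (s.realArr 3) t (vy c))
    (e4 : s'.realArr 4 = s.realArr 4) (e5 : s'.realArr 5 = s.realArr 5) :
    Extracted n p vx vy (t + 1) s' := by
  obtain ⟨hcp, hck⟩ := h.key c hc hc0
  have alive : ∀ j, s'.wordArr 1 j ≠ 0 → j ≠ c ∧ s.wordArr 1 j ≠ 0 := by
    intro j hj
    rw [e1] at hj
    by_cases e : j = c
    · simp [e] at hj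
    · rw [Function.update_of_ne e] at hj; exact ⟨e, hj⟩
  have alive' : ∀ j, j ≠ c → s'.wordArr 1 j = s.wordArr 1 j := fun j hj => by
    rw [e1, Function.update_of_ne hj]
  have old2 : ∀ k, k ≠ t → s'.realArr 2 k = s.realArr 2 k := fun k hk => by
    rw [e2, Function.update_of_ne hk]
  have old3 : ∀ k, k ≠ t → s'.realArr 3 k = s.realArr 3 k := fun k hk => by
    rw [e3, Function.update_of_ne hk]
  have new2 : s'.realArr 2 t = vx c := by rw [e2, Function.update_self]
  have new3 : s'.realArr 3 t = vy c := by rw [e3, Function.update_self]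
  have new1 : s'.wordArr 1 c = 0 := by rw [e1, Function.update_self]
  constructor
  · have : (Finset.range n).filter (fun j => s'.wordArr 1 j ≠ 0) =
        ((Finset.range n).filter fun j => s.wordArr 1 j ≠ 0).erase c := by
      ext j
      simp only [Finset.mem_filter, Finset.mem_erase, Finset.mem_range]
      constructor
      · rintro ⟨a, b⟩; exact ⟨(alive j b).1, a, (alive j b).2⟩
      · rintro ⟨a, b, d⟩; exact ⟨b, by rwa [alive' j a]⟩
    rw [this, Finset.card_erase_of_mem (by simp [hc, hc0])]
    have := h.card
    have : 0 < ((Finset.range n).filter fun j => s.wordArr 1 j ≠ 0).card :=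
      Finset.card_pos.2 ⟨c, by simp [hc, hc0]⟩
    omega
  · intro j hj; rw [alive' j (by omega)]; exact h.out j hj
  · intro j hj hj0
    obtain ⟨a, b⟩ := alive j hj0
    obtain ⟨d1, d2⟩ := h.key j hj b
    refine ⟨d1, ?_⟩
    rw [State.key, alive' j a, e4, e5]; exact d2
  · intro j hj hjp hj0
    by_cases e : j = c
    · exact ⟨t, h1, by omega, by rw [e, new2], by rw [e, new3]⟩
    · rw [alive' j e] at hj0
      obtain ⟨k, k1, k2, k3, k4⟩ := h.placed j hj hjp hj0
      exact ⟨k, k1, by omega, by rw [old2 k (by omega), k3], by rw [old3 k (by omega), k4]⟩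
  · intro k k1 k2
    by_cases e : k = t
    · exact ⟨c, hc, hcp, by rw [e, new2], by rw [e, new3]⟩
    · rw [old2 k e, old3 k e]; exact h.origin k k1 (by omega)
  · intro k hk
    rw [old2 k (by omega), old3 k (by omega)]; exact h.zero k (by omega)
  · intro k l k1 k2 k3
    by_cases e : l = t
    · subst e
      have := h.rest k k1 k2 c hc hc0
      rw [← old2 k (by omega), ← old3 k (by omega), ← new2, ← new3] at this
      exact this
    · have := h.sorted k l k1 k2 (by omega)
      unfold After cr at this ⊢
      rw [old2 k (by omega), old3 k (by omega), old2 l e, old3 l e]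
      exact this
  · intro k k1 k2 j hj hj0
    obtain ⟨a, b⟩ := alive j hj0
    by_cases e : k = t
    · rw [e, new2, new3]
      obtain ⟨d1, d2⟩ := h.key j hj b
      refine afterV_of_key (hpos c hc hcp) (hpos j hj d1) ?_
      rw [← d2, ← hck]; exact htop j hj
    · rw [old2 k e, old3 k e]
      exact h.rest k k1 (by omega) j hj b

theorem run_extract {p : ℕ} {vx vy : ℕ → ℝ} (hn : s.word 0 = n) (h1 : 1 ≤ n) (hW : 2 * n ≤ W)
    (hv : ∀ j, s.realArr 0 j - s.real 3 = vx j) (hv' : ∀ j, s.realArr 1 j - s.real 4 = vy j)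
    (hpos : ∀ j < n, j ≠ p → LexPos (vx j) (vy j)) (ht : Tour n (fun _ => True) s)
    (h : Extracted n p vx vy 1 s) :
    Run W extract s (n * (4 * Nat.log 2 n + 18) + 2) (Extracted n p vx vy n) := by
  have hlog : n < 2 ^ (Nat.log 2 n + 1) := Nat.lt_pow_succ_log_self (by norm_num) n
  let I : ℕ → State → Prop := fun t s' => s'.word 8 = t + 1 ∧ t + 1 ≤ n ∧
    Tour n (fun _ => True) s' ∧ Extracted n p vx vy (t + 1) s'
  refine Run.mono (Run.wp_seq (R := fun s' => s' = s.setWord 8 1) ?_ fun s₁ h₁ =>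
    Run.loop_agree (T := 5 + (4 * (Nat.log 2 n + 2) + 2)) n I ?_ ?_ (i := 0) ?_)
    (by simp [Prog.cost]; ring_nf; omega) fun _ h => h
  · simp only [wp, WExp.eval_ofNat]; exact ⟨by omega, trivial⟩
  · subst h₁
    rintro t s' ha ⟨k1, k2, k3, k4⟩ hb
    have e0 : s'.word 0 = n := by rw [ha.word 0 (by decide)]; simpa using hn
    have g0 : ∀ j, s'.realArr 0 j - s'.real 3 = vx j := fun j => by
      rw [ha.real 3 (by decide), ha.realArr 0 (by decide)]; exact hv j
    have g1 : ∀ j, s'.realArr 1 j - s'.real 4 = vy j := fun j => by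
      rw [ha.real 4 (by decide), ha.realArr 1 (by decide)]; exact hv' j
    simp only [Test.holds, WExp.eval_reg, k1, e0] at hb
    have hcn := k3.top_lt h1
    -- Extracted items have class `0`, the least one. By the count an unextracted item is left, so
    -- the winner is unextracted too.
    have hc0 : s'.wordArr 1 (s'.wordArr 0 1) ≠ 0 := by
      have : 0 < ((Finset.range n).filter fun j => s'.wordArr 1 j ≠ 0).card := by
        have := k4.card; omega
      obtain ⟨j, hj⟩ := Finset.card_pos.1 this
      simp only [Finset.mem_filter, Finset.mem_range] at hj
      have := k3.le_top hj.1
      simp only [State.key, Prod.Lex.le_iff, ofLex_toLex] at this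
      rcases this with h | h
      · omega
      · rw [← h.1]; exact hj.2
    refine ⟨by omega, Run.wp_seq (R := fun u => u.word 6 = s'.wordArr 0 1 ∧ u.word 8 = t + 2 ∧
      Tour n (fun v => ∀ k, 1 ≤ k → (n + s'.wordArr 0 1) / 2 ^ k ≠ v) u ∧
      Extracted n p vx vy (t + 2) u) ?_ fun u hu => ?_⟩
    · simp only [wp, RExp.eval_get, WExp.eval_reg, WExp.eval_get, WExp.eval_ofNat, WExp.eval_add,
        RExp.eval_sub, RExp.eval_reg, State.setWord_word, State.setWord_real,
        State.setWord_realArr, State.putReal_word, State.putReal_realArr, State.putReal_real,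
        State.putWord_word, k1]
      norm_num
      refine ⟨by omega, by omega, by omega, by omega, ?_, ?_⟩
      · refine k3.change (by simp) (by simp) fun j hj => ?_
        simp [State.key, hj]
      · refine k4.step (by omega) hpos hcn hc0 (fun j hj => k3.le_top hj) ?_ ?_ ?_ ?_ ?_
        all_goals simp [g0, g1]
    · obtain ⟨u1, u2, u3, u4⟩ := hu
      refine (run_climb u1 hcn hW (N := Nat.log 2 n + 2) (by rw [pow_succ]; omega) u3).mono le_rfl
        fun u' hu' => ?_
      obtain ⟨w1, w2⟩ := hu'
      refine ⟨by rw [w2.word 8 (by decide), u2], by omega, w1, ?_⟩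
      have c1 := w2.wordArr 1 (by decide)
      have c2 := w2.realArr 2 (by decide)
      have c3 := w2.realArr 3 (by decide)
      constructor <;> simp only [c1, c2, c3, w2.key]
      exacts [u4.card, u4.out, u4.key, u4.placed, u4.origin, u4.zero, u4.sorted, u4.rest]
  · subst h₁
    rintro t s' ha ⟨k1, k2, k3, k4⟩ hb
    have e0 : s'.word 0 = n := by rw [ha.word 0 (by decide)]; simpa using hn
    simp only [Test.holds, WExp.eval_reg, k1, e0] at hb
    obtain rfl : t + 1 = n := by omega
    exact k4
  · subst h₁
    refine ⟨by simp, h1, ⟨by simpa using ht.size, ht.leaf, ht.lt, ht.ok⟩, ?_⟩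
    exact ⟨h.card, h.out, h.key, h.placed, h.origin, h.zero, h.sorted, h.rest⟩

/-- The memory after the points have been sorted around the point `p`. -/
structure SortedAround (n : ℕ) (px py : ℕ → ℝ) (p : ℕ) (s : State) : Prop where
  lt : p < n
  word_two : s.word 2 = n - 1
  word_three : s.word 3 = Nat.log 2 n + 1
  baseX : s.real 3 = px p
  baseY : s.real 4 = py p
  zero : ∀ a, a ≠ 0 → ∀ i, s.wordArr a i = 0
  placed : ∀ j < n, j ≠ p → ∃ k, 1 ≤ k ∧ k < n ∧ s.realArr 2 k = px j - px p ∧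
    s.realArr 3 k = py j - py p
  origin : ∀ k, 1 ≤ k → k < n → ∃ j < n, j ≠ p ∧ s.realArr 2 k = px j - px p ∧
    s.realArr 3 k = py j - py p
  pos : ∀ k, 1 ≤ k → k < n → LexPos (s.realArr 2 k) (s.realArr 3 k)
  sorted : Sorted (s.realArr 2) (s.realArr 3) (n - 1)

theorem run_sortPoints {px py : ℕ → ℝ} (hn : s.word 0 = n) (h1 : 1 ≤ n) (hW : 2 * n ≤ W)
    (hx : s.realArr 0 = px) (hy : s.realArr 1 = py) (hr : ∀ a, 2 ≤ a → ∀ i, s.realArr a i = 0)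
    (hw : ∀ a i, s.wordArr a i = 0)
    (hinj : ∀ i < n, ∀ j < n, px i = px j → py i = py j → i = j) :
    Run W sortPoints s (70 * (n * (Nat.log 2 n + 1))) fun s' => ∃ p, SortedAround n px py p s' := by
  subst hx hy
  have htime : (4 * n + 6) + ((3 * (Nat.log 2 n + 1) + 3) + ((9 * n + 2) + (1 + ((7 * n + 4) +
      (n * (4 * Nat.log 2 n + 18) + 2))))) ≤ 70 * (n * (Nat.log 2 n + 1)) := by
    nlinarith [Nat.zero_le (Nat.log 2 n), Nat.mul_le_mul_right (Nat.log 2 n) h1]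
  refine Run.mono (Run.seq (run_findBase hn h1 (by omega)).agree fun s₁ h₁ =>
    Run.seq (R := fun s₂ => (s₂.word 3 = Nat.log 2 n + 1 ∧ Agree digits.mods s₁ s₂) ∧
      Agree (findBase.mods ++ digits.mods) s s₂)
      (Run.mono (run_digits (n := n) ?_ h1 (by omega)).agree le_rfl fun s₂ h₂ => ⟨h₂, ?_⟩)
      fun s₂ h₂ => Run.seq (run_angleKeys (n := n) (p := s₁.word 9) ?_ ?_ (by omega) (by omega) ?_
        ?_).agree fun s₃ h₃ => Run.seq (Run.of_wp (c := .setWord 5 (wr 0))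
        (Q := fun s₄ => s₄ = s₃.setWord 5 n) ?_) fun s₄ h₄ =>
        Run.seq (run_build (M := n) ?_ (by omega)) fun s₅ h₅ =>
        Run.mono (run_extract (p := s₁.word 9)
          (vx := fun j => s.realArr 0 j - s.realArr 0 (s₁.word 9))
          (vy := fun j => s.realArr 1 j - s.realArr 1 (s₁.word 9)) ?_ h1 hW ?_ ?_ ?_ h₅.1 ?_).agree
          le_rfl fun s₆ h₆ => ?_) htime fun _ h => h
  · rw [h₁.2.word 0 (by decide), hn]
  · exact (h₁.2.mono (List.subset_append_left _ _)).trans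
      (h₂.2.mono (List.subset_append_right _ _))
  · rw [h₂.2.word 0 (by decide), hn]
  · rw [h₂.1.2.word 9 (by decide)]
  · intro i; rw [h₂.2.wordArr 1 (by decide), hw]
  · intro i; rw [h₂.2.realArr 4 (by decide), hr 4 (by omega)]
  · have : s₃.word 0 = n := by rw [h₃.2.word 0 (by decide), h₂.2.word 0 (by decide), hn]
    simp only [wp, WExp.eval_reg, this]
    exact ⟨by omega, trivial⟩
  · subst h₄; simp
  all_goals subst h₄
  all_goals obtain ⟨⟨p1, p2, p3, p4, p5⟩, a1⟩ := h₁
  all_goals obtain ⟨⟨d1, d2⟩, a2⟩ := h₂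
  all_goals obtain ⟨⟨b1, b2⟩, a3⟩ := h₃
  all_goals obtain ⟨t1, a5⟩ := h₅
  all_goals have a35 : Agree (angleKeys.mods ++ [(0, 5), (2, 0), (0, 7)]) s₂ s₅ :=
    (a3.mono (by decide)).trans (((Agree.refl _ s₃).setWord (by decide)).trans (a5.mono (by decide)))
  all_goals have e3 : s₂.real 3 = s.realArr 0 (s₁.word 9) := by rw [d2.real 3 (by decide), p2]
  all_goals have e4 : s₂.real 4 = s.realArr 1 (s₁.word 9) := by rw [d2.real 4 (by decide), p3]
  all_goals have c0 : s₂.realArr 0 = s.realArr 0 := a2.realArr 0 (by decide)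
  all_goals have c1 : s₂.realArr 1 = s.realArr 1 := a2.realArr 1 (by decide)
  all_goals
    have hpos : ∀ j < n, j ≠ s₁.word 9 →
        LexPos (s.realArr 0 j - s.realArr 0 (s₁.word 9))
          (s.realArr 1 j - s.realArr 1 (s₁.word 9)) := by
      intro j hj hjp
      rcases p5 j hj with h | ⟨h, h'⟩
      · exact .inl (sub_pos.2 h)
      · refine .inr ⟨by rw [h, sub_self], sub_pos.2 (h'.lt_of_ne fun h'' => ?_)⟩
        exact hjp (hinj _ hj _ p1 h.symm h''.symm)
  · rw [a35.word 0 (by decide), a2.word 0 (by decide), hn]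
  · intro j; rw [a35.real 3 (by decide), a35.realArr 0 (by decide), c0, e3]
  · intro j; rw [a35.real 4 (by decide), a35.realArr 1 (by decide), c1, e4]
  · exact hpos
  · have k1 : s₅.wordArr 1 = s₃.wordArr 1 := by rw [a5.wordArr 1 (by decide)]; rfl
    have kk : s₅.key = s₃.key := by rw [SameKeys.key a5]; rfl
    -- The coordinate arrays are initially zero, which already places the base point at the
    -- positions `0` and `n`.
    have z2 : ∀ a, 2 ≤ a → a ≠ 4 → a ≠ 5 → ∀ k, s₅.realArr a k = 0 := fun a h h' h'' k => by
      rw [a35.realArr a (by simp [angleKeys, Prog.mods]; omega), a2.realArr a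
        (by simp [findBase, digits, Prog.mods]), hr a h]
    have alive : ∀ j < n, s₅.wordArr 1 j ≠ 0 ↔ j ≠ s₁.word 9 := by
      intro j hj
      rw [k1]
      exact ⟨fun h => (((b1 j).resolve_right h)).2, fun h => (b2 j hj h).1⟩
    constructor
    · have : ((Finset.range n).filter fun j => s₅.wordArr 1 j ≠ 0) =
          (Finset.range n).erase (s₁.word 9) := by
        ext j
        simp only [Finset.mem_filter, Finset.mem_range, Finset.mem_erase]
        exact ⟨fun h => ⟨(alive j h.1).1 h.2, h.1⟩, fun h => ⟨h.2, (alive j h.2).2 h.1⟩⟩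
      rw [this, Finset.card_erase_of_mem (by simpa using p1), Finset.card_range]
      omega
    · intro j hj
      rw [k1]; exact (b1 j).resolve_left (by omega)
    · intro j hj hj0
      have := (alive j hj).1 hj0
      refine ⟨this, ?_⟩
      rw [kk, (b2 j hj this).2, c0, c1, e3, e4]
    · intro j hj hjp hj0; exact absurd hj0 ((alive j hj).2 hjp)
    · intro k h h'; omega
    · intro k _; exact ⟨z2 2 (by omega) (by omega) (by omega) k, z2 3 (by omega) (by omega) (by omega) k⟩
    · intro k l h h' h''; omega
    · intro k h h'; omega
  · obtain ⟨x, a6⟩ := h₆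
    -- The count leaves no item unextracted, so the class array is clean again and can be reused for
    -- the chain.
    have dead : ∀ j, s₆.wordArr 1 j = 0 := by
      intro j
      by_cases hj : j < n
      · have := x.card
        have : ((Finset.range n).filter fun j => s₆.wordArr 1 j ≠ 0) = ∅ :=
          Finset.card_eq_zero.1 (by omega)
        by_contra hc
        have h' : j ∈ ((Finset.range n).filter fun j => s₆.wordArr 1 j ≠ 0) := by simp [hj, hc]
        rw [this] at h'
        simp at h'
      · exact x.out j (by omega)
    refine ⟨s₁.word 9, p1, ?_, ?_, ?_, ?_, fun a ha i => ?_, fun j hj hjp => ?_, ?_,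
      fun k hk hk' => ?_, ?_⟩
    · rw [a6.word 2 (by decide), a35.word 2 (by decide), d2.word 2 (by decide), p4]
    · rw [a6.word 3 (by decide), a35.word 3 (by decide), d1]
    · rw [a6.real 3 (by decide), a35.real 3 (by decide), e3]
    · rw [a6.real 4 (by decide), a35.real 4 (by decide), e4]
    · by_cases e : a = 1
      · rw [e]; exact dead i
      · rw [a6.wordArr a (by simp [extract, climb, pull, Prog.mods]; omega), a35.wordArr a
          (by simp [angleKeys, Prog.mods]; omega), a2.wordArr a (by simp [findBase, digits, Prog.mods]),
          hw]
    · exact x.placed j hj hjp (dead j)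
    · exact x.origin
    · obtain ⟨j, hj, hjp, h2, h3⟩ := x.origin k hk hk'
      rw [h2, h3]; exact hpos j hj hjp
    · have z0 := x.zero 0 (.inl rfl)
      have zn := x.zero n (.inr le_rfl)
      refine ⟨z0.1, z0.2, ?_, ?_, ?_⟩
      · rw [Nat.sub_add_cancel h1]; exact zn.1
      · rw [Nat.sub_add_cancel h1]; exact zn.2
      · intro i j h h' h''
        exact x.sorted i j h h' (by omega)

end CircleSep

namespace CircleSep

/-! ### The keys of the chain -/

section ChainKeys
variable {m W : ℕ} {s : State} {X Y : ℕ → ℝ}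

/-- The key of a vertex of the chain: reflex vertices come first, then the vertices by the circle
through them and their neighbours. -/
noncomputable def vertexKey (X Y : ℕ → ℝ) (m : ℕ) (nx pv : ℕ → ℕ) (i : ℕ) : ℕ ×ₗ (ℝ ×ₗ ℝ) :=
  if tri X Y (pv i) i (nx i) ≤ 0 ∧ nx i ≠ m + 1 then toLex (2, toLex (0, 0))
  else toLex (1, toLex (lift X Y (pv i) i (nx i) / tri X Y (pv i) i (nx i), 0))

theorem run_links (hm : s.word 2 = m) (hW : m + 2 ≤ W) (h3 : s.wordArr 3 0 = 0) :
    Run W links s (4 * m + 6) fun s' => (∀ i, i ≤ m → s'.wordArr 2 i = i + 1) ∧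
      ∀ i, i ≤ m + 1 → s'.wordArr 3 i = i - 1 := by
  let I : ℕ → State → Prop := fun t s' => s'.word 8 = t ∧ t ≤ m + 1 ∧
    (∀ i, i < t → s'.wordArr 2 i = i + 1) ∧ ∀ i, i ≤ t → s'.wordArr 3 i = i - 1
  refine Run.mono (Run.wp_seq (R := fun s' => s' = s.setWord 8 0) ?_ fun s₁ h₁ =>
    Run.loop_agree (T := 3) (m + 1) I ?_ ?_ (i := 0) ?_) (by simp [Prog.cost]; omega) fun _ h => h
  · simp [wp]
  · subst h₁
    rintro t s' ha ⟨k1, k2, k3, k4⟩ hb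
    have e2 : s'.word 2 = m := by rw [ha.word 2 (by decide)]; simpa using hm
    simp only [Test.holds, WExp.eval_reg, WExp.eval_add, WExp.eval_ofNat, k1, e2] at hb
    refine ⟨hb, Run.of_wp (c := _ ;; _ ;; _) ?_⟩
    simp only [wp, WExp.eval_reg, WExp.eval_add, WExp.eval_ofNat, k1, State.putWord_word]
    refine ⟨by omega, by omega, by omega, by omega, by omega, by simp, hb, fun i hi => ?_,
      fun i hi => ?_⟩
    · simp [Function.update_apply]
      split_ifs with h
      · omega
      · exact k3 i (by omega)
    · simp only [State.setWord_wordArr, State.putWord_wordArr, if_true]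
      by_cases e : i = t + 1
      · simp [e]
      · rw [Function.update_of_ne e]; simpa using k4 i (by omega)
  · subst h₁
    rintro t s' ha ⟨k1, k2, k3, k4⟩ hb
    have e2 : s'.word 2 = m := by rw [ha.word 2 (by decide)]; simpa using hm
    simp only [Test.holds, WExp.eval_reg, WExp.eval_add, WExp.eval_ofNat, k1, e2] at hb
    obtain rfl : t = m + 1 := by omega
    exact ⟨fun i hi => k3 i (by omega), k4⟩
  · subst h₁
    refine ⟨by simp, by omega, fun i hi => by omega, fun i hi => ?_⟩
    obtain rfl : i = 0 := by omega
    simpa using h3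

/-- The vertex before `m + 1` never counts as reflex. Its turn is a cross product, nonnegative by
sorting; if it vanishes with a predecessor on the same ray, it is the predecessor that is reflex. -/
theorem run_chainKey {i : ℕ} (hm : s.word 2 = m) (hi : s.word 6 = i) (hW : 2 ≤ W) (hiW : i ≤ W)
    (hX : s.realArr 2 = X) (hY : s.realArr 3 = Y) (hp : s.wordArr 3 i ≤ W)
    (hn : s.wordArr 2 i ≤ W) :
    Run W chainKey s 10 fun s' => s'.key i = vertexKey X Y m (s.wordArr 2) (s.wordArr 3) i ∧
      (∀ j, j ≠ i → s'.key j = s.key j) ∧ s'.wordArr 1 i ≠ 0 ∧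
      ∀ j, j ≠ i → s'.wordArr 1 j = s.wordArr 1 j := by
  subst hX hY
  refine (Run.of_wp (c := chainKey) ?_).mono (by simp [chainKey, Prog.cost]) fun _ h => h
  simp only [chainKey, crE, nqE, wp, Test.holds, RExp.eval_get, WExp.eval_get, WExp.eval_reg,
    WExp.eval_add, WExp.eval_ofNat, RExp.eval_sub, RExp.eval_reg, RExp.eval_ofNat, RExp.eval_div,
    RExp.eval_add, RExp.eval_mul, State.setReal_real, State.setReal_realArr, State.setReal_word,
    State.setWord_word, State.setWord_wordArr, State.setWord_realArr,
    State.setWord_real, State.putReal_word, State.putReal_real, State.putReal_wordArr,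
    State.putReal_realArr, State.putWord_word, State.putWord_real, State.putWord_realArr, hi, hm]
  norm_num
  have keyne : ∀ (u : State) (j : ℕ), j ≠ i → u.wordArr 1 = Function.update (s.wordArr 1) i
        (u.wordArr 1 i) → u.realArr 4 = Function.update (s.realArr 4) i (u.realArr 4 i) →
        u.realArr 5 = Function.update (s.realArr 5) i (u.realArr 5 i) → u.key j = s.key j := by
      intro u j hj g1 g2 g3
      rw [State.key, g1, g2, g3, State.key]
      simp [hj]
  refine ⟨hp, hn, hiW, fun h1 h2 => ⟨hiW, hW, hiW, ?_, ?_, ?_⟩,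
    fun h1 => ⟨hiW, by omega, hiW, ?_, ?_, ?_⟩⟩
  · have : tri (s.realArr 2) (s.realArr 3) (s.wordArr 3 i) i (s.wordArr 2 i) ≤ 0 := by
      simp only [tri, cr]; linarith
    simp [State.key, vertexKey, this, h2]
  · exact fun j hj => keyne _ j hj (by simp) (by simp) (by simp)
  · intro j hj; simp [hj]
  · have : ¬ (tri (s.realArr 2) (s.realArr 3) (s.wordArr 3 i) i (s.wordArr 2 i) ≤ 0 ∧
        s.wordArr 2 i ≠ m + 1) := by
      rintro ⟨h2, h3⟩
      exact h3 (h1 (by simp only [tri, cr] at h2; linarith))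
    simp [State.key, vertexKey, this]
    rfl
  · exact fun j hj => keyne _ j hj (by simp) (by simp) (by simp)
  · intro j hj; simp [hj]

theorem run_chainKeys (hm : s.word 2 = m) (hW : m + 2 ≤ W)
    (hX : s.realArr 2 = X) (hY : s.realArr 3 = Y) (hp : ∀ i ≤ m, s.wordArr 3 i ≤ W)
    (hn : ∀ i ≤ m, s.wordArr 2 i ≤ W) (h0 : ∀ i, s.wordArr 1 i = 0) :
    Run W chainKeys s (12 * m + 14) fun s' =>
      (∀ i, 0 < i → i ≤ m → s'.key i = vertexKey X Y m (s.wordArr 2) (s.wordArr 3) i) ∧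
      ∀ i, 0 < i ∧ i ≤ m ∨ s'.wordArr 1 i = 0 := by
  let I : ℕ → State → Prop := fun t s' => s'.word 6 = t + 1 ∧ t ≤ m ∧
    (∀ i, 0 < i → i < t + 1 → s'.key i = vertexKey X Y m (s.wordArr 2) (s.wordArr 3) i) ∧
    ∀ i, 0 < i ∧ i < t + 1 ∨ s'.wordArr 1 i = 0
  refine Run.mono (Run.wp_seq (R := fun s' => s' = s.setWord 6 1) ?_ fun s₁ h₁ =>
    Run.loop_agree (T := 10 + 1) (m + 1) I ?_ ?_ (i := 0) ?_) (by simp [Prog.cost]; omega) fun _ h => h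
  · simp [wp]; omega
  · subst h₁
    rintro t s' ha ⟨k1, k2, k3, k4⟩ hb
    have e2 : s'.word 2 = m := by rw [ha.word 2 (by decide)]; simpa using hm
    have c2 : s'.wordArr 2 = s.wordArr 2 := ha.wordArr 2 (by decide)
    have c3 : s'.wordArr 3 = s.wordArr 3 := ha.wordArr 3 (by decide)
    simp only [Test.holds, WExp.eval_reg, WExp.eval_add, WExp.eval_ofNat, k1, e2] at hb
    refine ⟨by omega, Run.seq (run_chainKey (X := X) (Y := Y) e2 k1 (by omega) (by omega)
      (by rw [ha.realArr 2 (by decide)]; simpa using hX)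
      (by rw [ha.realArr 3 (by decide)]; simpa using hY)
      (by rw [c3]; exact hp _ (by omega))
      (by rw [c2]; exact hn _ (by omega))).agree fun u hu => ?_⟩
    obtain ⟨⟨u1, u2, u3, u4⟩, hu⟩ := hu
    have e6 : u.word 6 = t + 1 := by rw [hu.word 6 (by decide), k1]
    refine Run.of_wp (c := .setWord 6 _) ?_
    simp only [wp, WExp.eval_reg, WExp.eval_add, WExp.eval_ofNat, e6]
    refine ⟨by omega, by simp, by omega, fun i h h' => ?_, fun i => ?_⟩
    · show u.key i = _
      by_cases e : i = t + 1
      · rw [e, u1, c2, c3]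
      · rw [u2 i e]; exact k3 i h (by omega)
    · show _ ∨ u.wordArr 1 i = 0
      by_cases e : i = t + 1
      · left; omega
      · rw [u4 i e]
        rcases k4 i with h | h
        · left; omega
        · exact .inr h
  · subst h₁
    rintro t s' ha ⟨k1, k2, k3, k4⟩ hb
    have e2 : s'.word 2 = m := by rw [ha.word 2 (by decide)]; simpa using hm
    simp only [Test.holds, WExp.eval_reg, WExp.eval_add, WExp.eval_ofNat, k1, e2] at hb
    obtain rfl : t = m := by omega
    exact ⟨fun i h h' => k3 i h (by omega), fun i => (k4 i).imp (fun h => ⟨h.1, by omega⟩) id⟩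
  · subst h₁
    exact ⟨by simp, by omega, fun i h h' => by omega, fun i => .inr (h0 i)⟩

end ChainKeys

end CircleSep

namespace CircleSep

/-! ### The rank table -/

section Rank
variable {m L W : ℕ} {s : State}

/-- The row of the triangle `t` of the rank table. -/
def State.row (s : State) (m t j : ℕ) : ℕ := s.wordArr 7 (t * (m + 2) + j)

/-- The ranks that occur in a row, as a binary number. -/
def mask (u : ℕ → ℕ) (L : ℕ) : ℕ := ∑ j ∈ Finset.range L, if u j ≠ 0 then 2 ^ j else 0

theorem mask_succ (u : ℕ → ℕ) (L : ℕ) :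
    mask u (L + 1) = mask u L + if u L ≠ 0 then 2 ^ L else 0 := Finset.sum_range_succ _ _

theorem mask_mono (u : ℕ → ℕ) {j L : ℕ} (h : j ≤ L) : mask u j ≤ mask u L :=
  Finset.sum_le_sum_of_subset (Finset.range_mono h)

theorem mask_zero {u : ℕ → ℕ} {L : ℕ} (h : ∀ j < L, u j = 0) : mask u L = 0 :=
  Finset.sum_eq_zero fun j hj => by simp [h j (Finset.mem_range.1 hj)]

/-- `r` is the rank of a triangle whose children have the rows `u` and `v`, as far as the columns
before `j` are concerned. -/
structure RankUpTo (u v : ℕ → ℕ) (j r : ℕ) : Prop where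
  le : r ≤ j
  free : r < j → u r = 0 ∧ v r = 0
  excl : ∀ i, r < i → i < j → u i = 0 ∨ v i = 0
  carries : 2 ^ r ≤ mask u r + mask v r + 1

/-- A column used in both rows, or used in one row at the candidate rank, produces a carry in the
binary sum of the two masks and one. The candidate moves past it, and the bound `carries` doubles.
-/
theorem RankUpTo.carry {u v : ℕ → ℕ} {j r : ℕ} (h : RankUpTo u v j r)
    (hc : 0 < u j ∧ 0 < v j ∨ j = r ∧ 0 < u j + v j) : RankUpTo u v (j + 1) (j + 1) := by
  refine ⟨le_rfl, by omega, by omega, ?_⟩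
  rw [mask_succ, mask_succ, pow_succ]
  rcases hc with ⟨h1, h2⟩ | ⟨rfl, h1⟩
  · rw [if_pos (by omega), if_pos (by omega)]; omega
  · have := h.carries
    by_cases h2 : u j = 0
    · rw [if_pos (by omega : v j ≠ 0)]; omega
    · rw [if_pos h2]; omega

theorem RankUpTo.keep {u v : ℕ → ℕ} {j r : ℕ} (h : RankUpTo u v j r)
    (hc : ¬ (0 < u j ∧ 0 < v j ∨ j = r ∧ 0 < u j + v j)) : RankUpTo u v (j + 1) r := by
  refine ⟨by have := h.le; omega, fun hr => ?_, fun i h1 h2 => ?_, h.carries⟩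
  · rcases Nat.lt_succ_iff_lt_or_eq.1 hr with h' | h'
    · exact h.free h'
    · rw [h']; omega
  · rcases Nat.lt_succ_iff_lt_or_eq.1 h2 with h' | h'
    · exact h.excl i h1 h'
    · rw [h']; omega

theorem run_findRank {a b : ℕ} (hm : s.word 2 = m) (hL : s.word 3 = L) (ha : s.word 12 = a)
    (hb : s.word 13 = b) (hLW : L ≤ W) (hle : ∀ i, s.wordArr 7 i ≤ W) :
    Run W findRank s (6 * L + 3) fun s' => RankUpTo (s.row m a) (s.row m b) L (s'.word 15) := by
  let I : ℕ → State → Prop := fun t s' => s'.word 14 = t ∧ t ≤ L ∧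
    RankUpTo (s.row m a) (s.row m b) t (s'.word 15)
  refine Run.mono (Run.wp_seq (R := fun s' => s' = s.setWord 15 0) ?_ fun s₁ h₁ =>
    Run.wp_seq (R := fun s' => s' = s₁.setWord 14 0) ?_ fun s₂ h₂ =>
    Run.loop_agree (T := 5) L I ?_ ?_ (i := 0) ?_) (by simp [Prog.cost]; omega) fun _ h => h
  · simp [wp]
  · simp [wp]
  · subst h₁ h₂
    rintro t s' hag ⟨k1, k2, k3⟩ hc
    have e2 : s'.word 2 = m := by rw [hag.word 2 (by decide)]; simpa using hm
    have e3 : s'.word 3 = L := by rw [hag.word 3 (by decide)]; simpa using hL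
    have e12 : s'.word 12 = a := by rw [hag.word 12 (by decide)]; simpa using ha
    have e13 : s'.word 13 = b := by rw [hag.word 13 (by decide)]; simpa using hb
    have c7 : s'.wordArr 7 = s.wordArr 7 := hag.wordArr 7 (by decide)
    simp only [Test.holds, WExp.eval_reg, k1, e3] at hc
    refine ⟨hc, Run.of_wp (c := _ ;; _ ;; _ ;; _) ?_⟩
    simp only [wp, cell, Test.holds, WExp.eval_get, WExp.eval_reg, WExp.eval_add, WExp.eval_mul,
      WExp.eval_ofNat, k1, e2, e12, e13, c7, State.setWord_word, State.setWord_wordArr]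
    refine ⟨hle _, hle _, fun hd => ⟨by norm_num; omega, by norm_num; omega, by norm_num,
      by omega, ?_⟩, fun hd => ⟨by norm_num; omega, by norm_num, by omega, ?_⟩⟩
    · norm_num at hd ⊢
      refine k3.carry ?_
      simp only [State.row]
      omega
    · norm_num at hd ⊢
      refine k3.keep ?_
      simp only [State.row]
      omega
  · subst h₁ h₂
    rintro t s' hag ⟨k1, k2, k3⟩ hc
    have e3 : s'.word 3 = L := by rw [hag.word 3 (by decide)]; simpa using hL
    simp only [Test.holds, WExp.eval_reg, k1, e3] at hc
    obtain rfl : t = L := by omega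
    exact k3
  · subst h₁ h₂
    exact ⟨by simp, by omega, by simp, by simp, by simp, by simp [mask]⟩

/-- The row of a new triangle. -/
def newRow (u v : ℕ → ℕ) (p r j : ℕ) : ℕ := if j < r then 0 else if j = r then p else u j + v j

theorem run_fillRow {a b p r : ℕ} (hm : s.word 2 = m) (hL : s.word 3 = L) (ha : s.word 12 = a)
    (hb : s.word 13 = b) (hp : s.word 9 = p) (hr : s.word 15 = r) (hLm : L ≤ m + 2) (hpm : p ≤ m)
    (hW : (m + 2) * (m + 2) ≤ W) (hle : ∀ i, s.wordArr 7 i ≤ m) (hpa : a ≠ p) (hpb : b ≠ p)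
    (hrk : RankUpTo (s.row m a) (s.row m b) L r) :
    Run W fillRow s (5 * L + 2) fun s' =>
      (∀ t j, j < m + 2 → s'.row m t j = if t = p ∧ j < L then
        newRow (s.row m a) (s.row m b) p r j else s.row m t j) ∧ ∀ i, s'.wordArr 7 i ≤ m := by
  -- Rows have length `m + 2`; quotient and remainder of an address recover row and column.
  have inj : ∀ t j t' j', j < m + 2 → j' < m + 2 → t * (m + 2) + j = t' * (m + 2) + j' →
      t = t' ∧ j = j' := by
    intro t j t' j' h1 h2 h3
    have e1 : (t * (m + 2) + j) / (m + 2) = t := by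
      rw [add_comm, Nat.add_mul_div_right _ _ (by omega), Nat.div_eq_of_lt h1, zero_add]
    have e2 : (t' * (m + 2) + j') / (m + 2) = t' := by
      rw [add_comm, Nat.add_mul_div_right _ _ (by omega), Nat.div_eq_of_lt h2, zero_add]
    have : t = t' := by rw [← e1, ← e2, h3]
    subst this
    exact ⟨rfl, by omega⟩
  have bound : ∀ j, j < m + 2 → p * (m + 2) + j ≤ W := fun j hj => by nlinarith
  let I : ℕ → State → Prop := fun i s' => s'.word 14 = i ∧ i ≤ L ∧
    (∀ t j, j < m + 2 → s'.row m t j = if t = p ∧ j < i then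
        newRow (s.row m a) (s.row m b) p r j else s.row m t j) ∧ ∀ i, s'.wordArr 7 i ≤ m
  refine Run.mono (Run.wp_seq (R := fun s' => s' = s.setWord 14 0) ?_ fun s₂ h₂ =>
    Run.loop_agree (T := 4) L I ?_ ?_ (i := 0) ?_) (by simp [Prog.cost]; omega) fun _ h => h
  · simp [wp]
  · subst h₂
    rintro i s' hag ⟨k1, k2, k3, k4⟩ hc
    have e2 : s'.word 2 = m := by rw [hag.word 2 (by decide)]; simpa using hm
    have e3 : s'.word 3 = L := by rw [hag.word 3 (by decide)]; simpa using hL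
    have e12 : s'.word 12 = a := by rw [hag.word 12 (by decide)]; simpa using ha
    have e13 : s'.word 13 = b := by rw [hag.word 13 (by decide)]; simpa using hb
    have e9 : s'.word 9 = p := by rw [hag.word 9 (by decide)]; simpa using hp
    have e15 : s'.word 15 = r := by rw [hag.word 15 (by decide)]; simpa using hr
    simp only [Test.holds, WExp.eval_reg, k1, e3] at hc
    have ra : s'.wordArr 7 (a * (m + 2) + i) = s.row m a i := by
      have := k3 a i (by omega); rwa [if_neg (by simp [hpa])] at this
    have rb : s'.wordArr 7 (b * (m + 2) + i) = s.row m b i := by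
      have := k3 b i (by omega); rwa [if_neg (by simp [hpb])] at this
    have la : s.row m a i ≤ m := hle _
    have lb : s.row m b i ≤ m := hle _
    have hval : newRow (s.row m a) (s.row m b) p r i ≤ m := by
      unfold newRow
      split_ifs with h1 h2
      · omega
      · exact hpm
      -- Beyond the rank at most one of the two entries is nonzero, so the sum merely selects it and
      -- stays a legal position.
      · rcases hrk.excl i (by omega) hc with h | h <;> omega
    have fin : ∀ v, v = newRow (s.row m a) (s.row m b) p r i →
        I (i + 1) ((s'.putWord 7 (p * (m + 2) + i) v).setWord 14 (i + 1)) := by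
      rintro v rfl
      refine ⟨by simp, by omega, fun t j hj => ?_, fun c => ?_⟩
      · show ((s'.putWord 7 (p * (m + 2) + i) _).setWord 14 (i + 1)).wordArr 7 _ = _
        simp only [State.setWord_wordArr, State.putWord_wordArr, if_true, Function.update_apply]
        by_cases e : t * (m + 2) + j = p * (m + 2) + i
        · obtain ⟨e1, e2⟩ := inj _ _ _ _ hj (by omega) e
          subst e1 e2
          simp
        · rw [if_neg e]
          refine (k3 t j hj).trans ?_
          by_cases e1 : t = p
          · subst e1
            have : j ≠ i := fun h => e (by rw [h])
            simp only [true_and]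
            by_cases h : j < i
            · rw [if_pos h, if_pos (by omega)]
            · rw [if_neg h, if_neg (by omega)]
          · simp [e1]
      · simp only [State.setWord_wordArr, State.putWord_wordArr, if_true, Function.update_apply]
        split_ifs
        · exact hval
        · exact k4 c
    have hWm : m + 2 ≤ W := by nlinarith
    have hb' := bound i (by omega)
    refine ⟨hc, Run.of_wp (c := _ ;; _) ?_⟩
    simp only [wp, cell, Test.holds, WExp.eval_get, WExp.eval_reg, WExp.eval_add, WExp.eval_mul,
      WExp.eval_ofNat, k1, e2, e12, e13, e9, e15, ra, rb, State.putWord_word]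
    refine ⟨fun h1 => ⟨hb', by omega, by omega, fin _ (by simp [newRow, h1])⟩,
      fun h1 => ⟨fun h2 => ⟨hb', by omega, by omega, fin _ (by simp [newRow, h2])⟩,
        fun h2 => ⟨hb', ?_, by omega, fin _ (by simp [newRow, h1, h2])⟩⟩⟩
    rcases hrk.excl i (by omega) hc with h | h <;> omega
  · subst h₂
    rintro t s' hag ⟨k1, k2, k3, k4⟩ hc
    have e3 : s'.word 3 = L := by rw [hag.word 3 (by decide)]; simpa using hL
    simp only [Test.holds, WExp.eval_reg, k1, e3] at hc
    obtain rfl : t = L := by omega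
    exact ⟨k3, k4⟩
  · subst h₂
    exact ⟨by simp, by omega, fun t j _ => by simp [State.row], hle⟩

/-- Binary addition again: the columns below `r` are cleared, column `r` is the carry, paid for by
`carries`, and beyond it the rows are disjoint, so the masks add up without a carry. -/
theorem mask_newRow {u v : ℕ → ℕ} {p r : ℕ} (h : RankUpTo u v L r) (hr : r < L) (hp : p ≠ 0) :
    mask (newRow u v p r) L ≤ mask u L + mask v L + 1 := by
  have low : ∀ j ≤ r, mask (newRow u v p r) j = 0 := fun j hj =>
    mask_zero fun i hi => by simp [newRow, show i < r by omega]
  have key : ∀ j, r < j → j ≤ L → mask (newRow u v p r) j ≤ mask u j + mask v j + 1 := by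
    intro j hj
    induction j, hj using Nat.le_induction with
    | base =>
      intro _
      rw [mask_succ, mask_succ, mask_succ, low r le_rfl, (h.free hr).1, (h.free hr).2]
      have := h.carries
      simp [newRow, hp]
      omega
    | succ j hj ih =>
      intro hjL
      have := ih (by omega)
      have e := h.excl j hj (by omega)
      rw [mask_succ, mask_succ, mask_succ]
      have e' : newRow u v p r j = u j + v j := by
        simp [newRow, show ¬ j < r by omega, show j ≠ r by omega]
      rw [e']
      rcases e with e | e <;> rw [e] <;> simp only [zero_add, add_zero, ne_eq, not_true, if_false]
        <;> omega
  exact key L hr le_rfl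

/-- By `carries`, a rank `r` presupposes masks of total value at least `2 ^ r - 1`; a bound on the
masks therefore bounds the rank logarithmically. -/
theorem RankUpTo.lt {u v : ℕ → ℕ} {r N : ℕ} (h : RankUpTo u v L r)
    (hN : mask u L + mask v L + 1 ≤ N) (hL : N < 2 ^ L) : r < L := by
  have h1 := h.carries
  have h2 := mask_mono u h.le
  have h3 := mask_mono v h.le
  by_contra hc
  have : 2 ^ L ≤ 2 ^ r := Nat.pow_le_pow_right (by norm_num) (by omega)
  omega

theorem RankUpTo.rowOk {lc ch : ℕ → ℕ} {row : ℕ → ℕ → ℕ} {p r : ℕ}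
    (h : RankUpTo (row (lc p)) (row (ch p)) L r) (hr : r < L)
    (hrow : ∀ j < L, row p j = newRow (row (lc p)) (row (ch p)) p r j) : RowOk L lc ch row p := by
  refine ⟨r, hr, ?_, fun j hj => ?_, (h.free hr).1, (h.free hr).2, fun j h1 h2 => ⟨?_, h.excl j h1 h2⟩⟩
  · rw [hrow r hr]; simp [newRow]
  · rw [hrow j (by omega)]; simp [newRow, hj]
  · rw [hrow j h2]; simp [newRow, show ¬ j < r by omega, show j ≠ r by omega]

end Rank

end CircleSep

namespace CircleSep

/-! ### Peeling the chain -/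

section Peel
variable {X Y : ℕ → ℝ} {m L W : ℕ} {Al H E : ℕ → Prop} {s s' : State}

/-- The memory while the chain is peeled, but for the keys. -/
structure Peel (X Y : ℕ → ℝ) (m L : ℕ) (Al H : ℕ → Prop) (s : State) : Prop where
  word_two : s.word 2 = m
  word_three : s.word 3 = L
  realX : s.realArr 2 = X
  realY : s.realArr 3 = Y
  forest : Forest X Y m Al H (s.wordArr 2) (s.wordArr 3) (s.wordArr 4) (s.wordArr 5) (s.wordArr 6)
  rowZero : ∀ j < L, s.row m 0 j = 0
  rowOk : ∀ t, H t → ¬ Al t → RowOk L (s.wordArr 5) (s.wordArr 4) (s.row m) t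
  mask_le : ∀ t, H t → ¬ Al t → mask (s.row m t) L + 1 + s.wordArr 3 t ≤ s.wordArr 2 t
  rowLe : ∀ i, s.wordArr 7 i ≤ m
  opLe : ∀ i, s.wordArr 6 i ≤ m + 1

/-- The keys of the vertices of the chain are correct, but for the vertices `E`. -/
structure Keys (X Y : ℕ → ℝ) (m : ℕ) (Al E : ℕ → Prop) (s : State) : Prop where
  key : ∀ i, Al i → 0 < i → i < m + 1 → ¬ E i →
    s.key i = vertexKey X Y m (s.wordArr 2) (s.wordArr 3) i
  dead : ∀ i, ¬ (Al i ∧ 0 < i ∧ i < m + 1) → s.wordArr 1 i = 0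

/-- The cells on which `Peel` depends. -/
def peelCells : List (Fin 4 × ℕ) :=
  [(0, 2), (0, 3), (3, 2), (3, 3), (2, 2), (2, 3), (2, 4), (2, 5), (2, 6), (2, 7)]

theorem Peel.agree {l : List (Fin 4 × ℕ)} (h : Peel X Y m L Al H s) (ha : Agree l s s')
    (hl : ∀ c ∈ peelCells, c ∉ l) : Peel X Y m L Al H s' := by
  have h2 := ha.wordArr 2 (hl _ (by decide))
  have h3 := ha.wordArr 3 (hl _ (by decide))
  have h4 := ha.wordArr 4 (hl _ (by decide))
  have h5 := ha.wordArr 5 (hl _ (by decide))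
  have h6 := ha.wordArr 6 (hl _ (by decide))
  have h7 := ha.wordArr 7 (hl _ (by decide))
  have hr : s'.row m = s.row m := by funext t j; rw [State.row, h7, State.row]
  constructor
  · rw [ha.word 2 (hl _ (by decide))]; exact h.word_two
  · rw [ha.word 3 (hl _ (by decide))]; exact h.word_three
  · rw [ha.realArr 2 (hl _ (by decide))]; exact h.realX
  · rw [ha.realArr 3 (hl _ (by decide))]; exact h.realY
  · rw [h2, h3, h4, h5, h6]; exact h.forest
  · rw [hr]; exact h.rowZero
  · rw [hr, h4, h5]; exact h.rowOk
  · rw [hr, h2, h3]; exact h.mask_le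
  · rw [h7]; exact h.rowLe
  · rw [h6]; exact h.opLe

/-- The mask is at most the number of positions strictly between the ends of the edge. This size
bound makes ranks logarithmic; an edge of the hull contributes the mask zero. -/
theorem Peel.mask_below (h : Peel X Y m L Al H s) {u v c : ℕ} (huv : u < v)
    (hc : Below Al H (s.wordArr 2) (s.wordArr 3) u v c) : mask (s.row m c) L + 1 + u ≤ v := by
  rcases hc with ⟨rfl, _⟩ | ⟨h1, h2, rfl, rfl⟩
  · rw [mask_zero h.rowZero]; omega
  · exact h.mask_le c h1 h2

theorem Peel.below_le (h : Peel X Y m L Al H s) {u v c : ℕ}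
    (hc : Below Al H (s.wordArr 2) (s.wordArr 3) u v c) : c ≤ m := by
  rcases hc with ⟨rfl, _⟩ | ⟨h1, _⟩
  · omega
  · have := h.forest.range c h1; omega

/-- Children are not alive, so filling the row of the living vertex `p` does not disturb their rows.
-/
theorem Below.ne {nx pv : ℕ → ℕ} {u v c p : ℕ} (hp : Al p) (hp0 : 0 < p)
    (hc : Below Al H nx pv u v c) : c ≠ p := by
  rcases hc with ⟨rfl, _⟩ | ⟨_, h2, _⟩
  · omega
  · rintro rfl; exact h2 hp

/-- The triangle `p` has been recorded. -/
structure Recorded (m L p : ℕ) (s s' : State) : Prop where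
  child : s'.wordArr 4 = Function.update (s.wordArr 4) (s.wordArr 3 p) p
  leftChild : s'.wordArr 5 = Function.update (s.wordArr 5) p (s.wordArr 4 (s.wordArr 3 p))
  opposite : s'.wordArr 6 = Function.update (Function.update (s.wordArr 6)
    (s.wordArr 4 (s.wordArr 3 p)) (s.wordArr 2 p)) (s.wordArr 4 p) (s.wordArr 3 p)
  rank : ∃ r < L, RankUpTo (s.row m (s.wordArr 4 (s.wordArr 3 p))) (s.row m (s.wordArr 4 p)) L r ∧
    ∀ t j, j < m + 2 → s'.row m t j = if t = p ∧ j < L then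
      newRow (s.row m (s.wordArr 4 (s.wordArr 3 p))) (s.row m (s.wordArr 4 p)) p r j
      else s.row m t j
  rowLe : ∀ i, s'.wordArr 7 i ≤ m

theorem run_record (h : Peel X Y m L Al H s) {p : ℕ} (hp : Al p) (hp0 : 0 < p) (hpm : p < m + 1)
    (h9 : s.word 9 = p) (h10 : s.word 10 = s.wordArr 3 p) (h11 : s.word 11 = s.wordArr 2 p)
    (hL : m + 1 < 2 ^ L) (hLm : L ≤ m + 1) (hW : (m + 2) * (m + 2) ≤ W) :
    Run W record s (11 * L + 11) (Recorded m L p s) := by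
  have hn := h.forest.chain.next p hp hpm
  have hv := h.forest.chain.prev p hp hp0
  have hbm := h.forest.chain.le _ hn.2.1
  have hWm : m + 2 ≤ W := by nlinarith
  have E1 := h.forest.edge _ hv.2.1 (by omega)
  rw [hv.2.2] at E1
  have E2 := h.forest.edge p hp hpm
  have l1 := h.below_le E1
  have l2 := h.below_le E2
  have n1 := Below.ne hp hp0 E1
  have n2 := Below.ne hp hp0 E2
  have m1 := h.mask_below hv.1 E1
  have m2 := h.mask_below hn.1 E2
  set a := s.wordArr 3 p with ha
  set b := s.wordArr 2 p with hb
  set l := s.wordArr 4 a with hl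
  set c := s.wordArr 4 p with hc
  refine Run.mono (Run.wp_seq (R := fun s₁ => s₁.word 12 = l ∧ s₁.word 13 = c ∧
    s₁.wordArr 4 = Function.update (s.wordArr 4) a p ∧
    s₁.wordArr 5 = Function.update (s.wordArr 5) p l ∧
    s₁.wordArr 6 = Function.update (Function.update (s.wordArr 6) l b) c a ∧
    Agree [(0, 12), (0, 13), (2, 4), (2, 5), (2, 6)] s s₁) ?_ fun s₁ h₁ =>
    Run.seq (R := fun s₂ => RankUpTo (s₁.row m l) (s₁.row m c) L (s₂.word 15) ∧
      Agree findRank.mods s₁ s₂) (T₁ := 6 * L + 3) ?_ fun s₂ h₂ =>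
      ((run_fillRow (m := m) (L := L) (a := l) (b := c) (p := p) (r := s₂.word 15) ?_ ?_ ?_ ?_ ?_
        rfl (by omega) (by omega) hW ?_ n1 n2 ?_).agree.mono le_rfl fun s₃ h₃ => ?_))
    (by simp [Prog.cost]; omega) fun _ h => h
  · simp only [wp, WExp.eval_get, WExp.eval_reg, State.setWord_word, State.setWord_wordArr,
      State.putWord_word, State.putWord_wordArr, h9, h10, h11]
    norm_num
    rw [← hl, ← hc]
    simp only [show l ≤ W by omega, show c ≤ W by omega, show p ≤ W by omega,
      show a ≤ W by omega, show b ≤ W by omega, true_and]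
    constructor <;> intro x hx <;> simp at hx <;> simp [hx]
  all_goals obtain ⟨w12, w13, g4, g5, g6, hag⟩ := h₁
  all_goals have e2 : s₁.word 2 = m := by rw [hag.word 2 (by decide), h.word_two]
  all_goals have e3 : s₁.word 3 = L := by rw [hag.word 3 (by decide), h.word_three]
  all_goals have e7 : s₁.wordArr 7 = s.wordArr 7 := hag.wordArr 7 (by decide)
  · exact (run_findRank e2 e3 w12 w13 (by omega) fun i => by
      rw [e7]; have := h.rowLe i; omega).agree
  all_goals obtain ⟨r1, r2⟩ := h₂
  all_goals have f7 : s₂.wordArr 7 = s₁.wordArr 7 := r2.wordArr 7 (by decide)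
  all_goals have hr1 : s₁.row m = s.row m := by funext t j; rw [State.row, e7, State.row]
  all_goals have hr2 : s₂.row m = s.row m := by funext t j; rw [State.row, f7, e7, State.row]
  all_goals rw [hr1] at r1
  · rw [r2.word 2 (by decide), e2]
  · rw [r2.word 3 (by decide), e3]
  · rw [r2.word 12 (by decide), w12]
  · rw [r2.word 13 (by decide), w13]
  · rw [r2.word 9 (by decide), hag.word 9 (by decide), h9]
  · rw [f7, e7]; exact h.rowLe
  · rw [hr2]; exact r1
  · obtain ⟨⟨k1, k2⟩, k3⟩ := h₃
    rw [hr2] at k1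
    -- The masks of both children plus one are bounded by the number of positions strictly between
    -- `a` and `b`, hence by `m`.
    refine ⟨?_, ?_, ?_, ⟨s₂.word 15, r1.lt (N := b - a - 1) (by omega) (by omega), r1, k1⟩, k2⟩
    · rw [k3.wordArr 4 (by decide), r2.wordArr 4 (by decide), g4]
    · rw [k3.wordArr 5 (by decide), r2.wordArr 5 (by decide), g5]
    · rw [k3.wordArr 6 (by decide), r2.wordArr 6 (by decide), g6]

/-- Only the row of `p` changes, and `p` is neither an older triangle nor a child of one, so all
older rows keep their meaning; the new row is that of `RankUpTo.rowOk`, its mask that of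
`mask_newRow`. -/
theorem Peel.add (hs : Sorted X Y m) (h : Peel X Y m L Al H s)
    (hc : Convex X Y m Al (s.wordArr 2) (s.wordArr 3)) {p : ℕ} (hp : Al p) (hp0 : 0 < p)
    (hpm : p < m + 1) (hne : ¬ (s.wordArr 3 p = 0 ∧ s.wordArr 2 p = m + 1)) (hLm : L ≤ m + 1)
    (hG : ∀ i, Al i → 0 < i → i < m + 1 →
      lift X Y (s.wordArr 3 i) i (s.wordArr 2 i) ≤
        lift X Y (s.wordArr 3 p) p (s.wordArr 2 p) / tri X Y (s.wordArr 3 p) p (s.wordArr 2 p) *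
          tri X Y (s.wordArr 3 i) i (s.wordArr 2 i))
    (hr : Recorded m L p s s') (h2 : s'.word 2 = s.word 2) (h3 : s'.word 3 = s.word 3)
    (hX : s'.realArr 2 = s.realArr 2) (hY : s'.realArr 3 = s.realArr 3)
    (e2 : s'.wordArr 2 = Function.update (s.wordArr 2) (s.wordArr 3 p) (s.wordArr 2 p))
    (e3 : s'.wordArr 3 = Function.update (s.wordArr 3) (s.wordArr 2 p) (s.wordArr 3 p)) :
    Peel X Y m L (fun i => Al i ∧ i ≠ p) H s' := by
  have hn := h.forest.chain.next p hp hpm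
  have hv := h.forest.chain.prev p hp hp0
  have E1 := h.forest.edge _ hv.2.1 (by omega)
  rw [hv.2.2] at E1
  have E2 := h.forest.edge p hp hpm
  have n1 := Below.ne hp hp0 E1
  have n2 := Below.ne hp hp0 E2
  have m1 := h.mask_below hv.1 E1
  have m2 := h.mask_below hn.1 E2
  obtain ⟨r, r1, r2, r3⟩ := hr.rank
  have old : ∀ t, t ≠ p → ∀ j < L, s'.row m t j = s.row m t j := fun t ht j hj => by
    rw [r3 t j (by omega), if_neg (by simp [ht])]
  have new : ∀ j < L, s'.row m p j = newRow (s.row m (s.wordArr 4 (s.wordArr 3 p)))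
      (s.row m (s.wordArr 4 p)) p r j := fun j hj => by rw [r3 p j (by omega), if_pos ⟨rfl, hj⟩]
  have maskc : ∀ u v : ℕ → ℕ, (∀ j < L, u j = v j) → mask u L = mask v L := fun u v huv =>
    Finset.sum_congr rfl fun j hj => by rw [huv j (Finset.mem_range.1 hj)]
  have ap : s.wordArr 3 p ≠ p := by omega
  have bp : s.wordArr 2 p ≠ p := by omega
  refine ⟨h2.trans h.word_two, h3.trans h.word_three, hX.trans h.realX, hY.trans h.realY, ?_,
    fun j hj => ?_, fun t ht hta => ?_, fun t ht hta => ?_, hr.rowLe,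
    fun i => ?_⟩
  · rw [e2, e3, hr.child, hr.leftChild, hr.opposite]
    exact h.forest.add hs hc hp hp0 hpm hne hG
  · rw [old 0 (by omega) j hj]; exact h.rowZero j hj
  · rw [hr.child, hr.leftChild]
    by_cases htp : t = p
    · subst htp
      have c1 : Function.update (s.wordArr 5) t (s.wordArr 4 (s.wordArr 3 t)) t =
        s.wordArr 4 (s.wordArr 3 t) := Function.update_self ..
      have c2 : Function.update (s.wordArr 4) (s.wordArr 3 t) t t = s.wordArr 4 t :=
        Function.update_of_ne (Ne.symm ap) ..
      obtain ⟨q1, q2, q3, q4⟩ := r2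
      have q : RankUpTo (s'.row m (s.wordArr 4 (s.wordArr 3 t))) (s'.row m (s.wordArr 4 t)) L r := by
        refine ⟨q1, fun h => ?_, fun i h1 h2 => ?_, ?_⟩
        · rw [old _ n1 r r1, old _ n2 r r1]; exact q2 h
        · rw [old _ n1 i h2, old _ n2 i h2]; exact q3 i h1 h2
        · have a1 : mask (s'.row m (s.wordArr 4 (s.wordArr 3 t))) r =
              mask (s.row m (s.wordArr 4 (s.wordArr 3 t))) r :=
            Finset.sum_congr rfl fun j hj => by
              rw [old _ n1 j (by have := Finset.mem_range.1 hj; omega)]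
          have a2 : mask (s'.row m (s.wordArr 4 t)) r = mask (s.row m (s.wordArr 4 t)) r :=
            Finset.sum_congr rfl fun j hj => by
              rw [old _ n2 j (by have := Finset.mem_range.1 hj; omega)]
          rw [a1, a2]; exact q4
      refine RankUpTo.rowOk (r := r) (by rw [c1, c2]; exact q) r1 fun j hj => ?_
      rw [c1, c2, new j hj]
      simp only [newRow, old _ n1 j hj, old _ n2 j hj]
    · have hta' : ¬ Al t := fun h => hta ⟨h, htp⟩
      have hta'' : t ≠ s.wordArr 3 p := fun e => hta' (e ▸ hv.2.1)
      have b1 := Below.ne hp hp0 (h.forest.left t ht hta')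
      have b2 := Below.ne hp hp0 (h.forest.right t ht hta')
      obtain ⟨r', q1, q2, q3, q4, q5, q6⟩ := h.rowOk t ht hta'
      refine ⟨r', q1, ?_, fun j hj => ?_, ?_, ?_, fun j h1 h2 => ?_⟩ <;>
        try simp only [Function.update_of_ne htp, Function.update_of_ne hta'']
      · rw [old t htp _ q1, q2]
      · rw [old t htp _ (by omega), q3 j hj]
      · rw [old _ b1 _ q1, q4]
      · rw [old _ b2 _ q1, q5]
      · rw [old _ b1 _ h2, old _ b2 _ h2, old t htp _ h2]; exact q6 j h1 h2
  · rw [e2, e3]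
    by_cases htp : t = p
    · subst htp
      rw [Function.update_of_ne (Ne.symm ap), Function.update_of_ne (Ne.symm bp), maskc _ _ new]
      have := mask_newRow r2 r1 (by omega : t ≠ 0)
      omega
    · have hta' : ¬ Al t := fun h => hta ⟨h, htp⟩
      have t1 : t ≠ s.wordArr 2 p := fun e => hta' (e ▸ hn.2.1)
      have t2 : t ≠ s.wordArr 3 p := fun e => hta' (e ▸ hv.2.1)
      rw [Function.update_of_ne t1, Function.update_of_ne t2, maskc _ _ (old t htp)]
      exact h.mask_le t ht hta'
  · have := h.forest.chain.le _ hn.2.1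
    rw [hr.opposite, Function.update_apply, Function.update_apply]
    split_ifs
    · omega
    · omega
    · exact h.opLe i

/-- Reflex vertices are dropped only while there are no triangles, so the rank table is not
concerned. -/
theorem Peel.drop (hs : Sorted X Y m) (h : Peel X Y m L Al H s)
    (h0 : ∀ t, H t → Al t) {p : ℕ} (hp : Al p) (hp0 : 0 < p)
    (hpm : p < m + 1) (ht : tri X Y (s.wordArr 3 p) p (s.wordArr 2 p) ≤ 0)
    (hb : s.wordArr 2 p ≠ m + 1)
    (ha : Agree [(2, 2), (2, 3), (2, 1), (0, 6)] s s')
    (e2 : s'.wordArr 2 = Function.update (s.wordArr 2) (s.wordArr 3 p) (s.wordArr 2 p))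
    (e3 : s'.wordArr 3 = Function.update (s.wordArr 3) (s.wordArr 2 p) (s.wordArr 3 p)) :
    Peel X Y m L (fun i => Al i ∧ i ≠ p) (fun i => H i ∧ i ≠ p) s' := by
  have h7 := ha.wordArr 7 (by decide)
  refine ⟨(ha.word 2 (by decide)).trans h.word_two, (ha.word 3 (by decide)).trans h.word_three,
    (ha.realArr 2 (by decide)).trans h.realX, (ha.realArr 3 (by decide)).trans h.realY, ?_,
    fun j hj => ?_, fun t ht hta => absurd ⟨h0 t ht.1, ht.2⟩ hta,
    fun t ht hta => absurd ⟨h0 t ht.1, ht.2⟩ hta, ?_, ?_⟩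
  · rw [e2, e3, ha.wordArr 4 (by decide), ha.wordArr 5 (by decide), ha.wordArr 6 (by decide)]
    exact h.forest.drop hs h0 hp hp0 hpm ht hb
  · rw [State.row, h7]; exact h.rowZero j hj
  · rw [h7]; exact h.rowLe
  · rw [ha.wordArr 6 (by decide)]; exact h.opLe

end Peel

end CircleSep

namespace CircleSep

/-! ### One cut: choosing the best vertex and repairing the keys -/

section Peel
variable {X Y : ℕ → ℝ} {m L W : ℕ} {Al H E : ℕ → Prop} {s s' : State}

theorem Keys.agree {l : List (Fin 4 × ℕ)} (h : Keys X Y m Al E s) (ha : Agree l s s')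
    (hl : ∀ c ∈ [((2 : Fin 4), 1), (2, 2), (2, 3), (3, 4), (3, 5)], c ∉ l) :
    Keys X Y m Al E s' := by
  have h1 := ha.wordArr 1 (hl _ (by decide))
  have h2 := ha.wordArr 2 (hl _ (by decide))
  have h3 := ha.wordArr 3 (hl _ (by decide))
  have h4 := ha.realArr 4 (hl _ (by decide))
  have h5 := ha.realArr 5 (hl _ (by decide))
  refine ⟨fun i a b c d => ?_, fun i hi => ?_⟩
  · rw [State.key, h1, h2, h3, h4, h5]; exact h.key i a b c d
  · rw [h1]; exact h.dead i hi

/-- Recomputing the key of the vertex `a`. -/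
theorem run_refresh {b : Test} {e : WExp} {a : ℕ} (h : Peel X Y m L Al H s)
    (hk : Keys X Y m Al E s) (ht : Tour (m + 2) (fun _ => True) s) (ha : Al a)
    (hb : b.holds s ↔ ¬ (0 < a ∧ a < m + 1)) (he : e.eval s = a)
    (hL : m + 1 < 2 ^ L) (hm : 0 < m) (hW : (m + 2) * (m + 2) ≤ W) :
    Run W (.branch b .skip (.setWord 6 e ;; chainKey ;; climb)) s (4 * L + 18) fun s' =>
      Peel X Y m L Al H s' ∧ Keys X Y m Al (fun i => E i ∧ i ≠ a) s' ∧
        Tour (m + 2) (fun _ => True) s' := by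
  have hWm : 2 * (m + 2) ≤ W := le_trans (Nat.mul_le_mul_right _ (by omega)) hW
  have ham := h.forest.chain.le a ha
  refine (Run.branch (T := 1 + (10 + (4 * (L + 1) + 2))) (fun hc => ?_) (fun hc => ?_)).mono
    (by omega) fun _ h => h
  · have hc' := hb.1 hc
    refine (Run.of_wp (c := .skip) (Q := fun s' => s' = s) rfl).mono (by simp [Prog.cost]) ?_
    rintro _ rfl
    exact ⟨h, ⟨fun i i1 i2 i3 i4 => hk.key i i1 i2 i3 fun hE => i4 ⟨hE, by rintro rfl; exact hc' ⟨i2, i3⟩⟩,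
      hk.dead⟩, ht⟩
  · rw [hb, not_not] at hc
    obtain ⟨hc1, hc2⟩ := hc
    have hn := h.forest.chain.next a ha hc2
    have hv := h.forest.chain.prev a ha hc1
    have hbm := h.forest.chain.le _ hn.2.1
    refine Run.wp_seq (R := fun s₁ => s₁ = s.setWord 6 a) ?_ fun s₁ h₁ =>
      Run.seq ((run_chainKey (s := s₁) (i := a) (X := X) (Y := Y) (m := m) ?_ ?_ (by omega) (by omega)
        ?_ ?_ ?_ ?_).agree) fun s₂ h₂ => (run_climb (M := m + 2) (i := a) (N := L + 1) ?_ (by omega)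
          (by omega) ?_ ?_).mono le_rfl fun s₃ h₃ => ?_
    · simp only [wp, he]; exact ⟨by omega, trivial⟩
    all_goals subst h₁
    · simpa using h.word_two
    · simp
    · exact h.realX
    · exact h.realY
    · show s.wordArr 3 a ≤ W; omega
    · show s.wordArr 2 a ≤ W; omega
    all_goals obtain ⟨⟨k1, k2, k3, k4⟩, ha2⟩ := h₂
    · rw [ha2.word 6 (by decide)]; simp
    · rw [pow_succ]; omega
    · refine ht.change (i := a) ?_ ?_ fun j hj => ?_
      · rw [ha2.word 5 (by decide)]; simp
      · rw [ha2.wordArr 0 (by decide)]; rfl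
      · rw [k2 j hj]; rfl
    · obtain ⟨t1, ha3⟩ := h₃
      have ag : Agree ([(0, 6)] ++ chainKey.mods) s s₂ :=
        ((Agree.refl _ s).setWord (by decide)).trans (ha2.mono (by decide))
      refine ⟨(h.agree ag (by decide)).agree ha3 (by decide), Keys.agree ⟨?_, ?_⟩ ha3 (by decide), t1⟩
      · intro i i1 i2 i3 i4
        rw [ha2.wordArr 2 (by decide), ha2.wordArr 3 (by decide)]
        by_cases e : i = a
        · rw [e]; exact k1
        · rw [k2 i e]; exact hk.key i i1 i2 i3 fun hE => i4 ⟨hE, e⟩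
      · intro i hi
        rw [k4 i (by rintro rfl; exact hi ⟨ha, hc1, hc2⟩)]
        exact hk.dead i hi

theorem vertexKey_class (nx pv : ℕ → ℕ) (i : ℕ) : (ofLex (vertexKey X Y m nx pv i)).1 =
    if tri X Y (pv i) i (nx i) ≤ 0 ∧ nx i ≠ m + 1 then 2 else 1 := by
  unfold vertexKey
  split_ifs <;> rfl

/-- The best vertex of the chain. -/
theorem Keys.top (hs : Sorted X Y m) (h : Peel X Y m L Al H s) (hk : Keys X Y m Al (fun _ => False) s)
    (ht : Tour (m + 2) (fun _ => True) s) {q q' : ℕ} (hq : Al q ∧ 0 < q ∧ q < m + 1)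
    (hq' : Al q' ∧ 0 < q' ∧ q' < m + 1) (hqq : q ≠ q') {p : ℕ} (hp : p = s.wordArr 0 1) :
    Al p ∧ 0 < p ∧ p < m + 1 ∧ ¬ (s.wordArr 3 p = 0 ∧ s.wordArr 2 p = m + 1) ∧
    (s.wordArr 1 p ≠ 1 → tri X Y (s.wordArr 3 p) p (s.wordArr 2 p) ≤ 0 ∧ s.wordArr 2 p ≠ m + 1 ∧
      ∀ t, H t → Al t) ∧
    (s.wordArr 1 p = 1 → Convex X Y m Al (s.wordArr 2) (s.wordArr 3) ∧
      ∀ i, Al i → 0 < i → i < m + 1 →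
      lift X Y (s.wordArr 3 i) i (s.wordArr 2 i) ≤
        lift X Y (s.wordArr 3 p) p (s.wordArr 2 p) / tri X Y (s.wordArr 3 p) p (s.wordArr 2 p) *
          tri X Y (s.wordArr 3 i) i (s.wordArr 2 i)) := by
  have hle : ∀ i, i < m + 2 → s.key i ≤ s.key p := fun i hi => hp ▸ ht.le_top hi
  have cls : ∀ i, Al i → 0 < i → i < m + 1 → s.wordArr 1 i =
      if tri X Y (s.wordArr 3 i) i (s.wordArr 2 i) ≤ 0 ∧ s.wordArr 2 i ≠ m + 1 then 2 else 1 := by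
    intro i h1 h2 h3
    have := congrArg (fun k => (ofLex k).1) (hk.key i h1 h2 h3 id)
    rwa [vertexKey_class] at this
  have clsle : ∀ i, i < m + 2 → s.wordArr 1 i ≤ s.wordArr 1 p := by
    intro i hi
    have := hle i hi
    simp only [State.key, Prod.Lex.le_iff, ofLex_toLex] at this
    rcases this with h | h
    · exact h.le
    · exact h.1.le
  -- Whatever is not an inner vertex of the chain has class `0`, and inner vertices have positive
  -- class.
  have hpal : Al p ∧ 0 < p ∧ p < m + 1 := by
    by_contra hc
    have h1 := hk.dead p hc
    have h2 := clsle q (by omega)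
    rw [cls q hq.1 hq.2.1 hq.2.2] at h2
    split_ifs at h2 <;> omega
  obtain ⟨p1, p2, p3⟩ := hpal
  have hn := h.forest.chain.next p p1 p3
  have hv := h.forest.chain.prev p p1 p2
  have hbm := h.forest.chain.le _ hn.2.1
  -- With two inner vertices left, none has the base point on both sides; this excludes the
  -- degenerate orientation.
  have two : ∀ i, Al i → 0 < i → i < m + 1 → ¬ (s.wordArr 3 i = 0 ∧ s.wordArr 2 i = m + 1) := by
    rintro i i1 i2 i3 ⟨e1, e2⟩
    obtain ⟨r, r1, r2⟩ : ∃ r, (Al r ∧ 0 < r ∧ r < m + 1) ∧ r ≠ i := by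
      by_cases e : q = i
      · exact ⟨q', hq', by omega⟩
      · exact ⟨q, hq, e⟩
    rcases lt_or_gt_of_ne r2 with h' | h'
    · have := h.forest.chain.le_prev i1 r1.1 h'; omega
    · have := h.forest.chain.next_le i1 r1.1 h'; omega
  refine ⟨p1, p2, p3, two p p1 p2 p3, fun h1 => ?_, fun h1 => ?_⟩
  · have hc := cls p p1 p2 p3
    split_ifs at hc with h2
    · refine ⟨h2.1, h2.2, fun t t1 => ?_⟩
      -- An existing triangle would guarantee a strictly convex hull, which has no reflex vertex.
      by_contra t2
      have b2 : s.wordArr 2 p < m + 1 := by omega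
      have := h.forest.conv t t1 t2 (s.wordArr 3 p) p (s.wordArr 2 p) ?_ (h.forest.sub p p1 p2 p3)
        (.inr (h.forest.sub _ hn.2.1 (by omega) b2)) hv.1 hn.1 (two p p1 p2 p3)
      · linarith [h2.1]
      · rcases Nat.eq_zero_or_pos (s.wordArr 3 p) with e | e
        · exact .inl e
        · exact .inr (h.forest.sub _ hv.2.1 e (by omega))
    · exact (h1 hc).elim
  · have nr : ∀ i, Al i → 0 < i → i < m + 1 →
        ¬ (tri X Y (s.wordArr 3 i) i (s.wordArr 2 i) ≤ 0 ∧ s.wordArr 2 i ≠ m + 1) := by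
      intro i i1 i2 i3 hc
      have h2 := cls i i1 i2 i3
      rw [if_pos hc] at h2
      have := clsle i (by omega)
      omega
    have cv : Convex X Y m Al (s.wordArr 2) (s.wordArr 3) := by
      intro i i1 i2 i3
      have := nr i i1 i2 i3
      by_cases e : s.wordArr 2 i = m + 1
      · exact .inr e
      · left; by_contra hc; exact this ⟨not_lt.1 hc, e⟩
    refine ⟨cv, fun i i1 i2 i3 => ?_⟩
    have hn' := h.forest.chain.next i i1 i3
    have hv' := h.forest.chain.prev i i1 i2
    have tp := hs.tri_pos h.forest.chain cv hv'.2.1 i1 hn'.2.1 hv'.1 hn'.1 (two i i1 i2 i3)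
    have := hle i (by omega)
    rw [hk.key i i1 i2 i3 id, hk.key p p1 p2 p3 id, vertexKey, vertexKey, if_neg (nr i i1 i2 i3),
      if_neg (nr p p1 p2 p3)] at this
    simp only [Prod.Lex.le_iff, ofLex_toLex, lt_irrefl, true_and, false_or, le_refl, and_true] at this
    rw [← le_iff_lt_or_eq, div_le_iff₀ tp] at this
    exact this

/-- Unlinking `p` changes the neighbours, and with them the keys, of its two neighbours only. These
form the exception set in `Keys` until both have been refreshed. Every ingredient costs a multiple
of `L`. -/
theorem run_cut (hs : Sorted X Y m) (h : Peel X Y m L Al H s) (hk : Keys X Y m Al (fun _ => False) s)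
    (ht : Tour (m + 2) (fun _ => True) s) {q q' : ℕ} (hq : Al q ∧ 0 < q ∧ q < m + 1)
    (hq' : Al q' ∧ 0 < q' ∧ q' < m + 1) (hqq : q ≠ q')
    (hL : m + 1 < 2 ^ L) (hLm : L ≤ m + 1) (hW : (m + 2) * (m + 2) ≤ W) :
    Run W cut s (23 * L + 62) fun s' => ∃ p H', (Al p ∧ 0 < p ∧ p < m + 1) ∧
      Peel X Y m L (fun i => Al i ∧ i ≠ p) H' s' ∧
      Keys X Y m (fun i => Al i ∧ i ≠ p) (fun _ => False) s' ∧
      Tour (m + 2) (fun _ => True) s' := by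
  have hWm : 2 * (m + 2) ≤ W := le_trans (Nat.mul_le_mul_right _ (by omega)) hW
  obtain ⟨p1, p2, p3, hne, hdrop, hadd⟩ := Keys.top hs h hk ht hq hq' hqq rfl
  set p := s.wordArr 0 1 with hp
  have hn := h.forest.chain.next p p1 p3
  have hv := h.forest.chain.prev p p1 p2
  have hbm := h.forest.chain.le _ hn.2.1
  set a := s.wordArr 3 p with ha
  set b := s.wordArr 2 p with hb
  have hR := h.forest.chain.remove p1 p2 p3
  -- the state after the branch
  let I₂ : State → Prop := fun u => u.word 9 = p ∧ u.word 10 = a ∧ u.word 11 = b ∧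
    Agree (record.mods ++ [(0, 9), (0, 10), (0, 11)]) s u ∧
    (s.wordArr 1 p = 1 ∧ Recorded m L p s u ∨ s.wordArr 1 p ≠ 1 ∧
      Agree [(0, 9), (0, 10), (0, 11)] s u)
  let I₃ : State → Prop := fun u => u.word 10 = a ∧ u.word 11 = b ∧
    ∃ H', Peel X Y m L (fun i => Al i ∧ i ≠ p) H' u ∧
      Keys X Y m (fun i => Al i ∧ i ≠ p) (fun i => i = a ∨ i = b) u ∧
      Tour (m + 2) (fun _ => True) u
  refine Run.mono (Run.wp_seq (R := fun s₁ => s₁ = ((s.setWord 9 p).setWord 10 a).setWord 11 b) ?_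
    fun s₁ h₁ => Run.seq (R := I₂) (T₁ := 11 * L + 12) ?_ fun s₂ h₂ => Run.wp_seq
    (R := fun s₃ => s₃ = (((s₂.putWord 2 a b).putWord 3 b a).putWord 1 p 0).setWord 6 p) ?_
    fun s₃ h₃ => Run.seq (R := I₃) (T₁ := 4 * (L + 1) + 2) ?_ fun s₄ h₄ =>
    Run.seq (R := fun s₅ => s₅.word 11 = b ∧ ∃ H', Peel X Y m L (fun i => Al i ∧ i ≠ p) H' s₅ ∧
      Keys X Y m (fun i => Al i ∧ i ≠ p) (fun i => (i = a ∨ i = b) ∧ i ≠ a) s₅ ∧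
      Tour (m + 2) (fun _ => True) s₅) (T₁ := 4 * L + 18) (T₂ := 4 * L + 18) ?_
      fun s₅ h₅ => ?_)
    (by simp [Prog.cost]; omega) fun _ h => h
  · simp only [wp, WExp.eval_get, WExp.eval_reg, WExp.eval_ofNat, State.setWord_word,
      State.setWord_wordArr]
    norm_num
    rw [← hp, ← ha, ← hb]
    simp only [show p ≤ W by omega, show a ≤ W by omega, show b ≤ W by omega, and_self]
  · subst h₁
    have ag : Agree [(0, 9), (0, 10), (0, 11)] s (((s.setWord 9 p).setWord 10 a).setWord 11 b) :=
      (((Agree.refl _ _).setWord (by decide)).setWord (by decide)).setWord (by decide)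
    refine Run.branch (T := 11 * L + 11) (fun hc => ?_) (fun hc => ?_)
    · simp only [Test.holds, WExp.eval_get, WExp.eval_reg, State.setWord_word, State.setWord_wordArr,
        WExp.eval_ofNat] at hc
      norm_num at hc
      have hrec := run_record (W := W) (h.agree ag (by decide)) p1 p2 p3 (by simp) (by simp [ha])
        (by simp [hb]) hL hLm hW
      refine hrec.agree.mono le_rfl fun u hu => ⟨?_, ?_, ?_, ?_, .inl ⟨hc, hu.1.child, hu.1.leftChild,
        hu.1.opposite, hu.1.rank, hu.1.rowLe⟩⟩
      · rw [hu.2.word 9 (by decide)]; simp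
      · rw [hu.2.word 10 (by decide)]; simp
      · rw [hu.2.word 11 (by decide)]; simp
      · exact (ag.mono (by simp)).trans (hu.2.mono (by simp))
    · simp only [Test.holds, WExp.eval_get, WExp.eval_reg, State.setWord_word, State.setWord_wordArr,
        WExp.eval_ofNat] at hc
      norm_num at hc
      refine (Run.of_wp (c := .skip) (Q := I₂) ?_).mono (by simp [Prog.cost]) fun _ h => h
      refine ⟨by simp, by simp, by simp, ag.mono (by simp), .inr ⟨hc, ag⟩⟩
  · obtain ⟨g9, g10, g11, -, -⟩ := h₂
    simp only [wp, WExp.eval_reg, WExp.eval_ofNat, State.putWord_word, g9, g10, g11]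
    simp only [show p ≤ W by omega, show a ≤ W by omega, show b ≤ W by omega, Nat.zero_le, and_self]
  · obtain ⟨g9, g10, g11, ag, hor⟩ := h₂
    have c1 : s₂.wordArr 1 = s.wordArr 1 := ag.wordArr 1 (by decide)
    have c2 : s₂.wordArr 2 = s.wordArr 2 := ag.wordArr 2 (by decide)
    have c3 : s₂.wordArr 3 = s.wordArr 3 := ag.wordArr 3 (by decide)
    have d1 : s₃.wordArr 1 = Function.update (s.wordArr 1) p 0 := by rw [h₃]; simp [c1]
    have d2 : s₃.wordArr 2 = Function.update (s.wordArr 2) a b := by rw [h₃]; simp [c2]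
    have d3 : s₃.wordArr 3 = Function.update (s.wordArr 3) b a := by rw [h₃]; simp [c3]
    have dr : s₃.realArr = s.realArr := by
      rw [h₃]; funext x; exact ag.realArr x (by simp [record, findRank, fillRow, Prog.mods])
    have kne : ∀ j, j ≠ p → s₃.key j = s.key j := fun j hj => by
      rw [State.key, d1, dr, Function.update_of_ne hj, State.key]
    have peel : ∃ H', Peel X Y m L (fun i => Al i ∧ i ≠ p) H' s₃ := by
      rcases hor with ⟨o1, o2⟩ | ⟨o1, o2⟩
      · obtain ⟨cv, hG⟩ := hadd o1
        refine ⟨H, Peel.add hs h cv p1 p2 p3 hne hLm hG (s' := s₃) ?_ ?_ ?_ ?_ ?_ d2 d3⟩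
        · obtain ⟨o3, o4, o5, ⟨r, r1, r2, r3⟩, o7⟩ := o2
          subst h₃
          exact ⟨by simpa using o3, by simpa using o4, by simpa using o5, ⟨r, r1, r2, r3⟩, by simpa using o7⟩
        · rw [h₃]; simp; exact ag.word 2 (by decide)
        · rw [h₃]; simp; exact ag.word 3 (by decide)
        · rw [dr]
        · rw [dr]
      · obtain ⟨t1, t2, t3⟩ := hdrop o1
        refine ⟨_, Peel.drop hs (h.agree o2 (by decide)) t3 p1 p2 p3 (by rw [c2, c3]; exact t1)
          (by rw [c2]; exact t2) (s' := s₃) ?_ (by rw [d2, c2, c3]) (by rw [d3, c2, c3])⟩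
        subst h₃
        constructor <;> intro x hx <;> simp at hx <;> simp [hx]
    have keys : Keys X Y m (fun i => Al i ∧ i ≠ p) (fun i => i = a ∨ i = b) s₃ := by
      refine ⟨fun i i1 i2 i3 i4 => ?_, fun i hi => ?_⟩
      · push Not at i4
        rw [kne i i1.2, hk.key i i1.1 i2 i3 id]
        simp only [vertexKey, d2, d3, Function.update_of_ne i4.1, Function.update_of_ne i4.2]
      · rw [d1]
        by_cases e : i = p
        · simp [e]
        · rw [Function.update_of_ne e]
          exact hk.dead i fun h => hi ⟨⟨h.1, e⟩, h.2⟩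
    have tour : Tour (m + 2) (fun v => ∀ k, 1 ≤ k → (m + 2 + p) / 2 ^ k ≠ v) s₃ := by
      refine ht.change ?_ ?_ kne
      · rw [h₃]; simp; exact ag.word 5 (by decide)
      · rw [h₃]; simp; exact ag.wordArr 0 (by decide)
    refine (run_climb (i := p) (M := m + 2) (N := L + 1) ?_ (by omega) (by omega)
      (by rw [pow_succ]; omega) tour).mono le_rfl fun u hu => ?_
    · rw [h₃]; simp
    · obtain ⟨H', hH'⟩ := peel
      refine ⟨?_, ?_, H', hH'.agree hu.2 (by decide), keys.agree hu.2 (by decide), hu.1⟩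
      · rw [hu.2.word 10 (by decide), h₃]; simpa using g10
      · rw [hu.2.word 11 (by decide), h₃]; simpa using g11
  · obtain ⟨g10, g11, H', k1, k2, k3⟩ := h₄
    refine (run_refresh (a := a) k1 k2 k3 ⟨hv.2.1, by omega⟩ ?_ ?_ hL (by omega) hW).agree.mono le_rfl
      fun u hu => ⟨?_, H', hu.1⟩
    · simp only [Test.holds, WExp.eval_reg, WExp.eval_ofNat, g10]; omega
    · simp [g10]
    · rw [hu.2.word 11 (by decide), g11]
  · obtain ⟨g11, H', k1, k2, k3⟩ := h₅
    refine (run_refresh (a := b) k1 k2 k3 ⟨hn.2.1, by omega⟩ ?_ ?_ hL (by omega) hW).mono le_rfl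
      fun u hu => ⟨p, H', ⟨p1, p2, p3⟩, hu.1, ⟨fun i i1 i2 i3 _ => ?_, hu.2.1.dead⟩, hu.2.2⟩
    · simp only [Test.holds, WExp.eval_reg, WExp.eval_add, WExp.eval_ofNat, g11, k1.word_two]; omega
    · simp [g11]
    · exact hu.2.1.key i i1 i2 i3 (by rintro ⟨⟨e | e, e'⟩, e''⟩ <;> omega)

end Peel

end CircleSep

namespace CircleSep

/-! ### From the sorted points to the search tree -/

section Peel
variable {X Y : ℕ → ℝ} {m L W x : ℕ} {Al H E N : ℕ → Prop} {s s' : State}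

theorem run_cuts (hs : Sorted X Y m) (h : Peel X Y m L Al H s)
    (hk : Keys X Y m Al (fun _ => False) s) (ht : Tour (m + 2) (fun _ => True) s)
    (hal : ∀ i, 0 < i → i < m + 1 → Al i) (hm : 0 < m)
    (hL : m + 1 < 2 ^ L) (hLm : L ≤ m + 1) (hW : (m + 2) * (m + 2) ≤ W) :
    Run W cuts s (m * (23 * L + 64) + 2) fun s' => ∃ Al H x, 0 < x ∧ x < m + 1 ∧
      (∀ i, Al i ↔ i = 0 ∨ i = x ∨ i = m + 1) ∧ Peel X Y m L Al H s' := by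
  have hWm : 2 * (m + 2) ≤ W := le_trans (Nat.mul_le_mul_right _ (by omega)) hW
  let I : ℕ → State → Prop := fun t u => u.word 8 = t + 1 ∧ t + 1 ≤ m ∧ ∃ Al H,
    Peel X Y m L Al H u ∧ Keys X Y m Al (fun _ => False) u ∧ Tour (m + 2) (fun _ => True) u ∧
    Set.ncard {j | Al j ∧ 0 < j ∧ j < m + 1} + t = m
  refine Run.mono (Run.wp_seq (R := fun u => u = s.setWord 8 1) ?_ fun s₁ h₁ =>
    Run.loop_agree (T := 23 * L + 62 + 1) m I ?_ ?_ (i := 0) ?_)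
    (by simp only [Prog.cost, Nat.sub_zero]; ring_nf; omega) fun _ h => h
  · simp only [wp, WExp.eval_ofNat]; exact ⟨by omega, trivial⟩
  · rintro t u - ⟨k1, k2, Al, H, k3, k4, k5, k6⟩ hb
    simp only [Test.holds, WExp.eval_reg, k1, k3.word_two] at hb
    have hfin : {j | Al j ∧ 0 < j ∧ j < m + 1}.Finite :=
      (Set.finite_lt_nat (m + 1)).subset fun j hj => hj.2.2
    -- The loop leaves one vertex over, so two are alive whenever a cut is made.
    obtain ⟨q, hq, q', hq', hqq⟩ := (Set.one_lt_ncard hfin).1 (by omega)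
    refine ⟨by omega, ((run_cut hs k3 k4 k5 hq hq' hqq hL hLm hW).agree).seq (T₂ := 1) ?_⟩
    rintro v ⟨⟨p, H', hp, l1, l2, l3⟩, hag⟩
    refine Run.of_wp (c := .setWord 8 _) ?_
    have e8 : v.word 8 = t + 1 := by rw [hag.word 8 (by decide), k1]
    simp only [wp, WExp.eval_reg, WExp.eval_add, WExp.eval_ofNat, e8]
    have ag : Agree [(0, 8)] v (v.setWord 8 (t + 1 + 1)) := (Agree.refl _ _).setWord (by decide)
    refine ⟨by omega, by simp, by omega, _, H', l1.agree ag (by decide), l2.agree ag (by decide),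
      ⟨by simpa using l3.size, l3.leaf, l3.lt, l3.ok⟩, ?_⟩
    have : {j | (Al j ∧ j ≠ p) ∧ 0 < j ∧ j < m + 1} = {j | Al j ∧ 0 < j ∧ j < m + 1} \ {p} := by
      ext j; simp only [Set.mem_ofPred_eq, Set.mem_sdiff, Set.mem_singleton_iff]; tauto
    rw [this, Set.ncard_sdiff_singleton_of_mem (by exact hp)]
    omega
  · rintro t u - ⟨k1, k2, Al, H, k3, k4, k5, k6⟩ hb
    simp only [Test.holds, WExp.eval_reg, k1, k3.word_two] at hb
    obtain ⟨x, hx⟩ := Set.ncard_eq_one.1 (by omega : Set.ncard {j | Al j ∧ 0 < j ∧ j < m + 1} = 1)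
    have hx' : ∀ i, (Al i ∧ 0 < i ∧ i < m + 1) ↔ i = x := fun i => by
      have := Set.ext_iff.1 hx i
      simpa using this
    obtain ⟨x1, x2, x3⟩ := (hx' x).2 rfl
    refine ⟨Al, H, x, x2, x3, fun i => ⟨fun hi => ?_, ?_⟩, k3⟩
    · have := k3.forest.chain.le i hi
      by_cases h0 : i = 0
      · exact .inl h0
      by_cases h1 : i = m + 1
      · exact .inr (.inr h1)
      exact .inr (.inl ((hx' i).1 ⟨hi, by omega, by omega⟩))
    · rintro (rfl | rfl | rfl)
      exacts [k3.forest.chain.zero, x1, k3.forest.chain.last]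
  · subst h₁
    have ag : Agree [(0, 8)] s (s.setWord 8 1) := (Agree.refl _ _).setWord (by decide)
    refine ⟨by simp, by omega, Al, H, h.agree ag (by decide), hk.agree ag (by decide),
      ⟨by simpa using ht.size, ht.leaf, ht.lt, ht.ok⟩, ?_⟩
    have : {j | Al j ∧ 0 < j ∧ j < m + 1} = ((Finset.Ioo 0 (m + 1) : Finset ℕ) : Set ℕ) := by
      ext j
      simp only [Set.mem_ofPred_eq, Finset.coe_Ioo, Set.mem_Ioo]
      exact ⟨fun h => h.2, fun h => ⟨hal j h.1 h.2, h⟩⟩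
    rw [this, Set.ncard_coe_finset]
    simp

/-- The memory that the query program works on. -/
structure Searchable (X Y : ℕ → ℝ) (m L x : ℕ) (N : ℕ → Prop) (s : State) : Prop where
  word_two : s.word 2 = m
  word_three : s.word 3 = L
  word_four : s.word 4 = x
  realX : s.realArr 2 = X
  realY : s.realArr 3 = Y
  range : ∀ t, N t → 0 < t ∧ t ≤ m
  tree : Tree X Y m L x N (s.wordArr 2) (s.wordArr 3) (s.wordArr 4) (s.wordArr 5) (s.wordArr 6)
    (s.row m)
  rowLe : ∀ i, s.wordArr 7 i ≤ m
  opLe : ∀ i, s.wordArr 6 i ≤ m + 1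

/-- The last vertex `x` and the base point, which sits at both ends of the chain, span the root
edge. Its two root triangles become opposite to each other; a missing one is entered as `0`, the
base point, which is an endpoint of the edge. -/
theorem run_root (hs : Sorted X Y m) (hpos : ∀ k, 1 ≤ k → k ≤ m → LexPos (X k) (Y k))
    (h : Peel X Y m L Al H s) (hx : 0 < x) (hxm : x < m + 1)
    (hal : ∀ i, Al i ↔ i = 0 ∨ i = x ∨ i = m + 1) (hW : m + 1 ≤ W) :
    Run W root s 3 fun s' => ∃ x N, Searchable X Y m L x N s' := by
  have a0 : Al 0 := h.forest.chain.zero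
  have ax : Al x := (hal x).2 (.inr (.inl rfl))
  have hn := h.forest.chain.next 0 a0 (by omega)
  have e0 : s.wordArr 2 0 = x := by
    have := h.forest.chain.next_le a0 ax hx
    rcases (hal _).1 hn.2.1 with e | e | e <;> omega
  have b0 := h.below_le (h.forest.edge 0 a0 (by omega))
  have bx := h.below_le (h.forest.edge x ax hxm)
  have hxne : pt X Y 0 ≠ pt X Y x := by
    intro e
    have e1 := congrArg Complex.re e
    have e2 := congrArg Complex.im e
    simp only [pt, hs.X0, hs.Y0] at e1 e2
    rcases hpos x hx (by omega) with h | h <;> linarith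
  refine Run.of_wp (c := root) ?_
  simp only [root, wp, WExp.eval_get, WExp.eval_reg, WExp.eval_ofNat, State.setWord_word,
    State.setWord_wordArr, State.putWord_word, State.putWord_wordArr, e0]
  norm_num
  refine ⟨by omega, by omega, by omega, by omega, x, fun t => H t ∧ ¬ Al t, ?_⟩
  have := h.forest.tree hs hx hxm hal hxne h.rowOk h.rowZero
  refine ⟨by simpa using h.word_two, by simpa using h.word_three, by simp, h.realX, h.realY,
    fun t ht => ?_, ?_, by simpa using h.rowLe, fun i => ?_⟩
  · have := h.forest.range t ht.1; omega
  · have hr : ∀ u v w, (((s.setWord 4 x).putWord 6 u v).putWord 6 v w).row m = s.row m := by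
      intro u v w; funext t j; simp [State.row]
    rw [hr]
    simpa using this
  · simp only [State.putWord_wordArr, State.setWord_wordArr, if_true, Function.update_apply]
    split_ifs
    · omega
    · omega
    · exact h.opLe i

theorem run_triangulate (hs : Sorted X Y m) (hpos : ∀ k, 1 ≤ k → k ≤ m → LexPos (X k) (Y k))
    (hm : 0 < m) (h2 : s.word 2 = m) (h3 : s.word 3 = L) (hX : s.realArr 2 = X)
    (hY : s.realArr 3 = Y) (h0 : ∀ a, a ≠ 0 → ∀ i, s.wordArr a i = 0)
    (hL : m + 1 < 2 ^ L) (hLm : L ≤ m + 1) (hW : (m + 2) * (m + 2) ≤ W) :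
    Run W triangulate s (m * (23 * L + 87) + 50) fun s' => ∃ x N, Searchable X Y m L x N s' := by
  have hWm : 2 * (m + 2) ≤ W := le_trans (Nat.mul_le_mul_right _ (by omega)) hW
  refine Run.mono (Run.seq (run_links h2 (by omega) (h0 3 (by omega) 0)).agree fun s₁ h₁ =>
    Run.seq (run_chainKeys (m := m) (X := X) (Y := Y) ?_ (by omega) ?_ ?_ ?_ ?_ ?_).agree fun s₂ h₂ =>
    Run.wp_seq (R := fun u => u = s₂.setWord 5 (m + 2)) ?_ fun s₃ h₃ =>
    Run.seq (run_build (M := m + 2) ?_ (by omega)) fun s₄ h₄ =>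
    -- At the start all positions are on the chain, all inner positions count as hull vertices, and
    -- there is no triangle.
    Run.seq (T₂ := 3) (run_cuts (L := L) (Al := fun i => i ≤ m + 1) (H := fun i => 0 < i ∧ i < m + 1) hs ?_ ?_
      h₄.1 (fun i _ h => h.le) hm hL hLm hW) fun s₅ h₅ => ?_)
    (by simp only [Prog.cost]; ring_nf; omega) fun _ h => h
  · rw [h₁.2.word 2 (by decide), h2]
  · rw [h₁.2.realArr 2 (by decide), hX]
  · rw [h₁.2.realArr 3 (by decide), hY]
  · intro i hi; rw [h₁.1.2 i (by omega)]; omega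
  · intro i hi; rw [h₁.1.1 i hi]; omega
  · intro i; rw [h₁.2.wordArr 1 (by decide)]; exact h0 1 (by omega) i
  · have : s₂.word 2 = m := by rw [h₂.2.word 2 (by decide), h₁.2.word 2 (by decide), h2]
    simp only [wp, WExp.eval_add, WExp.eval_reg, WExp.eval_ofNat, this]
    exact ⟨by omega, trivial⟩
  · rw [h₃]; simp
  · obtain ⟨⟨n1, n2⟩, g1⟩ := h₁
    obtain ⟨⟨-, -⟩, g2⟩ := h₂
    have g3 : Agree [(0, 5)] s₂ s₃ := h₃ ▸ (Agree.refl _ _).setWord (by decide)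
    have ag : Agree (links.mods ++ chainKeys.mods ++ [(0, 5), (2, 0), (0, 7)]) s s₄ :=
      (((g1.mono (by decide)).trans (g2.mono (by decide))).trans (g3.mono (by decide))).trans
        (h₄.2.mono (by decide))
    have ag' : Agree (chainKeys.mods ++ [(0, 5), (2, 0), (0, 7)]) s₁ s₄ :=
      ((g2.mono (by decide)).trans (g3.mono (by decide))).trans (h₄.2.mono (by decide))
    have c2 : s₄.wordArr 2 = s₁.wordArr 2 := ag'.wordArr 2 (by decide)
    have c3 : s₄.wordArr 3 = s₁.wordArr 3 := ag'.wordArr 3 (by decide)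
    have z : ∀ a, 4 ≤ a → ∀ i, s₄.wordArr a i = 0 := fun a ha i => by
      rw [ag.wordArr a (by simp [links, chainKeys, chainKey, Prog.mods]; omega)]
      exact h0 a (by omega) i
    refine ⟨by rw [ag.word 2 (by decide), h2], by rw [ag.word 3 (by decide), h3],
      by rw [ag.realArr 2 (by decide), hX], by rw [ag.realArr 3 (by decide), hY], ?_,
      fun j _ => z 7 (by omega) _, fun t t1 t2 => absurd (by omega) t2,
      fun t t1 t2 => absurd (by omega) t2, fun i => by rw [z 7 (by omega)]; omega,
      fun i => by rw [z 6 (by omega)]; omega⟩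
    rw [c2, c3]
    refine ⟨⟨by omega, by omega, fun i hi => hi, fun i i1 i2 => ?_, fun i i1 i2 => ?_⟩,
      fun i _ i1 i2 => ⟨i1, i2⟩, fun i hi => hi, fun A B C _ hH i i1 i2 => hH i ⟨i1, i2⟩, ?_, ?_, ?_, ?_,
      ?_, fun i i1 i2 => .inl ⟨z 4 (by omega) i, fun k _ k1 k2 => ?_⟩, ?_, ?_, ?_⟩
    · rw [n1 i (by omega), n2 (i + 1) (by omega)]
      exact ⟨by omega, by omega, by omega, by omega⟩
    · rw [n2 i (by omega), n1 (i - 1) (by omega)]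
      omega
    all_goals try exact fun t t1 t2 => absurd (by omega) t2
    rw [n1 i (by omega)] at k2
    omega
  · obtain ⟨⟨n1, n2⟩, g1⟩ := h₁
    obtain ⟨⟨k1, k2⟩, g2⟩ := h₂
    have g3 : Agree [(0, 5)] s₂ s₃ := h₃ ▸ (Agree.refl _ _).setWord (by decide)
    have hk : Keys X Y m (fun i => i ≤ m + 1) (fun _ => False) s₂ := by
      refine ⟨fun i _ i1 i2 _ => ?_, fun i hi => ?_⟩
      · rw [g2.wordArr 2 (by decide), g2.wordArr 3 (by decide)]
        exact k1 i i1 (by omega)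
      · rcases k2 i with h | h
        · exact absurd ⟨by omega, by omega, by omega⟩ hi
        · exact h
    exact (hk.agree g3 (by decide)).agree h₄.2 (by decide)
  · obtain ⟨Al, H, x, x1, x2, x3, x4⟩ := h₅
    exact run_root hs hpos x4 x1 x2 x3 (by omega)

end Peel

end CircleSep

namespace CircleSep

/-! ### Queries -/

section Query
variable {X Y : ℕ → ℝ} {m L W x : ℕ} {N : ℕ → Prop} {s s' : State} {q : ℂ} {ρ : ℝ}

theorem Ok.solve {s k e y : ℝ} (h0 : 0 ≤ y) (h : Ok s k |e| y) (hm : ∀ w, Ok s k |e| w → y ≤ w) :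
    Ok s k e (if e < 0 then 0 - y else y) ∧
      ∀ w, Ok s k e w → |if e < 0 then 0 - y else y| ≤ |w| := by
  refine ⟨h.of_abs, fun w hw => ?_⟩
  have : |if e < 0 then 0 - y else y| = y := by split_ifs <;> simp [abs_of_nonneg h0]
  rw [this]
  exact hm _ hw.abs

/-- No circle contains `u` and `v` and avoids the disk around `q`. -/
def Infeasible (u v q : ℂ) (ρ : ℝ) : Prop :=
  ∀ c r, dist c u ≤ r → dist c v ≤ r → ¬ r + ρ ≤ dist c q

/-- the current centre -/
def State.centre (s : State) : ℂ := ⟨s.real 23, s.real 24⟩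

theorem dist2_eval {i : WExp} : (dist2 i).eval s =
    dist s.centre (pt (s.realArr 2) (s.realArr 3) (i.eval s)) ^ 2 := by
  rw [dist_sq]
  simp only [dist2, pt, State.centre, RExp.eval_add, RExp.eval_mul, RExp.eval_sub, RExp.eval_get,
    RExp.eval_reg]
  ring

/-- The branches of the program are the hypotheses of the lemmas `Ok.solve_zero`, `Ok.solve_large`,
`Ok.solve_small` and `Ok.solve_none`, applied to the absolute value of the slope; the final branch
restores the sign. -/
theorem run_pairCircle {u v : ℕ} (hX : s.realArr 2 = X) (hY : s.realArr 3 = Y)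
    (h20 : s.word 20 = u) (h21 : s.word 21 = v) (h10 : s.real 10 = q.re) (h11 : s.real 11 = q.im)
    (h2 : s.real 2 = ρ) (hρ : 0 ≤ ρ) (huv : pt X Y u ≠ pt X Y v) (hW : 1 ≤ W) :
    Run W pairCircle s 20 fun s' =>
      s'.word 24 = 0 ∧ Infeasible (pt X Y u) (pt X Y v) q ρ ∨
      s'.word 24 = 1 ∧ PairOpt (pt X Y u) (pt X Y v) q ρ s'.centre ∧
        s'.real 25 = dist s'.centre (pt X Y u) ^ 2 := by
  subst hX hY
  set U := pt (s.realArr 2) (s.realArr 3) u with hU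
  set V := pt (s.realArr 2) (s.realArr 3) v with hV
  set S := ρ * √(len2 U V) with hS
  have hS0 : 0 ≤ S := by positivity
  refine Run.mono (Run.wp_seq (R := fun s₁ => s₁.real 12 = V.re - U.re ∧ s₁.real 13 = V.im - U.im ∧
    s₁.real 14 = len2 U V ∧ s₁.real 15 = (U.re + V.re) / 2 ∧ s₁.real 16 = (U.im + V.im) / 2 ∧
    s₁.real 17 = kk U V q ρ ∧ s₁.real 18 = ee U V q ∧ s₁.real 2 = ρ ∧ s₁.realArr = s.realArr ∧
    s₁.word = s.word) ?_ fun s₁ h₁ =>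
    Run.wp_seq (R := fun s₂ => (s₂.word 24 = 0 ∧ (∀ z, ¬ Ok S (kk U V q ρ) (ee U V q) z) ∨
      s₂.word 24 = 1 ∧ Ok S (kk U V q ρ) (ee U V q) (s₂.real 22) ∧
      ∀ w, Ok S (kk U V q ρ) (ee U V q) w → |s₂.real 22| ≤ |w|) ∧
      Agree [(0, 24), (1, 19), (1, 20), (1, 21), (1, 22)] s₁ s₂) ?_
      fun s₂ h₂ => (Run.of_wp (c := _ ;; _ ;; _) ?_)) (by simp [Prog.cost]) fun _ h => h
  · simp only [wp, RExp.eval_get, WExp.eval_reg, RExp.eval_reg, RExp.eval_add, RExp.eval_sub,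
      RExp.eval_mul, RExp.eval_div, RExp.eval_ofNat, State.setReal_real, State.setReal_realArr,
      State.setReal_word, h20, h21, h10, h11, h2]
    norm_num
    refine ⟨rfl, rfl, ?_, rfl, rfl, ?_, ?_⟩
    · simp only [len2, hU, hV, pt]; ring
    · simp only [kk, len2, hU, hV, pt]; ring
    · simp only [ee, hU, hV, pt]
  · obtain ⟨-, -, e14, -, -, e17, e18, e2, -, -⟩ := h₁
    -- The machine obtains an absolute value as the square root of a square.
    have habs : √(ee U V q * ee U V q) = |ee U V q| := Real.sqrt_mul_self_eq_abs _
    set k := kk U V q ρ with hk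
    set e := ee U V q with he
    have hE0 := abs_nonneg e
    have ag : ∀ (a b c d f : ℝ) (w : ℕ), Agree [(0, 24), (1, 19), (1, 20), (1, 21), (1, 22)] s₁
        ((((((s₁.setReal 19 a).setReal 20 b).setReal 21 c).setWord 24 w).setReal 22 d).setReal 22 f) :=
      fun a b c d f w => ((((((Agree.refl _ _).setReal (by decide)).setReal (by decide)).setReal
        (by decide)).setWord (by decide)).setReal (by decide)).setReal (by decide)
    have ag' : ∀ (a b c d : ℝ) (w : ℕ), Agree [(0, 24), (1, 19), (1, 20), (1, 21), (1, 22)] s₁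
        (((((s₁.setReal 19 a).setReal 20 b).setReal 21 c).setWord 24 w).setReal 22 d) :=
      fun a b c d w => (((((Agree.refl _ _).setReal (by decide)).setReal (by decide)).setReal
        (by decide)).setWord (by decide)).setReal (by decide)
    have ag0 : ∀ (a b c : ℝ) (w w' : ℕ), Agree [(0, 24), (1, 19), (1, 20), (1, 21), (1, 22)] s₁
        (((((s₁.setReal 19 a).setReal 20 b).setReal 21 c).setWord 24 w).setWord 24 w') :=
      fun a b c w w' => (((((Agree.refl _ _).setReal (by decide)).setReal (by decide)).setReal
        (by decide)).setWord (by decide)).setWord (by decide)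
    have ag0' : ∀ (a b c d : ℝ) (w w' : ℕ), Agree [(0, 24), (1, 19), (1, 20), (1, 21), (1, 22)] s₁
        ((((((s₁.setReal 19 a).setReal 20 b).setReal 21 c).setWord 24 w).setWord 24 w').setReal 22 d) :=
      fun a b c d w w' => (ag0 a b c w w').setReal (by decide)
    have fin : ∀ y, 0 ≤ y ∧ Ok S k |e| y ∧ (∀ w, Ok S k |e| w → y ≤ w) →
        (e < 0 → Ok S k e (0 - y) ∧ ∀ w, Ok S k e w → |0 - y| ≤ |w|) ∧
        (¬ e < 0 → Ok S k e y ∧ ∀ w, Ok S k e w → |y| ≤ |w|) := by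
      rintro y ⟨y1, y2, y3⟩
      have := Ok.solve y1 y2 y3
      refine ⟨fun h => ?_, fun h => ?_⟩
      · simpa only [if_pos h] using this
      · simpa only [if_neg h] using this
    simp only [wp, Test.holds, RExp.eval_reg, WExp.eval_ofNat, RExp.eval_sqrt, RExp.eval_add,
      RExp.eval_sub, RExp.eval_mul, RExp.eval_div, RExp.eval_ofNat, State.setReal_real,
      State.setReal_word, State.setWord_word, State.setWord_real, e14, e17, e18, e2, ← hS,
      not_lt, not_le, Nat.cast_ofNat, Nat.cast_zero, not_and]
    norm_num only [if_true, if_false]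
    simp only [habs]
    have hz : S ≤ k → Ok S k e 0 ∧ ∀ w, Ok S k e w → 0 ≤ |w| := fun h =>
      ⟨Ok.solve_zero h, fun w _ => abs_nonneg w⟩
    have hl := fun h h1 => fin _ (Ok.solve_large hS0 (k := k) (E := |e|) h h1)
    have hm := fun h h1 h2 => fin _ (Ok.solve_small (s := S) (k := k) h hE0 h1 h2)
    have hn : k < S → |e| ≤ S → (0 < k → |e| * |e| + k * k < S * S) → ∀ z, ¬ Ok S k e z :=
      fun h h1 h2 z hz => Ok.solve_none hS0 h hE0 h1 (fun h3 => by linarith [h2 h3.1, h3.2])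
        (abs_nonneg z) hz.abs
    exact ⟨hW, fun h => ⟨fun _ => ⟨.inr ⟨trivial, hz h⟩, ag _ _ _ _ _ _⟩,
        fun _ => ⟨.inr ⟨trivial, hz h⟩, ag' _ _ _ _ _⟩⟩,
      fun h => ⟨fun h1 => ⟨fun h' => ⟨.inr ⟨trivial, (hl h h1).1 h'⟩, ag _ _ _ _ _ _⟩,
        fun h' => ⟨.inr ⟨trivial, (hl h h1).2 h'.not_gt⟩, ag' _ _ _ _ _⟩⟩,
      fun h1 => ⟨fun h2 => ⟨fun h' => ⟨.inr ⟨trivial, (hm h h2.1 (by linarith [h2.2])).1 h'⟩,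
          ag _ _ _ _ _ _⟩, fun h' => ⟨.inr ⟨trivial, (hm h h2.1 (by linarith [h2.2])).2 h'.not_gt⟩,
          ag' _ _ _ _ _⟩⟩,
        fun h2 => ⟨Nat.zero_le _, fun _ => ⟨.inl ⟨trivial, hn h h1 h2⟩, ag0' _ _ _ _ _ _⟩,
          fun _ => ⟨.inl ⟨trivial, hn h h1 h2⟩, ag0 _ _ _ _ _⟩⟩⟩⟩⟩
  · obtain ⟨e12, e13, -, e15, e16, -, -, -, ea, ew⟩ := h₁
    obtain ⟨hor, hag⟩ := h₂
    have a2 : s₂.realArr = s.realArr := by rw [← ea]; funext i; exact hag.realArr i (by simp)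
    have w20 : s₂.word 20 = u := by rw [hag.word 20 (by decide), ew, h20]
    have cen : ∀ t, ((((s₂.setReal 23 (s₂.real 15 - s₂.real 22 * s₂.real 13)).setReal 24
        (s₂.real 16 + s₂.real 22 * s₂.real 12)).setReal 25 t).centre) = bis U V (s₂.real 22) := by
      intro t
      simp [State.centre, bis, hag.real 12 (by decide), hag.real 13 (by decide),
        hag.real 15 (by decide), hag.real 16 (by decide), e12, e13, e15, e16]
    have cen' : (((s₂.setReal 23 (s₂.real 15 - s₂.real 22 * s₂.real 13)).setReal 24
        (s₂.real 16 + s₂.real 22 * s₂.real 12)).centre) = bis U V (s₂.real 22) := by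
      rw [← cen 0]; simp [State.centre]
    simp only [wp, dist2_eval, RExp.eval_reg, RExp.eval_add, RExp.eval_sub, RExp.eval_mul,
      State.setReal_real, State.setReal_word, WExp.eval_reg, State.setReal_realArr, a2, w20]
    norm_num only [if_true, if_false]
    rw [cen, cen']
    refine hor.imp (fun h => ⟨h.1, fun c r h1 h2 h3 => ?_⟩)
      fun h => ⟨h.1, (pairOpt_bis huv hρ _).2 h.2, rfl⟩
    obtain ⟨z, -, hz⟩ := exists_bis_le huv h1 h2 h3
    exact h.2 z ((ok_iff hρ z).1 hz)

end Query

end CircleSep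

namespace CircleSep

/-! ### Testing an edge and a circumcircle -/

section Query
variable {X Y : ℕ → ℝ} {m L W x : ℕ} {N : ℕ → Prop} {s s' : State} {q : ℂ} {ρ : ℝ}

theorem Searchable.agree {l : List (Fin 4 × ℕ)} (h : Searchable X Y m L x N s) (ha : Agree l s s')
    (hl : ∀ c ∈ ((0 : Fin 4), 4) :: peelCells, c ∉ l) : Searchable X Y m L x N s' := by
  have h2 := ha.wordArr 2 (hl _ (by decide))
  have h3 := ha.wordArr 3 (hl _ (by decide))
  have h4 := ha.wordArr 4 (hl _ (by decide))
  have h5 := ha.wordArr 5 (hl _ (by decide))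
  have h6 := ha.wordArr 6 (hl _ (by decide))
  have h7 := ha.wordArr 7 (hl _ (by decide))
  have hr : s'.row m = s.row m := by funext t j; rw [State.row, h7, State.row]
  constructor
  · rw [ha.word 2 (hl _ (by decide))]; exact h.word_two
  · rw [ha.word 3 (hl _ (by decide))]; exact h.word_three
  · rw [ha.word 4 (hl _ (by decide))]; exact h.word_four
  · rw [ha.realArr 2 (hl _ (by decide))]; exact h.realX
  · rw [ha.realArr 3 (hl _ (by decide))]; exact h.realY
  · exact h.range
  · rw [h2, h3, h4, h5, h6, hr]; exact h.tree
  · rw [h7]; exact h.rowLe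
  · rw [h6]; exact h.opLe

/-- The memory during a query. -/
structure Asked (X Y : ℕ → ℝ) (m L x : ℕ) (N : ℕ → Prop) (q : ℂ) (ρ : ℝ) (s : State) : Prop
    extends Searchable X Y m L x N s where
  query_re : s.real 10 = q.re
  query_im : s.real 11 = q.im
  query_radius : s.real 2 = ρ
  radius_nonneg : 0 ≤ ρ

theorem Asked.agree {l : List (Fin 4 × ℕ)} (h : Asked X Y m L x N q ρ s) (ha : Agree l s s')
    (hl : ∀ c ∈ ((1 : Fin 4), 10) :: (1, 11) :: (1, 2) :: (0, 4) :: peelCells, c ∉ l) :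
    Asked X Y m L x N q ρ s' where
  toSearchable := h.toSearchable.agree ha fun c hc => hl c (by simp at hc ⊢; tauto)
  query_re := by rw [ha.real 10 (hl _ (by decide))]; exact h.query_re
  query_im := by rw [ha.real 11 (hl _ (by decide))]; exact h.query_im
  query_radius := by rw [ha.real 2 (hl _ (by decide))]; exact h.query_radius
  radius_nonneg := h.radius_nonneg

/-- The circle contains the points and avoids the disk around `q`. -/
def Feasible (X Y : ℕ → ℝ) (m : ℕ) (q : ℂ) (ρ : ℝ) (c : ℂ) (r : ℝ) : Prop :=
  (∀ i ≤ m, dist c (pt X Y i) ≤ r) ∧ r + ρ ≤ dist c q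

/-- The query has been answered. -/
def Solved (X Y : ℕ → ℝ) (m : ℕ) (q : ℂ) (ρ : ℝ) (s : State) : Prop :=
  s.word 28 = 1 ∧ (∃ R, 0 ≤ R ∧ s.real 25 = R ^ 2 ∧ Feasible X Y m q ρ s.centre R ∧
    ∀ c r, Feasible X Y m q ρ c r → R ≤ r) ∨
  s.word 28 = 2 ∧ ∀ c r, ¬ Feasible X Y m q ρ c r

/-- The result of testing an edge. -/
def EdgeResult (X Y : ℕ → ℝ) (q : ℂ) (ρ : ℝ) (u v o o' : ℕ) (s : State) : Prop :=
  s.word 24 = 0 ∧ Infeasible (pt X Y u) (pt X Y v) q ρ ∨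
  (PairOpt (pt X Y u) (pt X Y v) q ρ s.centre ∧ s.real 25 = dist s.centre (pt X Y u) ^ 2) ∧
    (s.word 24 = 1 ∧ dist s.centre (pt X Y o) ≤ dist s.centre (pt X Y u) ∧
      dist s.centre (pt X Y o') ≤ dist s.centre (pt X Y u) ∨
    s.word 24 = 2 ∧ dist s.centre (pt X Y o) ≤ dist s.centre (pt X Y u) ∧
      dist s.centre (pt X Y u) < dist s.centre (pt X Y o') ∨
    s.word 24 = 3 ∧ dist s.centre (pt X Y u) < dist s.centre (pt X Y o))

theorem run_tryEdge {u v o o' : ℕ} (h : Asked X Y m L x N q ρ s)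
    (h20 : s.word 20 = u) (h21 : s.word 21 = v) (h22 : s.word 22 = o) (h23 : s.word 23 = o')
    (huv : pt X Y u ≠ pt X Y v) (hW : 3 ≤ W) :
    Run W tryEdge s 24 (EdgeResult X Y q ρ u v o o') := by
  refine Run.mono (Run.seq (run_pairCircle (q := q) (ρ := ρ) h.realX h.realY h20 h21 h.query_re
    h.query_im h.query_radius h.radius_nonneg huv (by omega)).agree fun s₁ h₁ => Run.of_wp ?_)
    (by simp [Prog.cost]) fun _ h => h
  obtain ⟨hor, ha⟩ := h₁
  have e22 : s₁.word 22 = o := by rw [ha.word 22 (by decide), h22]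
  have e23 : s₁.word 23 = o' := by rw [ha.word 23 (by decide), h23]
  have eX : s₁.realArr 2 = X := by rw [ha.realArr 2 (by decide), h.realX]
  have eY : s₁.realArr 3 = Y := by rw [ha.realArr 3 (by decide), h.realY]
  simp only [wp, Test.holds, dist2_eval, WExp.eval_reg, WExp.eval_ofNat, RExp.eval_reg, eX, eY, e22,
    e23]
  rcases hor with ⟨h0, hi⟩ | ⟨h1, hp, h25⟩
  · exact ⟨fun _ => .inl ⟨h0, hi⟩, fun hc => (hc h0).elim⟩
  · have sq : ∀ a b : ℂ, dist s₁.centre a ^ 2 < dist s₁.centre b ^ 2 ↔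
        dist s₁.centre a < dist s₁.centre b := fun a b =>
      sq_lt_sq₀ dist_nonneg dist_nonneg
    simp only [h25, sq, not_lt]
    refine ⟨fun hc => by omega, fun _ => ⟨fun h2 => ⟨by omega, .inr ⟨⟨hp, h25⟩, ?_⟩⟩, fun h2 =>
      ⟨fun h3 => ⟨by omega, .inr ⟨⟨hp, h25⟩, ?_⟩⟩, fun h3 => .inr ⟨⟨hp, h25⟩, .inl ⟨h1, h2, h3⟩⟩⟩⟩⟩
    · exact .inr (.inr ⟨by simp, h2⟩)
    · exact .inr (.inl ⟨by simp, h2, h3⟩)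

theorem run_circum {t a b : ℕ} (h : Asked X Y m L x N q ρ s)
    (h27 : s.word 27 = t) (h29 : s.word 29 = a) (h30 : s.word 30 = b) (ht : tri X Y a t b ≠ 0)
    (hW : 2 ≤ W) : Run W circum s 12 fun s' => s'.real 25 = dist s'.centre (pt X Y a) ^ 2 ∧
      dist s'.centre (pt X Y a) = dist s'.centre (pt X Y t) ∧
      dist s'.centre (pt X Y a) = dist s'.centre (pt X Y b) ∧
      (s'.word 28 = 2 ∧ dist s'.centre q < dist s'.centre (pt X Y a) + ρ ∨
        s'.word 28 = 1 ∧ dist s'.centre (pt X Y a) + ρ ≤ dist s'.centre q) := by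
  refine (Run.of_wp (c := circum) (Q := fun s' => s'.real 25 = dist s'.centre (pt X Y a) ^ 2 ∧
      dist s'.centre (pt X Y a) = dist s'.centre (pt X Y t) ∧
      dist s'.centre (pt X Y a) = dist s'.centre (pt X Y b) ∧
      (s'.word 28 = 2 ∧ dist s'.centre q < dist s'.centre (pt X Y a) + ρ ∨
        s'.word 28 = 1 ∧ dist s'.centre (pt X Y a) + ρ ≤ dist s'.centre q)) ?_).mono
    (by simp [circum, Prog.cost]) fun _ h => h
  obtain ⟨o, ho⟩ : ∃ o : ℂ, o = ⟨X a + (((X t - X a) * (X t - X a) + (Y t - Y a) * (Y t - Y a)) *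
      (Y b - Y a) - ((X b - X a) * (X b - X a) + (Y b - Y a) * (Y b - Y a)) * (Y t - Y a)) /
        (2 * ((X t - X a) * (Y b - Y a) - (Y t - Y a) * (X b - X a))),
      Y a + ((X t - X a) * ((X b - X a) * (X b - X a) + (Y b - Y a) * (Y b - Y a)) -
      (X b - X a) * ((X t - X a) * (X t - X a) + (Y t - Y a) * (Y t - Y a))) /
        (2 * ((X t - X a) * (Y b - Y a) - (Y t - Y a) * (X b - X a)))⟩ := ⟨_, rfl⟩
  have hD : (X t - X a) * (Y b - Y a) - (Y t - Y a) * (X b - X a) ≠ 0 := by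
    intro e; apply ht; simp only [tri, cr]; linarith
  have d1 : dist o (pt X Y a) = dist o (pt X Y t) := by
    rw [← sq_eq_sq₀ dist_nonneg dist_nonneg, dist_sq, dist_sq, ho]
    simp only [pt]
    field_simp
    ring
  have d2 : dist o (pt X Y a) = dist o (pt X Y b) := by
    rw [← sq_eq_sq₀ dist_nonneg dist_nonneg, dist_sq, dist_sq, ho]
    simp only [pt]
    field_simp
    ring
  have hre := congrArg Complex.re ho
  have him := congrArg Complex.im ho
  simp only at hre him
  have hq : (o.re - q.re) * (o.re - q.re) + (o.im - q.im) * (o.im - q.im) = dist o q ^ 2 := by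
    rw [dist_sq]; ring
  have hlt : dist o q ^ 2 < (dist o (pt X Y a) + ρ) * (dist o (pt X Y a) + ρ) ↔
      dist o q < dist o (pt X Y a) + ρ := by
    rw [← sq, sq_lt_sq₀ dist_nonneg (add_nonneg dist_nonneg h.radius_nonneg)]
  simp only [circum, wp, Test.holds, dist2_eval, RExp.eval_reg, RExp.eval_add, RExp.eval_sub,
    RExp.eval_mul, RExp.eval_div, RExp.eval_get, RExp.eval_sqrt, RExp.eval_ofNat, WExp.eval_reg,
    WExp.eval_ofNat, State.setReal_real, State.setReal_word, State.setReal_realArr,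
    State.setWord_real, State.setWord_word, h27, h29, h30, h.realX, h.realY,
    h.query_re, h.query_im, h.query_radius, State.centre]
  norm_num only [if_true, if_false]
  rw [← hre, ← him, Complex.eta, Real.sqrt_sq dist_nonneg, hq, hlt]
  exact ⟨fun h' => ⟨hW, trivial, d1, d2, .inl ⟨trivial, h'⟩⟩,
    fun h' => ⟨by omega, trivial, d1, d2, .inr ⟨trivial, not_lt.1 h'⟩⟩⟩

end Query

end CircleSep

namespace CircleSep

/-! ### Handling one triangle of the search -/

section Visit
variable {X Y : ℕ → ℝ} {m L W x : ℕ} {N : ℕ → Prop} {s s' : State} {q : ℂ} {ρ : ℝ}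

theorem Feasible.dist_le {c : ℂ} {r : ℝ} (h : Feasible X Y m q ρ c r)
    (hl : pt X Y (m + 1) = pt X Y 0) {i : ℕ} (hi : i ≤ m + 1) : dist c (pt X Y i) ≤ r := by
  rcases hi.lt_or_eq with hi | rfl
  · exact h.1 i (by omega)
  · rw [hl]; exact h.1 0 (Nat.zero_le m)

/-- A separating circle contains `u` and `v`: if no circle does so, the query is infeasible, and
otherwise the minimum for the pair is a lower bound. It is attained when both apexes are inside, by
`EdgeOk`. Only the other two outcomes need `c` or `d`. -/
theorem run_dispatch {u v o o' T : ℕ} {c d : Prog} {Q : State → Prop}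
    (hr : EdgeResult X Y q ρ u v o o' s) (hl : pt X Y (m + 1) = pt X Y 0) (hu : u ≤ m + 1)
    (hv : v ≤ m + 1) (hok : EdgeOk X Y m u v o o') (hW : 2 ≤ W) (hT : 1 ≤ T)
    (hQ : ∀ w, Solved X Y m q ρ (s.setWord 28 w) → Q (s.setWord 28 w))
    (hc : PairOpt (pt X Y u) (pt X Y v) q ρ s.centre →
      dist s.centre (pt X Y o) ≤ dist s.centre (pt X Y u) →
      dist s.centre (pt X Y u) < dist s.centre (pt X Y o') → Run W c s T Q)
    (hd : PairOpt (pt X Y u) (pt X Y v) q ρ s.centre →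
      dist s.centre (pt X Y u) < dist s.centre (pt X Y o) → Run W d s T Q) :
    Run W (dispatch c d) s (T + 3) Q := by
  have set : ∀ w ≤ 2, Solved X Y m q ρ (s.setWord 28 w) → Run W (.setWord 28 (.const w)) s T Q :=
    fun w hw h => ⟨_, 1, .setWord s 28 (.const w) (hw.trans hW), hT, hQ w h⟩
  refine (Run.branch (T := T + 2) (fun h0 => ?_) fun h0 =>
    Run.branch (T := T + 1) (fun h1 => ?_) fun h1 => Run.branch (fun h2 => ?_) fun h2 => ?_)
  · refine (set 2 le_rfl (.inr ⟨by simp, fun c r hf => ?_⟩)).mono (by omega) fun _ h => h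
    simp only [Test.holds, WExp.eval_reg, WExp.eval_ofNat] at h0
    rcases hr with ⟨-, h⟩ | ⟨-, h⟩
    · exact h c r (hf.dist_le hl hu) (hf.dist_le hl hv) hf.2
    · omega
  · refine (set 1 (by omega) (.inl ⟨by simp, ?_⟩)).mono (by omega) fun _ h => h
    simp only [Test.holds, WExp.eval_reg, WExp.eval_ofNat] at h0 h1
    rcases hr with ⟨h, -⟩ | ⟨⟨hp, h25⟩, ⟨-, h2, h3⟩ | ⟨h, -⟩ | ⟨h, -⟩⟩
    · omega
    · exact ⟨_, dist_nonneg, h25, ⟨hok _ hp.eq h2 h3, hp.avoid⟩, fun c r hf =>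
        hp.min c r (hf.dist_le hl hu) (hf.dist_le hl hv) hf.2⟩
    · omega
    · omega
  · simp only [Test.holds, WExp.eval_reg, WExp.eval_ofNat] at h0 h1 h2
    rcases hr with ⟨h, -⟩ | ⟨⟨hp, -⟩, ⟨h, -⟩ | ⟨-, h3, h4⟩ | ⟨h, -⟩⟩
    · omega
    · omega
    · exact hc hp h3 h4
    · omega
  · simp only [Test.holds, WExp.eval_reg, WExp.eval_ofNat] at h0 h1 h2
    rcases hr with ⟨h, -⟩ | ⟨⟨hp, -⟩, ⟨h, -⟩ | ⟨h, -⟩ | ⟨-, h3⟩⟩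
    · omega
    · omega
    · omega
    · exact hd hp h3

theorem run_edge {u v o o' T : ℕ} {c d : Prog} {Q : State → Prop} (h : Asked X Y m L x N q ρ s)
    (h20 : s.word 20 = u) (h21 : s.word 21 = v) (h22 : s.word 22 = o) (h23 : s.word 23 = o')
    (huv : pt X Y u ≠ pt X Y v) (hu : u ≤ m + 1) (hv : v ≤ m + 1) (hok : EdgeOk X Y m u v o o')
    (hW : 3 ≤ W) (hT : 1 ≤ T) (hQ : ∀ s', Solved X Y m q ρ s' → Q s')
    (hc : ∀ s', Agree tryEdge.mods s s' → PairOpt (pt X Y u) (pt X Y v) q ρ s'.centre →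
      dist s'.centre (pt X Y o) ≤ dist s'.centre (pt X Y u) →
      dist s'.centre (pt X Y u) < dist s'.centre (pt X Y o') → Run W c s' T Q)
    (hd : ∀ s', Agree tryEdge.mods s s' → PairOpt (pt X Y u) (pt X Y v) q ρ s'.centre →
      dist s'.centre (pt X Y u) < dist s'.centre (pt X Y o) → Run W d s' T Q) :
    Run W (tryEdge ;; dispatch c d) s (T + 27) Q :=
  Run.mono ((run_tryEdge h h20 h21 h22 h23 huv hW).agree.seq fun s₁ h₁ =>
    run_dispatch h₁.1 h.tree.last hu hv hok (by omega) hT (fun w hw => hQ _ hw)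
      (fun hp h2 h3 => hc s₁ h₁.2 hp h2 h3) fun hp h2 => hd s₁ h₁.2 hp h2) (by omega) fun _ h => h

theorem pt_ne_of_tri {a t b : ℕ} (h : tri X Y a t b ≠ 0) :
    pt X Y a ≠ pt X Y t ∧ pt X Y t ≠ pt X Y b ∧ pt X Y a ≠ pt X Y b := by
  refine ⟨fun e => h ?_, fun e => h ?_, fun e => h ?_⟩ <;>
  · simp only [pt, Complex.mk.injEq] at e
    simp only [tri, cr, e.1, e.2]
    ring

/-- Unless a test settles the query, there are three possibilities: a lower edge points to a child,
where the search continues; or the base points out of the triangle, so its column can be excluded;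
or all three edges point inward, and the circumcircle decides. -/
theorem run_visit {y j u : ℕ} (h : Asked X Y m L x N q ρ s) (h25 : s.word 25 = y)
    (h27 : s.word 27 = u) (h28 : s.word 28 = 0) (hj : j < L) (hu : s.row m y j = u) (hu0 : u ≠ 0)
    (hi : SearchInv X Y L N (s.wordArr 2) (s.wordArr 3) (s.row m) q ρ y (j + 1))
    (hW : 3 ≤ W) (hmW : m + 1 ≤ W) : Run W visit s 130 fun s' => Solved X Y m q ρ s' ∨
      s'.word 28 = 0 ∧ ∃ y', s'.word 25 = y' ∧
        SearchInv X Y L N (s.wordArr 2) (s.wordArr 3) (s.row m) q ρ y' j := by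
  have ht := h.tree
  set nx := s.wordArr 2 with hnx
  set pv := s.wordArr 3 with hpv
  set ch := s.wordArr 4 with hch
  set lc := s.wordArr 5 with hlc
  set op := s.wordArr 6 with hop
  have hN : N u := by
    have := (ht.row_up hi.mem hj (by rw [hu]; exact hu0)).1
    rwa [hu] at this
  obtain ⟨b1, b2, b3⟩ := ht.mem u hN
  have bl : lc u ≤ m := by
    by_cases e : lc u = 0
    · omega
    · exact (h.range _ (ht.left u hN e).1).2
  have br : ch u ≤ m := by
    by_cases e : ch u = 0
    · omega
    · exact (h.range _ (ht.right u hN e).1).2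
  obtain ⟨n1, n2, n3⟩ := pt_ne_of_tri (ht.tri_ne u hN)
  let V : State → Prop := fun s' => Agree visit.mods s s' ∧ s'.word 25 = y ∧ s'.word 28 = 0 ∧
    s'.word 29 = pv u ∧ s'.word 30 = nx u ∧ s'.word 31 = lc u ∧ s'.word 32 = ch u
  have vask : ∀ {s'}, V s' → Asked X Y m L x N q ρ s' := fun h' => h.agree h'.1 (by decide)
  have vtry : ∀ {s' s''}, V s' → Agree tryEdge.mods s' s'' → V s'' := by
    rintro s' s'' ⟨h1, h2, h3, h4, h5, h6, h7⟩ ha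
    refine ⟨h1.trans (ha.mono (by decide)), ?_, ?_, ?_, ?_, ?_, ?_⟩
    all_goals rw [ha.word _ (by decide)]; assumption
  have v27 : ∀ {s'}, V s' → s'.word 27 = u := fun h' => by rw [h'.1.word 27 (by decide), h27]
  have v6 : ∀ {s'}, V s' → s'.wordArr 6 = op := fun h' => by rw [h'.1.wordArr 6 (by decide)]
  have fin : ∀ {s' w}, w ≤ W → SearchInv X Y L N nx pv (s.row m) q ρ w j → V s' →
      ∀ i, s'.word i = w → Run W (.setWord 25 (wr i)) s' 1 fun s' => Solved X Y m q ρ s' ∨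
        s'.word 28 = 0 ∧ ∃ y', s'.word 25 = y' ∧
          SearchInv X Y L N nx pv (s.row m) q ρ y' j := by
    rintro s' w hw hs ⟨-, -, h', -⟩ i rfl
    exact Run.of_wp (c := .setWord 25 (wr i)) ⟨hw, .inr ⟨by simp [h'], _, rfl, by simpa using hs⟩⟩
  refine Run.mono (Run.wp_seq (R := fun s' => V s' ∧ s'.word 20 = pv u ∧ s'.word 21 = u ∧
    s'.word 22 = nx u ∧ s'.word 23 = if lc u = 0 then pv u else lc u) ?_ fun s₁ h₁ =>
    run_edge (T := 91) (vask h₁.1) h₁.2.1 h₁.2.2.1 h₁.2.2.2.1 h₁.2.2.2.2 n1 (by omega) (by omega)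
      (ht.okLeft u hN) hW (by omega) (fun _ h => .inl h) (fun s₂ a₂ p₂ i₂ o₂ => ?_)
      fun s₂ a₂ p₂ o₂ => Run.mono (Run.wp_seq (R := fun s' => V s' ∧ s'.word 20 = u ∧
        s'.word 21 = nx u ∧ s'.word 22 = pv u ∧ s'.word 23 = if ch u = 0 then u else ch u) ?_
        fun s₃ h₃ => run_edge (T := 54) (vask h₃.1) h₃.2.1 h₃.2.2.1 h₃.2.2.2.1 h₃.2.2.2.2 n2
          (by omega) (by omega) (ht.okRight u hN) hW (by omega) (fun _ h => .inl h)
          (fun s₄ a₄ p₄ i₄ o₄ => ?_)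
          fun s₄ a₄ p₄ o₄ => Run.mono (Run.wp_seq (R := fun s' => V s' ∧ s'.word 20 = pv u ∧
            s'.word 21 = nx u ∧ s'.word 22 = u ∧ s'.word 23 = op u) ?_
            fun s₅ h₅ => run_edge (T := 12) (vask h₅.1) h₅.2.1 h₅.2.2.1 h₅.2.2.2.1 h₅.2.2.2.2 n3
              (by omega) (by omega) (ht.okUp u hN) hW (by omega) (fun _ h => .inl h)
              (fun s₆ a₆ p₆ i₆ o₆ => ?_) fun s₆ a₆ p₆ o₆ => ?_)
            (by simp [Prog.cost]) fun _ h => h)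
        (by simp [Prog.cost]) fun _ h => h) (by simp [Prog.cost]) fun _ h => h
  · simp only [wp, Test.holds, WExp.eval_reg, WExp.eval_get, WExp.eval_ofNat, State.setWord_word,
      State.setWord_wordArr, h27, ← hnx, ← hpv, ← hch, ← hlc]
    norm_num only [if_true, if_false]
    refine ⟨by omega, by omega, by omega, by omega, by omega, by omega, by omega,
      fun e => ⟨by omega, ⟨?_, ?_⟩, ?_⟩, fun e => ⟨by omega, ⟨?_, ?_⟩, ?_⟩⟩
    · exact ((((((((Agree.refl _ _).setWord (by decide)).setWord (by decide)).setWord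
        (by decide)).setWord (by decide)).setWord (by decide)).setWord (by decide)).setWord
        (by decide)).setWord (by decide)
    · simp [h25, h28]
    · simp [e]
    · exact ((((((((Agree.refl _ _).setWord (by decide)).setWord (by decide)).setWord
        (by decide)).setWord (by decide)).setWord (by decide)).setWord (by decide)).setWord
        (by decide)).setWord (by decide)
    · simp [h25, h28]
    · simp [e]
  -- A missing triangle is represented by an endpoint of the edge, which no circle through the
  -- endpoints can miss.
  · have e : lc u ≠ 0 := fun e => by rw [if_pos e] at o₂; exact lt_irrefl _ o₂
    rw [if_neg e] at o₂
    obtain ⟨l1, l2, l3⟩ := ht.left u hN e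
    have v := vtry h₁.1 a₂
    subst hu
    -- This edge is the base of the left child, and by uniqueness its minimum circle is the one just
    -- tested.
    exact (fin (by omega) (hi.goLeft ht hj hu0 e fun c hc => by
      rw [l2, l3] at hc
      rwa [l2, hc.unique n1 h.radius_nonneg p₂]) v 31 v.2.2.2.2.2.1).mono (by omega) fun _ h => h
  · have v := vtry h₁.1 a₂
    have w27 := v27 v
    obtain ⟨k1, k2, k3, k4, k5, k6, k7⟩ := v
    simp only [wp, Test.holds, WExp.eval_reg, WExp.eval_ofNat, State.setWord_word, w27, k4, k5, k7]
    norm_num only [if_true, if_false]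
    refine ⟨by omega, by omega, by omega, fun e => ⟨by omega, ⟨?_, ?_⟩, ?_⟩,
      fun e => ⟨by omega, ⟨?_, ?_⟩, ?_⟩⟩
    · exact (((k1.setWord (by decide)).setWord (by decide)).setWord (by decide)).setWord (by decide)
    · simp [k2, k3, k4, k5, k6, k7]
    · simp [e]
    · exact (((k1.setWord (by decide)).setWord (by decide)).setWord (by decide)).setWord (by decide)
    · simp [k2, k3, k4, k5, k6, k7]
    · simp [e]
  · have e : ch u ≠ 0 := fun e => by rw [if_pos e] at o₄; exact lt_irrefl _ o₄
    rw [if_neg e] at o₄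
    obtain ⟨l1, l2, l3⟩ := ht.right u hN e
    have v := vtry h₃.1 a₄
    subst hu
    exact (fin (by omega) (hi.goRight ht hj hu0 e fun c hc => by
      rw [l2, l3] at hc
      rwa [l2, hc.unique n2 h.radius_nonneg p₄]) v 32 v.2.2.2.2.2.2).mono (by omega) fun _ h => h
  · have v := vtry h₃.1 a₄
    have w27 := v27 v
    have w6 := v6 v
    have bo : op u ≤ m + 1 := h.opLe u
    obtain ⟨k1, k2, k3, k4, k5, k6, k7⟩ := v
    simp only [wp, WExp.eval_reg, WExp.eval_get, State.setWord_word, State.setWord_wordArr, w27, k4,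
      k5, w6]
    norm_num only [if_true, if_false]
    refine ⟨by omega, by omega, by omega, by omega, ⟨?_, ?_⟩, ?_⟩
    · exact (((k1.setWord (by decide)).setWord (by decide)).setWord (by decide)).setWord (by decide)
    · simp [k2, k3, k4, k5, k6, k7]
    · simp
  · have v := vtry h₅.1 a₆
    -- The minimum circle of the base contains the apex `u`, so the base does not point down.
    refine ⟨s₆, 1, .skip s₆, by omega, .inr ⟨v.2.2.1, y, v.2.1, hi.skip (.inr fun hd => ?_)⟩⟩
    rw [hu] at hd
    exact absurd (hd _ p₆) (not_lt.2 i₆)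
  · have v := vtry h₅.1 a₆
    refine (run_circum (vask v) (v27 v) v.2.2.2.1 v.2.2.2.2.1 (ht.tri_ne u hN) (by omega)).mono
      le_rfl fun s₇ ⟨k1, k2, k3, k4⟩ => .inl ?_
    -- All three edges point inward, so the circumcircle is feasible as soon as any circle is, and
    -- it is minimal.
    have key := fun (c : ℂ) (r : ℝ) (hf : Feasible X Y m q ρ c r) =>
      circum_min n3 n1 n2.symm h.radius_nonneg p₆ p₂ p₄ o₆ o₂ o₄ k3 k2
        (hf.dist_le ht.last (by omega)) (hf.dist_le ht.last b3) (hf.dist_le ht.last (by omega)) hf.2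
    rcases k4 with ⟨k4, k5⟩ | ⟨k4, k5⟩
    · exact .inr ⟨k4, fun c r hf => by linarith [(key c r hf).2]⟩
    · exact .inl ⟨k4, _, dist_nonneg, k1, ⟨ht.circ u hN _ k2 k3, k5⟩, fun c r hf => (key c r hf).1⟩

end Visit

end CircleSep

namespace CircleSep

/-! ### The search as a whole and the query program -/

section Answer
variable {X Y : ℕ → ℝ} {m L W x : ℕ} {N : ℕ → Prop} {s s' : State} {q : ℂ} {ρ : ℝ}

/-- The query has been answered, or the search goes on at the columns below `j`. -/
def Pending (X Y : ℕ → ℝ) (m L : ℕ) (N : ℕ → Prop) (nx pv : ℕ → ℕ) (row : ℕ → ℕ → ℕ) (q : ℂ)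
    (ρ : ℝ) (j : ℕ) (s : State) : Prop :=
  Solved X Y m q ρ s ∨ s.word 28 = 0 ∧ ∃ y, s.word 25 = y ∧ SearchInv X Y L N nx pv row q ρ y j

/-- Each iteration uses up one column of the rank table at constant cost, whether it moves `y` or
not. -/
theorem run_search (h : Asked X Y m L x N q ρ s) (h26 : s.word 26 = L)
    (hp : Pending X Y m L N (s.wordArr 2) (s.wordArr 3) (s.row m) q ρ L s)
    (hW : 3 ≤ W) (hmW : m + 1 ≤ W) (hLW : L ≤ W) :
    Run W search s (134 * L + 1) (Solved X Y m q ρ) := by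
  have ns : ∀ {s' : State}, s'.word 28 = 0 → ¬ Solved X Y m q ρ s' := by
    rintro s' h0 (⟨h1, -⟩ | ⟨h1, -⟩) <;> omega
  refine (Run.loop_agree (s := s) (T := 133) (Q := Solved X Y m q ρ) L
    (fun i s' => (s'.word 28 = 0 → i ≤ L ∧ s'.word 26 = L - i) ∧
      Pending X Y m L N (s.wordArr 2) (s.wordArr 3) (s.row m) q ρ (L - i) s')
    (fun i s' ha h1 hb => ?_) (fun i s' ha h1 hb => ?_) (i := 0)
    ⟨fun _ => ⟨Nat.zero_le _, h26⟩, hp⟩).mono (by rw [Nat.sub_zero, mul_comm]) fun _ h => h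
  · simp only [Test.holds, WExp.eval_reg, WExp.eval_ofNat] at hb
    obtain ⟨h0, hb⟩ := hb
    obtain ⟨hi, h26'⟩ := h1.1 h0
    obtain ⟨-, y, h25, hy⟩ := h1.2.resolve_left (ns h0)
    obtain ⟨j, hj⟩ : ∃ j, L - i = j + 1 := ⟨L - i - 1, by omega⟩
    have hj' : L - (i + 1) = j := by omega
    have hA := h.agree ha (by decide)
    have e2 : s'.wordArr 2 = s.wordArr 2 := ha.wordArr 2 (by decide)
    have e3 : s'.wordArr 3 = s.wordArr 3 := ha.wordArr 3 (by decide)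
    have er : s'.row m = s.row m := by
      funext t j; simp only [State.row, ha.wordArr 7 (by decide)]
    have hr : s'.row m y j ≤ m := hA.rowLe _
    rw [hj] at hy
    rw [hj']
    refine ⟨by omega, Run.mono (Run.wp_seq (T := 131) (R := fun s₁ =>
      Agree [(0, 26), (0, 27)] s' s₁ ∧ s₁.word 26 = j ∧ s₁.word 27 = s'.row m y j) ?_
      fun s₁ ⟨a₁, k26, k27⟩ => Run.branch (fun hb => ?_) fun hb => ?_) (by simp [Prog.cost])
      fun _ h => h⟩
    · simp only [wp, cell, WExp.eval_get, WExp.eval_add, WExp.eval_mul, WExp.eval_sub,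
        WExp.eval_reg, WExp.eval_ofNat, State.setWord_word, State.setWord_wordArr, h26', hj, h25,
        hA.word_two]
      norm_num only [if_true, if_false]
      simp only [Nat.add_sub_cancel]
      refine ⟨by omega, ?_, ?_, trivial, rfl⟩
      · exact hr.trans (by omega)
      · exact ((Agree.refl _ _).setWord (by decide)).setWord (by decide)
    · simp only [Test.holds, WExp.eval_reg, WExp.eval_ofNat] at hb
      refine ⟨s₁, 1, .skip s₁, by omega, fun _ => ⟨by omega, k26⟩, .inr ⟨?_, y, ?_, hy.skip (.inl ?_)⟩⟩
      · rw [a₁.word 28 (by decide), h0]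
      · rw [a₁.word 25 (by decide), h25]
      · rw [← er, ← k27, hb]
    · simp only [Test.holds, WExp.eval_reg, WExp.eval_ofNat] at hb
      have r1 : s₁.row m = s'.row m := by
        funext t j; simp only [State.row, a₁.wordArr 7 (by decide)]
      have f2 : s₁.wordArr 2 = s'.wordArr 2 := a₁.wordArr 2 (by decide)
      have f3 : s₁.wordArr 3 = s'.wordArr 3 := a₁.wordArr 3 (by decide)
      rw [← e2, ← e3, ← er, ← f2, ← f3, ← r1] at hy ⊢
      rw [← r1] at k27
      exact (run_visit (hA.agree a₁ (by decide)) (by rw [a₁.word 25 (by decide), h25]) k27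
        (by rw [a₁.word 28 (by decide), h0]) (by omega) rfl (by rw [← k27]; exact hb) hy hW
        hmW).agree.mono (by omega) fun s₂ ⟨k1, k2⟩ =>
          ⟨fun _ => ⟨by omega, by rw [k2.word 26 (by decide), k26]⟩, k1⟩
  · simp only [Test.holds, WExp.eval_reg, WExp.eval_ofNat, not_and] at hb
    -- An unanswered query at the end of the loop would have exhausted all columns, against
    -- `SearchInv.pos`.
    refine h1.2.resolve_right fun ⟨h0, y, _, hy⟩ => ?_
    have := hb h0
    have := h1.1 h0
    have := hy.pos h.tree
    omega

/-- The output of a query. -/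
def Replied (X Y : ℕ → ℝ) (m : ℕ) (q : ℂ) (ρ x₀ y₀ : ℝ) (s : State) : Prop :=
  s.word 1 = 1 ∧ (∃ c R, 0 ≤ R ∧ s.real 0 = c.re + x₀ ∧ s.real 1 = c.im + y₀ ∧ s.real 2 = R ∧
    Feasible X Y m q ρ c R ∧ ∀ c r, Feasible X Y m q ρ c r → R ≤ r) ∨
  s.word 1 = 0 ∧ ∀ c r, ¬ Feasible X Y m q ρ c r

/-- The root edge is tested first. If its circle misses the apex on one side, the triangle there
starts the search: its base is the root edge, and all columns are still open. -/
theorem run_query (h : Searchable X Y m L x N s) (hm : 0 < m) (hρ : 0 ≤ s.real 2)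
    (hW : 3 ≤ W) (hmW : m + 1 ≤ W) (hLW : L ≤ W) :
    Run W query s (134 * L + 60)
      (Replied X Y m ⟨s.real 0 - s.real 3, s.real 1 - s.real 4⟩ (s.real 2) (s.real 3) (s.real 4)) := by
  have ht := h.tree
  set q : ℂ := ⟨s.real 0 - s.real 3, s.real 1 - s.real 4⟩ with hq
  have l0 : s.wordArr 4 0 ≤ m := by
    by_cases e : s.wordArr 4 0 = 0
    · omega
    · exact (h.range _ (ht.rootLeft e).1).2
  have lx : s.wordArr 4 x ≤ m := by
    by_cases e : s.wordArr 4 x = 0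
    · omega
    · exact (h.range _ (ht.rootRight e).1).2
  have hx := ht.root_le
  let V : State → Prop := fun s' => Agree query.mods s s' ∧ Asked X Y m L x N q (s.real 2) s'
  have vagree : ∀ {l s' s''}, V s' → Agree l s' s'' → l ⊆ query.mods →
      (∀ c ∈ ((1 : Fin 4), 10) :: (1, 11) :: (1, 2) :: (0, 4) :: peelCells, c ∉ l) → V s'' :=
    fun h1 ha h2 h3 => ⟨h1.1.trans (ha.mono h2), h1.2.agree ha h3⟩
  refine (Run.branch (T := 134 * L + 59) (fun hb => ?_) fun hb => Run.mono
    (Run.wp_seq (R := fun s₁ => V s₁ ∧ s₁.word 20 = 0 ∧ s₁.word 21 = x ∧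
      s₁.word 22 = s.wordArr 4 0 ∧ s₁.word 23 = s.wordArr 4 x) ?_ fun s₁ h₁ =>
    Run.seq (run_tryEdge h₁.1.2 h₁.2.1 h₁.2.2.1 h₁.2.2.2.1 h₁.2.2.2.2 ht.root_ne hW).agree
      fun s₂ h₂ => Run.seq (T₁ := 6) (T₂ := 134 * L + 6) (R := fun s₃ => V s₃ ∧ s₃.word 26 = L ∧
        Pending X Y m L N (s.wordArr 2) (s.wordArr 3) (s.row m) q (s.real 2) L s₃) ?_
      fun s₃ h₃ => Run.seq (T₁ := 134 * L + 1) (T₂ := 5) (R := fun s₄ => V s₄ ∧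
        Solved X Y m q (s.real 2) s₄) ?_ fun s₄ h₄ => ?_)
    (by simp [Prog.cost]; omega) fun _ h => h)
  · simp only [Test.holds, WExp.eval_reg, WExp.eval_ofNat, h.word_two] at hb
    omega
  · simp only [wp, WExp.eval_reg, WExp.eval_get, WExp.eval_ofNat, RExp.eval_reg, RExp.eval_sub,
      State.setWord_word, State.setWord_wordArr, State.setReal_word, State.setReal_wordArr,
      State.setReal_real, h.word_four]
    norm_num only [if_true, if_false]
    have ag : ∀ a b c d e f, Agree [(1, 10), (1, 11), (0, 20), (0, 21), (0, 22), (0, 23)] s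
        ((((((s.setReal 10 a).setReal 11 b).setWord 20 c).setWord 21 d).setWord 22 e).setWord
          23 f) := fun a b c d e f => ((((((Agree.refl _ _).setReal (by decide)).setReal
        (by decide)).setWord (by decide)).setWord (by decide)).setWord (by decide)).setWord (by decide)
    exact ⟨by omega, by omega, by omega, by omega, ⟨(ag _ _ _ _ _ _).mono (by decide),
      h.agree (ag _ _ _ _ _ _) (by decide), by simp [hq], by simp [hq], by simp, hρ⟩,
      trivial, trivial, trivial, trivial⟩
  · obtain ⟨hr, ha⟩ := h₂
    have v := vagree h₁.1 ha (by decide) (by decide)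
    have e4 : s₂.wordArr 4 = s.wordArr 4 := v.1.wordArr 4 (by decide)
    have e3 := v.2.word_three
    have e4' := v.2.word_four
    have go : ∀ {s' y}, Agree [(0, 28), (0, 26)] s₂ s' → s'.word 28 = 0 → s'.word 26 = L → N y →
        y = s.wordArr 4 x ∨ y = s.wordArr 4 0 → Down X Y (s.wordArr 2) (s.wordArr 3) q (s.real 2) y →
        ∀ e : WExp, e.eval s' = y → Run W (.setWord 25 e) s' 1 fun s₃ => V s₃ ∧ s₃.word 26 = L ∧
          Pending X Y m L N (s.wordArr 2) (s.wordArr 3) (s.row m) q (s.real 2) L s₃ := by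
      rintro s' y a' w28 w26 hN hy hd e rfl
      have v' := vagree v a' (by decide) (by decide)
      refine Run.of_wp (c := .setWord 25 e) ⟨by omega, vagree v' ((Agree.refl [(0, 25)] _).setWord
        (by decide)) (by decide) (by decide), by simp [w26], .inr ⟨by simp [w28], _, by simp,
        hN, hd, fun j h1 h2 => by omega⟩⟩
    refine (Run.wp_seq (T := 5) (R := fun s' => s' = s₂.setWord 28 0) ?_ fun s' hs' =>
      Run.wp_seq (T := 4) (R := fun s'' => s'' = s'.setWord 26 L) ?_ fun s'' hs'' =>
      run_dispatch (T := 1) (u := 0) (v := x) (o := s.wordArr 4 0) (o' := s.wordArr 4 x)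
        (X := X) (Y := Y) (q := q) (ρ := s.real 2) ?_ ht.last (by omega) (by omega) ht.okRoot
        (by omega) le_rfl (fun w hw => ?_) (fun p i o => ?_) fun p o => ?_)
    · simp [wp]
    · subst hs'
      simp [wp, e3, hLW]
    · subst hs' hs''
      simpa [EdgeResult, State.centre] using hr
    · subst hs' hs''
      exact ⟨vagree v (((Agree.refl [(0, 28), (0, 26)] _).setWord (by decide)).setWord
        (by decide) |>.setWord (by decide)) (by decide) (by decide), by simp, .inl hw⟩
    · have e : s.wordArr 4 x ≠ 0 := fun e => by rw [e] at o; exact lt_irrefl _ o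
      obtain ⟨k1, k2, k3⟩ := ht.rootRight e
      have a'' : Agree [(0, 28), (0, 26)] s₂ s'' := by
        subst hs' hs''
        exact ((Agree.refl _ _).setWord (by decide)).setWord (by decide)
      refine go a'' (by simp [hs'', hs']) (by simp [hs'']) k1 (.inl rfl) (fun c hc => ?_) _ ?_
      -- The base of this triangle runs from `x` to `m + 1`, so it is the root edge in the opposite
      -- direction.
      · rw [k2, k3, ht.last] at hc
        rwa [k2, hc.symm.unique ht.root_ne hρ p, ← p.eq]
      · simp [a''.wordArr 4 (by decide), a''.word 4 (by decide), e4, e4']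
    · have e : s.wordArr 4 0 ≠ 0 := fun e => by rw [e] at o; exact lt_irrefl _ o
      obtain ⟨k1, k2, k3⟩ := ht.rootLeft e
      have a'' : Agree [(0, 28), (0, 26)] s₂ s'' := by
        subst hs' hs''
        exact ((Agree.refl _ _).setWord (by decide)).setWord (by decide)
      refine go a'' (by simp [hs'', hs']) (by simp [hs'']) k1 (.inr rfl) (fun c hc => ?_) _ ?_
      · rw [k2, k3] at hc
        rwa [k2, hc.unique ht.root_ne hρ p]
      · simp [a''.wordArr 4 (by decide), e4]
  · obtain ⟨v, h26, hp⟩ := h₃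
    have f2 : s₃.wordArr 2 = s.wordArr 2 := v.1.wordArr 2 (by decide)
    have f3 : s₃.wordArr 3 = s.wordArr 3 := v.1.wordArr 3 (by decide)
    have fr : s₃.row m = s.row m := by
      funext t j; simp only [State.row, v.1.wordArr 7 (by decide)]
    rw [← f2, ← f3, ← fr] at hp
    exact (run_search v.2 h26 hp hW hmW hLW).agree.mono le_rfl fun s₄ h₄ =>
      ⟨vagree v h₄.2 (by decide) (by decide), h₄.1⟩
  · obtain ⟨v, hs⟩ := h₄
    have r3 : s₄.real 3 = s.real 3 := v.1.real 3 (by decide)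
    have r4 : s₄.real 4 = s.real 4 := v.1.real 4 (by decide)
    refine (Run.of_wp (c := .branch _ _ _) ?_).mono (by simp [Prog.cost]) fun _ h => h
    simp only [wp, Test.holds, WExp.eval_reg, WExp.eval_ofNat, RExp.eval_reg, RExp.eval_add,
      RExp.eval_sqrt, State.setReal_real]
    norm_num only [if_true, if_false]
    rcases hs with ⟨w, R, hR, e, hf, hmin⟩ | ⟨w, hno⟩
    · refine ⟨fun _ => ⟨by omega, .inl ⟨by simp, s₄.centre, R, hR, ?_, ?_, ?_, hf, hmin⟩⟩,
        fun hc => (hc w).elim⟩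
      · simp [State.centre, r3]
      · simp [State.centre, r4]
      · simp [e, Real.sqrt_sq hR]
    · exact ⟨fun hc => by omega, fun _ => ⟨by omega, .inr ⟨by simp, hno⟩⟩⟩

theorem run_query_single (h2 : s.word 2 = 0) (hW : 1 ≤ W) :
    Run W query s 60 fun s' => s'.word 1 = 1 ∧ s'.real 0 = s.real 3 ∧ s'.real 1 = s.real 4 ∧
      s'.real 2 = 0 := by
  refine (Run.branch (T := 4) (fun _ => Run.of_wp (c := _ ;; _ ;; _ ;; _) ?_) fun hb => ?_).mono
    (by omega) fun _ h => h
  · simp [wp, hW]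
  · simp [h2] at hb

end Answer

end CircleSep

namespace CircleSep

/-! ### The plane as the complex numbers -/

/-- A point of the plane relative to the base point `b`. -/
def toC (b p : Plane) : ℂ := ⟨p 0 - b 0, p 1 - b 1⟩

theorem dist_toC (b p q : Plane) : dist (toC b p) (toC b q) = dist p q := by
  rw [EuclideanSpace.dist_eq, Complex.dist_eq_re_im, Fin.sum_univ_two, Real.dist_eq, Real.dist_eq,
    sq_abs, sq_abs]
  simp [toC]

theorem toC_surjective (b : Plane) : Function.Surjective (toC b) := fun c =>
  ⟨!₂[c.re + b 0, c.im + b 1], by simp [toC]⟩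

/-! ### Back to circles in the plane -/

section Separation
variable {n : ℕ} {P : Fin n → Plane} {X Y : ℕ → ℝ} {b : Plane}

/-- The points of `P`, relative to `b`, are those at the positions `0`, ..., `n - 1`. -/
structure Placed (P : Fin n → Plane) (b : Plane) (X Y : ℕ → ℝ) : Prop where
  origin : ∀ k ≤ n - 1, ∃ i, pt X Y k = toC b (P i)
  placed : ∀ i, ∃ k ≤ n - 1, pt X Y k = toC b (P i)

/-- Two distinct points force a positive radius. The interior of the disk is then the open ball,
whose disjointness from the query disk is the inequality between distance and radii; this also
covers query points. -/
theorem isSeparating_iff (hP : Function.Injective P) (hn : 0 < n - 1) (h : Placed P b X Y)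
    (Q C : Circle) : IsSeparating P Q.region C ↔
      Feasible X Y (n - 1) (toC b Q.center) Q.radius (toC b C.center) C.radius := by
  have e : (∀ i, P i ∈ C.region) ↔ ∀ k ≤ n - 1, dist (toC b C.center) (pt X Y k) ≤ C.radius := by
    refine ⟨fun h' k hk => ?_, fun h' i => ?_⟩
    · obtain ⟨i, hi⟩ := h.origin k hk
      rw [hi, dist_toC, dist_comm]
      exact h' i
    · obtain ⟨k, hk, hi⟩ := h.placed i
      have := h' k hk
      rwa [hi, dist_toC, dist_comm] at this
  rw [IsSeparating, Feasible, ← e, dist_toC]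
  refine and_congr_right fun h' => ?_
  have hr : 0 < C.radius := by
    refine lt_of_le_of_ne C.radius_nonneg fun h0 => ?_
    have : ∀ i, P i = C.center := fun i => by
      have := h' i
      rwa [Circle.region, ← h0, Metric.closedBall_zero, Set.mem_singleton_iff] at this
    have := congrArg Fin.val (hP ((this ⟨0, by omega⟩).trans (this ⟨1, by omega⟩).symm))
    simp at this
  rw [Circle.region, Circle.region, interior_closedBall _ hr.ne',
    disjoint_ball_closedBall_iff hr Q.radius_nonneg]

theorem Replied.answers {s : State} (hP : Function.Injective P) (hn : 0 < n - 1)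
    (h : Placed P b X Y) {Q : Circle}
    (hs : Replied X Y (n - 1) (toC b Q.center) Q.radius (b 0) (b 1) s) : s.Answers P Q := by
  rcases hs with ⟨h1, c, R, hR, r0, r1, r2, hf, hm⟩ | ⟨h1, hno⟩
  · obtain ⟨p, rfl⟩ := toC_surjective b c
    refine .inl ⟨h1, ⟨p, R, hR⟩, ⟨(isSeparating_iff hP hn h Q _).2 hf, fun C' h' =>
      hm _ _ ((isSeparating_iff hP hn h Q C').1 h')⟩, ?_, ?_, r2⟩
    · simp [r0, toC]
    · simp [r1, toC]
  · exact .inr ⟨h1, fun C h' => hno _ _ ((isSeparating_iff hP hn h Q C).1 h')⟩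

/-- A disk of radius zero has empty interior, so it separates its centre from every query. -/
theorem isMinSeparating_single (P : Fin n → Plane) (p : Plane) (hp : ∀ i, P i = p) (Q : Set Plane) :
    IsMinSeparating P Q ⟨p, 0, le_rfl⟩ := by
  refine ⟨⟨fun i => by simp [Circle.region, hp i], ?_⟩, fun C _ => C.radius_nonneg⟩
  simp [Circle.region]

/-- The memory after preprocessing. -/
structure Ready (P : Fin n → Plane) (s : State) : Prop where
  word_two : s.word 2 = n - 1
  base : ∃ p, s.real 3 = P p 0 ∧ s.real 4 = P p 1 ∧ (0 < n - 1 → ∃ X Y x N,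
    Searchable X Y (n - 1) (Nat.log 2 n + 1) x N s ∧ Placed P (P p) X Y)

/-- Queries write no cell on which the result of the preprocessing depends, so any number of them
can follow one another. -/
theorem Ready.agree {s s' : State} (h : Ready P s) (ha : Agree query.mods s s') : Ready P s' := by
  obtain ⟨p, h3, h4, hs⟩ := h.base
  refine ⟨by rw [ha.word 2 (by decide), h.word_two], p, by rw [ha.real 3 (by decide), h3],
    by rw [ha.real 4 (by decide), h4], fun hn => ?_⟩
  obtain ⟨X, Y, x, N, h5, h6⟩ := hs hn
  exact ⟨X, Y, x, N, h5.agree ha (by decide), h6⟩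

theorem agree_enter (s : State) (Q : Circle) : Agree query.mods s (s.enter Q) :=
  (((Agree.refl _ _).setReal (by decide)).setReal (by decide)).setReal (by decide)

theorem log_succ_le (hn : 1 ≤ n) : Nat.log 2 n + 1 ≤ n := by
  have := Nat.log_lt_of_lt_pow (b := 2) (by omega) (Nat.lt_two_pow_self (n := n))
  omega

theorem run_preprocess {W : ℕ} (hn : 1 ≤ n) (hP : Function.Injective P)
    (hW : (n + 1) * (n + 1) ≤ W) :
    Run W preprocess (inputState P) (240 * (n * (Nat.log 2 n + 1))) (Ready P) := by
  have val : ∀ a, a < 2 → ∀ j (h : j < n), (inputState P).realArr a j =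
      if a = 0 then P ⟨j, h⟩ 0 else P ⟨j, h⟩ 1 := by
    intro a ha j h
    have : a = 0 ∨ a = 1 := by omega
    rcases this with rfl | rfl <;> simp [inputState, h]
  have ext2 : ∀ p q : Plane, p 0 = q 0 → p 1 = q 1 → p = q := fun p q h0 h1 => by
    ext i; fin_cases i <;> assumption
  have hL := log_succ_le hn
  have time : 70 * (n * (Nat.log 2 n + 1)) + (((n - 1) * (23 * (Nat.log 2 n + 1) + 87) + 50) + 1) ≤
      240 * (n * (Nat.log 2 n + 1)) := by
    obtain ⟨k, rfl⟩ : ∃ k, n = k + 1 := ⟨n - 1, by omega⟩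
    rw [Nat.add_sub_cancel]
    nlinarith [Nat.zero_le (k * Nat.log 2 (k + 1)), Nat.zero_le (Nat.log 2 (k + 1))]
  refine Run.mono (Run.seq (run_sortPoints (n := n) (px := (inputState P).realArr 0)
    (py := (inputState P).realArr 1) (by simp [inputState]) hn (by nlinarith) rfl rfl
    (fun a ha i => ?_) (fun _ _ => rfl) fun i hi j hj h0 h1 => ?_) fun s ⟨p, h⟩ =>
    Run.branch (fun hb => ?_) fun hb => ?_) time fun _ h => h
  · have h0 : a ≠ 0 := by omega
    have h1 : a ≠ 1 := by omega
    simp [inputState, h0, h1]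
  · rw [val 0 (by omega) i hi, val 0 (by omega) j hj] at h0
    rw [val 1 (by omega) i hi, val 1 (by omega) j hj] at h1
    exact congrArg Fin.val (hP (ext2 _ _ (by simpa using h0) (by simpa using h1)))
  · simp only [Test.holds, WExp.eval_reg, WExp.eval_ofNat, h.word_two] at hb
    refine ⟨s, 1, .skip s, by omega, h.word_two, ⟨p, h.lt⟩, ?_, ?_, fun hn => by omega⟩
    · rw [h.baseX, val 0 (by omega) p h.lt, if_pos rfl]
    · rw [h.baseY, val 1 (by omega) p h.lt, if_neg (by omega)]
  · simp only [Test.holds, WExp.eval_reg, WExp.eval_ofNat, h.word_two] at hb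
    have rel : ∀ j (hj : j < n), (⟨(inputState P).realArr 0 j - (inputState P).realArr 0 p,
        (inputState P).realArr 1 j - (inputState P).realArr 1 p⟩ : ℂ) =
        toC (P ⟨p, h.lt⟩) (P ⟨j, hj⟩) := by
      intro j hj
      rw [val 0 (by omega) j hj, val 0 (by omega) p h.lt, val 1 (by omega) j hj,
        val 1 (by omega) p h.lt]
      simp [toC]
    have zero : pt (s.realArr 2) (s.realArr 3) 0 = toC (P ⟨p, h.lt⟩) (P ⟨p, h.lt⟩) := by
      simp [pt, toC, h.sorted.X0, h.sorted.Y0]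
    refine (run_triangulate h.sorted (fun k h1 h2 => h.pos k h1 (by omega)) (by omega) h.word_two
      h.word_three rfl rfl h.zero ?_ (by omega) ?_).agree.mono le_rfl
      fun s' ⟨⟨x, N, hs⟩, ha⟩ => ⟨hs.word_two, ⟨p, h.lt⟩, ?_, ?_, fun _ => ⟨_, _, x, N, hs,
        fun k hk => ?_, fun i => ?_⟩⟩
    · rw [Nat.sub_add_cancel hn]; exact Nat.lt_pow_succ_log_self (by omega) n
    · rwa [show n - 1 + 2 = n + 1 by omega]
    · rw [ha.real 3 (by decide), h.baseX, val 0 (by omega) p h.lt, if_pos rfl]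
    · rw [ha.real 4 (by decide), h.baseY, val 1 (by omega) p h.lt, if_neg (by omega)]
    · rcases k.eq_zero_or_pos with rfl | h0
      · exact ⟨_, zero⟩
      · obtain ⟨j, hj, -, e1, e2⟩ := h.origin k h0 (by omega)
        exact ⟨⟨j, hj⟩, by rw [pt, e1, e2, rel j hj]⟩
    · by_cases hi : i.1 = p
      · exact ⟨0, Nat.zero_le _, by rw [zero]; congr 1; exact congrArg P (Fin.ext hi.symm)⟩
      · obtain ⟨k, k1, k2, e1, e2⟩ := h.placed i i.2 hi
        exact ⟨k, by omega, by rw [pt, e1, e2, rel i i.2]⟩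

theorem Ready.run_query {W : ℕ} {s : State} (hn : 1 ≤ n) (hP : Function.Injective P)
    (hW : (n + 1) * (n + 1) ≤ W) (h : Ready P s) (Q : Circle) :
    Run W query (s.enter Q) (240 * (Nat.log 2 n + 1)) fun s' => s'.Answers P Q ∧ Ready P s' := by
  have hr := h.agree (agree_enter s Q)
  have hL := log_succ_le hn
  obtain ⟨p, h3, h4, hs⟩ := hr.base
  have e0 : (s.enter Q).real 0 = Q.center 0 := by simp [State.enter]
  have e1 : (s.enter Q).real 1 = Q.center 1 := by simp [State.enter]
  have e2 : (s.enter Q).real 2 = Q.radius := by simp [State.enter]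
  rcases Nat.eq_zero_or_pos (n - 1) with hn' | hn'
  · refine (run_query_single (by rw [hr.word_two, hn']) (by nlinarith)).agree.mono (by omega)
      fun s' ⟨⟨k1, k2, k3, k4⟩, ha⟩ => ⟨.inl ⟨k1, ⟨P p, 0, le_rfl⟩,
        isMinSeparating_single P _ (fun i => congrArg P (Fin.ext (by omega))) _, ?_, ?_, k4⟩,
        hr.agree ha⟩
    · rw [k2, h3]
    · rw [k3, h4]
  · obtain ⟨X, Y, x, N, hs, hp⟩ := hs hn'
    refine (CircleSep.run_query (W := W) hs hn' (by rw [e2]; exact Q.radius_nonneg) (by nlinarith)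
      (by rw [Nat.sub_add_cancel hn]; nlinarith) (by nlinarith)).agree.mono (by omega)
      fun s' ⟨k, ha⟩ => ⟨Replied.answers hP hn' hp ?_, hr.agree ha⟩
    rwa [e0, e1, e2, h3, h4] at k

end Separation

end CircleSep

theorem mainTheorem3 :
    ∃ (preprocess query : CircleSep.Prog) (K : ℕ),
      ∀ (n : ℕ) (_ : 1 ≤ n) (P : Fin n → CircleSep.Plane) (_ : Function.Injective P),
        ∃ Ready : CircleSep.State → Prop,
          (∃ (s : CircleSep.State) (t : ℕ),
            CircleSep.Exec ((n + 1) ^ K) preprocess (CircleSep.inputState P) s t ∧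
            t ≤ K * (n * (Nat.log 2 n + 1)) ∧ Ready s) ∧
          ∀ s : CircleSep.State, Ready s → ∀ Q : CircleSep.Circle,
            ∃ (s' : CircleSep.State) (t : ℕ),
              CircleSep.Exec ((n + 1) ^ K) query (s.enter Q) s' t ∧
              t ≤ K * (Nat.log 2 n + 1) ∧ s'.Answers P Q ∧ Ready s' := by
  refine ⟨CircleSep.preprocess, CircleSep.query, 240, fun n hn P hP => ⟨CircleSep.Ready P, ?_⟩⟩
  -- The same constant serves for the times and the word size; the rank table only needs an exponent
  -- of two, having rows of length `n + 1`.
  have hW : (n + 1) * (n + 1) ≤ (n + 1) ^ 240 := by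
    rw [← sq]; exact Nat.pow_le_pow_right (Nat.succ_pos n) (by norm_num)
  exact ⟨CircleSep.run_preprocess hn hP hW, fun s hs Q => hs.run_query hn hP hW Q⟩
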